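/- **Moulds.** A mould is a function $M^\bullet$ of finite words $(s_1,\dots,s_r)$, $r\ge 0$, here with letters in $\mathbb N^*=\{1,2,\dots\}$. Put $|s|=\sum_i s_i$ and $$(A\times B)^{s}=\sum_{s's''=s}A^{s'}B^{s''},\qquad (A\circ B)^{s}=\sum_{s^1\cdots s^t=s,\ s^i\neq\emptyset}A^{|s^1|,\dots,|s^t|}\,B^{s^1}\cdots B^{s^t}.$$ Let $1^\bullet$ be the unit for $\times$, $\mathrm{logmu}(M)=\sum_{m\ge1}\frac{(-1)^{m-1}}{m}(M-1)^{\times m}$ and $\mathrm{inv}(M)=\sum_{m\ge 0}(1-M)^{\times m}$ (for $M^\emptyset=1$). Let $(E-1)^\emptyset=0$, $(E-1)^{s_1,\dots,s_r}=1/r!$ for $r\geq1$, and $K^{s_1,\dots,s_r}=K_r$ with $$\sum_{r\ge0}K_r\,t^r=2\tanh(t/2).$$ **Normalisation.** Fix $c\in\mathbb C$. Let $\mathrm{coSe}_k^{s}=(c+\log k)^r/r!$ and $\mathrm{invcoSe}_k^{s}=(-c-\log k)^r/r!$ if $s=(1,\dots,1)$ ($r\ge0$ letters), and $\mathrm{coSe}_k^{s}=\mathrm{invcoSe}_k^{s}=0$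 for all other $s$. **Multitangents.** For $z\in\mathbb C\setminus\mathbb Z$ let $\mathrm{doTe}_k^{s}(z)=\sum_{k\ge n_1>\dots>n_r\ge -k}\prod_i(n_i+z)^{-s_i}$ and $$\mathrm{Te}^\bullet(z)=\lim_{k\to\infty}\mathrm{invcoSe}_k^\bullet\times \mathrm{doTe}_k^\bullet(z)\times \mathrm{coSe}_k^\bullet ,\qquad \mathrm{Ta}^\bullet=\mathrm{Te}^\bullet\circ(E-1)^\bullet,\qquad \mathrm{Tan}^\bullet=\mathrm{logmu}(\mathrm{Ta}^\bullet).$$ (If $s_1,s_r\ne1$, then $\mathrm{Te}^{s}(z)=\sum_{n_1>\dots>n_r}\prod_i(n_i+z)^{-s_i}$ without any correction.) **The moulds See and Teen.** Let $H$ be the odd function $H(\partial)=\frac{e^\partial}{1-e^\partial}+\frac12=-\frac12\coth\frac{\partial}{2}$. With $e^{\partial}$ acting as the unit shift it has the two realisations $H_+=\frac12+\sum_{n\ge1}e^{n\partial}$ and $H_-=-\frac12-\sum_{n\ge1}e^{-n\partial}$. The moulds $\mathrm{See}_\pm^\bullet$ are given by $\mathrm{See}_\pm^\emptyset=1$ and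 $$\mathrm{See}_\pm^{s_1,\dots,s_r}(z)=H_\pm\big(\mathrm{See}_\pm^{s_1,\dots,s_{r-1}}(z)\,z^{-s_r}\big).$$ The resulting multiple sums are truncated to the points $z,z\pm1,\dots,z\pm k$, multiplied on the left by $\mathrm{invcoSe}_k^\bullet$, and taken to the limit $k\to\infty$ (the correction acts trivially if $s_1\neq1$). Let $\mathrm{Tee}^\bullet(z)=\mathrm{See}_+^\bullet(z)\times \mathrm{inv}(\mathrm{See}_-^\bullet(z))$ and $\mathrm{Teen}^\bullet=\mathrm{logmu}(\mathrm{Tee}^\bullet)$. **Fourier coefficients.** For $\omega\in\Omega=2\pi i\,\mathbb Z^*$ and $T\in\{\mathrm{Tan},\mathrm{Teen}\}$ let $T_\omega^{s}=\int_0^1 T^{s}(x+iy)\,e^{\omega(x+iy)}\,dx$, with $y=1$ if $\omega\in\Omega^-=-2\pi i\,\mathbb N^*$ and $y=-1$ if $\omega\in\Omega^+=2\pi i\,\mathbb N^*$. **Theorem.** For every $c\in\mathbb C$ and every word $s=(s_1,\dots,s_r)$, $r\ge0$, of positive integers: 1. For every $z\in\mathbb C\setminus\mathbb Z$ the limits defining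 $\mathrm{Te}^{s}(z)$ and $\mathrm{See}_\pm^{s}(z)$ exist. If $r\geq1$ and $s_1\ne1$, then $\mathrm{See}_+^{s}(z)=\int_0^{+\infty}\widehat{\mathrm{See}}^{s}(\zeta)e^{-\zeta z}d\zeta$ for $\Re z>0$ and $\mathrm{See}_-^{s}(z)=\int_0^{-\infty}\widehat{\mathrm{See}}^{s}(\zeta)e^{-\zeta z}d\zeta$ for $\Re z<0$, the integrals being absolutely convergent, where $\widehat{\mathrm{See}}^{s_1}(\zeta)=H(-\zeta)\frac{\zeta^{s_1-1}}{(s_1-1)!}$ and $\widehat{\mathrm{See}}^{s_1,\dots,s_r}(\zeta)=H(-\zeta)\int_0^\zeta\widehat{\mathrm{See}}^{s_1,\dots,s_{r-1}}(\zeta-\tau)\frac{\tau^{s_r-1}}{(s_r-1)!}d\tau$ for $r\ge2$. 2. $\mathrm{Tan}^{s}(z)=(\mathrm{Teen}^\bullet(z)\circ K^\bullet)^{s}$ for all $z\in\mathbb C\setminus\mathbb Z$. 3. $\mathrm{Tan}_\omega^{s}=(\mathrm{Teen}_\omega^\bullet\circ K^\bullet)^{s}$ for all $\omega\in\Omega$.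 If $s_1\neq1$ and $s_r\ne1$ (in particular for $s=\emptyset$), then for both $T=\mathrm{Tan}$ and $T=\mathrm{Teen}$ one has $T^{s}(z)=\sum_{\omega\in\Omega^-}T^{s}_\omega e^{-\omega z}$ for $\Im z>0$ and $T^{s}(z)=\sum_{\omega\in\Omega^+}T^{s}_\omega e^{-\omega z}$ for $\Im z<0$. 4. As functions of $z$, both $\mathrm{Teen}^{s}$ and $\mathrm{Tan}^{s}$ have the parity of $1-r+\sum s_i$: for $T\in\{\mathrm{Teen},\mathrm{Tan}\}$ and $z\in\mathbb C\setminus\mathbb Z$, $T^{s}(-z)=(-1)^{1-r+\sum s_i}\,T^{s}(z)$. -/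

import Mathlib

open scoped BigOperators

noncomputable section

/-- A complex-valued mould: a function of finite words `(s₁, …, s_r)` of integers. -/
abbrev Mould : Type := List ℕ → ℂ

/-- The multiplication unit. -/
def mouldOne : Mould := fun w => if w = [] then 1 else 0

/-- Mould multiplication: sum over all factorisations `w = w' w''`. -/
def mouldMul (A B : Mould) : Mould := fun w =>
  ∑ i ∈ Finset.range (w.length + 1), A (w.take i) * B (w.drop i)

/-- Powers with respect to mould multiplication. -/
def mouldPow (A : Mould) : ℕ → Mould
  | 0 => mouldOne
  | n + 1 => mouldMul (mouldPow A n) A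

/-- Mould composition: sum over all factorisations `w = w¹ … wᵗ` into nonempty words of
`A^{|w¹|,…,|wᵗ|} B^{w¹} ⋯ B^{wᵗ}`, where `|v|` is the sum of the letters of `v`. -/
def mouldComp (A B : Mould) : Mould := fun w =>
  ∑ p : Composition w.length,
    A ((w.splitWrtComposition p).map List.sum) * ((w.splitWrtComposition p).map B).prod

/-- Mould logarithm `(M - 1) - (M - 1)²/2 + (M - 1)³/3 - ⋯` of a mould `M` whose value at the
empty word is `1`; the powers of exponent larger than the length of the word vanish. -/
def logmu (M : Mould) : Mould := fun w =>
  ∑ m ∈ Finset.Icc 1 w.length,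
    ((-1 : ℂ) ^ (m - 1) / (m : ℂ)) * mouldPow (fun v => M v - mouldOne v) m w

/-- Multiplicative inverse `∑ (1 - M)^m` of a mould `M` whose value at the empty word is `1`;
again the powers of exponent larger than the length of the word vanish. -/
def invmu (M : Mould) : Mould := fun w =>
  ∑ m ∈ Finset.range (w.length + 1), mouldPow (fun v => mouldOne v - M v) m w

/-- The mould `E - 1`. -/
def expSubOneMould : Mould := fun w => if w = [] then 0 else 1 / (w.length.factorial : ℂ)

/-- The formal power series `2 tanh (t / 2)`. -/
def twoTanhHalf : PowerSeries ℂ :=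
  2 * ((PowerSeries.rescale (1 / 2 : ℂ) (PowerSeries.exp ℂ)
        - PowerSeries.rescale (-1 / 2 : ℂ) (PowerSeries.exp ℂ))
      * (PowerSeries.rescale (1 / 2 : ℂ) (PowerSeries.exp ℂ)
        + PowerSeries.rescale (-1 / 2 : ℂ) (PowerSeries.exp ℂ))⁻¹)

/-- The length-dependent mould `K` with generating series `2 tanh (t / 2)`. -/
def KMould : Mould := fun w => PowerSeries.coeff w.length twoTanhHalf

/-- The corrective mould: `(c + log k)^r / r!` at `(1, …, 1)` (`r` letters), `0` elsewhere. -/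
def coSe (c : ℂ) (k : ℕ) : Mould := fun w =>
  if ∀ s ∈ w, s = 1 then (c + (Real.log k : ℂ)) ^ w.length / (w.length.factorial : ℂ) else 0

/-- The multiplicative inverse of `coSe c k`. -/
def invcoSe (c : ℂ) (k : ℕ) : Mould := fun w =>
  if ∀ s ∈ w, s = 1 then (-c - (Real.log k : ℂ)) ^ w.length / (w.length.factorial : ℂ) else 0

open Classical in
/-- The truncated multitangent: sum over `k ≥ n₁ > ⋯ > n_r ≥ -k` of
`(n₁ + z)^{-s₁} ⋯ (n_r + z)^{-s_r}`. -/
def doTe (k : ℕ) (z : ℂ) : Mould := fun w =>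
  ∑ n ∈ (Fintype.piFinset fun _ : Fin w.length => Finset.Icc (-(k : ℤ)) (k : ℤ)).filter
      (fun n => StrictAnti n),
    ∏ i : Fin w.length, (((n i : ℂ) + z) ^ (w.get i))⁻¹

/-- The truncated and corrected multitangent. -/
def TeTrunc (c : ℂ) (k : ℕ) (z : ℂ) : Mould :=
  mouldMul (mouldMul (invcoSe c k) (doTe k z)) (coSe c k)

/-- The symmetrel multitangents `Te(z)`. The corrective factors act trivially on the words
with `s₁ ≠ 1` and `s_r ≠ 1`. -/
def Te (c z : ℂ) : Mould := fun w => Filter.limUnder Filter.atTop (fun k => TeTrunc c k z w)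

/-- The symmetral multitangents. -/
def Ta (c z : ℂ) : Mould := mouldComp (Te c z) expSubOneMould

/-- The alternal multitangents. -/
def Tan (c z : ℂ) : Mould := logmu (Ta c z)

/-- The odd function `H(x) = e^x / (1 - e^x) + 1/2 = -(1/2) coth (x / 2)`. -/
def Hfun (x : ℝ) : ℝ := -(1 / 2) * (Real.cosh (x / 2) / Real.sinh (x / 2))

/-- `H(∂)` in the geometric model `+`, where `e^∂` is the unit shift and
`H(∂) = 1/2 + ∑_{n ≥ 1} e^{n∂}`, truncated: if `f k z` is built on the points
`z, z + 1, …, z + k`, then so is the result. -/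
def HPlus (f : ℕ → ℂ → ℂ) : ℕ → ℂ → ℂ := fun k z =>
  (1 / 2) * f k z + ∑ n ∈ Finset.Icc 1 k, f (k - n) (z + n)

/-- `H(∂)` in the geometric model `-`, where `H(∂) = -1/2 - ∑_{n ≥ 1} e^{-n∂}`, truncated: if
`f k z` is built on the points `z, z - 1, …, z - k`, then so is the result. -/
def HMinus (f : ℕ → ℂ → ℂ) : ℕ → ℂ → ℂ := fun k z =>
  -(1 / 2) * f k z - ∑ n ∈ Finset.Icc 1 k, f (k - n) (z - n)

/-- Solution of the induction `See = H(∂) (See × Je)`, `See^∅ = 1`, for a given realisation `H`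
of `H(∂)`. Since `Je` lives on words of length one, this reads
`See^{s₁,…,s_r} = H (See^{s₁,…,s_{r-1}} · z^{-s_r})`. The argument is the reversed word. -/
def seeInduction (H : (ℕ → ℂ → ℂ) → ℕ → ℂ → ℂ) : List ℕ → ℕ → ℂ → ℂ
  | [] => fun _ _ => 1
  | s :: u => H (fun k z => seeInduction H u k z * (z ^ s)⁻¹)

/-- Truncated `See` in the model `+`. -/
def doSeePlus (k : ℕ) (z : ℂ) : Mould := fun w => seeInduction HPlus w.reverse k z

/-- Truncated `See` in the model `-`. -/
def doSeeMinus (k : ℕ) (z : ℂ) : Mould := fun w => seeInduction HMinus w.reverse k z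

/-- `See` in the model `+`. The corrective factor acts trivially on the words with `s₁ ≠ 1`. -/
def SeePlus (c z : ℂ) : Mould := fun w =>
  Filter.limUnder Filter.atTop (fun k => mouldMul (invcoSe c k) (doSeePlus k z) w)

/-- `See` in the model `-`. The corrective factor acts trivially on the words with `s₁ ≠ 1`. -/
def SeeMinus (c z : ℂ) : Mould := fun w =>
  Filter.limUnder Filter.atTop (fun k => mouldMul (invcoSe c k) (doSeeMinus k z) w)

/-- `Tee = See₊ × invSee₋`. -/
def Tee (c z : ℂ) : Mould := mouldMul (SeePlus c z) (invmu (SeeMinus c z))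

/-- The auxiliary multitangents `Teen`. -/
def Teen (c z : ℂ) : Mould := logmu (Tee c z)

/-- `See` in the convolutive model, for nonempty reversed words: `z^{-s}` becomes
`ζ^{s-1} / (s-1)!`, products become convolutions and `∂` becomes multiplication by `-ζ`. -/
def hatSeeRev : List ℕ → ℝ → ℝ
  | [] => fun _ => 0
  | [s] => fun ζ => Hfun (-ζ) * (ζ ^ (s - 1) / ((s - 1).factorial : ℝ))
  | s :: t :: u => fun ζ => Hfun (-ζ) *
      ∫ τ in (0 : ℝ)..ζ, hatSeeRev (t :: u) (ζ - τ) * (τ ^ (s - 1) / ((s - 1).factorial : ℝ))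

/-- `See` in the convolutive model, for nonempty words. -/
def hatSee (w : List ℕ) (ζ : ℝ) : ℝ := hatSeeRev w.reverse ζ

/-- The frequency `ω = 2πi m`. -/
def freq (m : ℤ) : ℂ := 2 * (Real.pi : ℂ) * Complex.I * (m : ℂ)

/-- The coefficient of `e^{-ωz}`, `ω = 2πi m`, in the Fourier expansion of a 1-periodic
function `T`: the northern expansion (`Im z > 0`) for `m < 0`, the southern one (`Im z < 0`)
for `m > 0`. -/
def fourierAt (T : ℂ → ℂ) (m : ℤ) : ℂ :=
  ∫ x in (0 : ℝ)..1, T ((x : ℂ) - (m.sign : ℂ) * Complex.I)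
    * Complex.exp (freq m * ((x : ℂ) - (m.sign : ℂ) * Complex.I))

/-- The scalar mould `Tan_ω`, `ω = 2πi m`. -/
def TanOmega (c : ℂ) (m : ℤ) : Mould := fun w => fourierAt (fun z => Tan c z w) m

/-- The scalar mould `Teen_ω`, `ω = 2πi m`. -/
def TeenOmega (c : ℂ) (m : ℤ) : Mould := fun w => fourierAt (fun z => Teen c z w) m

end

/-!
Moulds form an algebra under mould multiplication, and composition with a fixed mould on the right
is an endomorphism of it (`compHom`); composition is associative (`comp_assoc`). Inverse and
logarithm are compositions of power series with `M - 1`, so they are compatible with composition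
(`log_comp`) and with the parity automorphism (`log_parity`).

**Truncated identities.** The truncated multitangent is the ordered product of the moulds
`1 + mono (z + n)` over `k ≥ n ≥ -k`, and truncated `See₊ × inv See₋` is the ordered product of
`block (z + n) = (1 + mono (z + n) / 2) / (1 - mono (z + n) / 2)` over the same points. These
factors are related by composition with the length-dependent mould of the series
`X / (1 - X / 2)` (`comp_doTe`), and this composition leaves the corrective exponentials unchanged
on words with positive letters. As `X / (1 - X / 2)` composed with `2 tanh (t / 2)` is `e ^ t - 1`
(`moebius_comp_KMould`), the relation `Tan = Teen ∘ K` follows by passing to the limit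
(`posEq_tan`).

**Convergence.** Normalised by the exponentials of logarithms, the product of the blocks at
`x + k, …, x + 1` has factors `1 + defect (x + n)`, where the words `(1, …, 1)` cancel up to order
`n ^ (-2)`. The defect is `O (‖y‖ ^ (-7 / 4))` (`growthOn_defect`), so the products converge locally
uniformly, with limit `1 + O (‖x‖ ^ (-1 / 4))` at infinity. This gives all the limits, their
holomorphy in `z` and their behaviour at infinity.

**Parity, periodicity, Fourier expansions.** Reflection `z ↦ -z` exchanges `See₊` and `See₋` up
to the parity automorphism, and so it inverts `Tee` up to parity, which is the parity of the
logarithm `Teen`; since `K` is odd, it passes to `Tan`. The difference equation of `See₊` makes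
`Tee` `1`-periodic. At `i ∞` the mould `Tee` tends to `exp (-π i J)`, where `J` is the indicator
of the word `(1)`; so `Teen` tends to `0` at all words other than `(1)`, and the `q`-expansion of
periodic functions on the upper half-plane gives the Fourier expansions.

**Laplace transforms.** For `s₁ ≠ 1`, both `See₊` and the Laplace transform of the convolutive
model satisfy the same first-order difference equation and tend to `0` along `z + ℕ`, hence they
agree (`hasLaplace_hatSeeRev`).
-/

section

open Filter Topology Asymptotics

/-! ### The algebra of moulds -/

/-- Sum of `φ x y` over all factorisations `w = x y`, by recursion on `w`. -/
def splitSum {β : Type*} [AddCommMonoid β] : List ℕ → (List ℕ → List ℕ → β) → β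
  | [], φ => φ [] []
  | s :: u, φ => φ [] (s :: u) + splitSum u (fun x y => φ (s :: x) y)

lemma sum_range_take_drop {β : Type*} [AddCommMonoid β] (w : List ℕ)
    (φ : List ℕ → List ℕ → β) :
    ∑ i ∈ Finset.range (w.length + 1), φ (w.take i) (w.drop i) = splitSum w φ := by
  induction w generalizing φ with
  | nil => simp [splitSum]
  | cons s u ih =>
    rw [List.length_cons, Finset.sum_range_succ', splitSum, ← ih, add_comm]
    simp

lemma splitSum_congr {β : Type*} [AddCommMonoid β] {w : List ℕ} {φ ψ : List ℕ → List ℕ → β}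
    (h : ∀ x y, x ++ y = w → φ x y = ψ x y) : splitSum w φ = splitSum w ψ := by
  induction w generalizing φ ψ with
  | nil => exact h [] [] rfl
  | cons s u ih =>
    simp only [splitSum]
    rw [h [] (s :: u) rfl, ih (fun x y hxy => h (s :: x) y (by simp [hxy]))]

lemma splitSum_add {β : Type*} [AddCommMonoid β] (w : List ℕ) (φ ψ : List ℕ → List ℕ → β) :
    splitSum w (fun x y => φ x y + ψ x y) = splitSum w φ + splitSum w ψ := by
  simp only [← sum_range_take_drop, Finset.sum_add_distrib]

lemma splitSum_mul_left (w : List ℕ) (a : ℂ) (φ : List ℕ → List ℕ → ℂ) :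
    splitSum w (fun x y => a * φ x y) = a * splitSum w φ := by
  simp only [← sum_range_take_drop, Finset.mul_sum]

lemma splitSum_mul_right (w : List ℕ) (a : ℂ) (φ : List ℕ → List ℕ → ℂ) :
    splitSum w (fun x y => φ x y * a) = splitSum w φ * a := by
  simp only [← sum_range_take_drop, Finset.sum_mul]

lemma splitSum_eq_zero {β : Type*} [AddCommMonoid β] {w : List ℕ} {φ : List ℕ → List ℕ → β}
    (h : ∀ x y, x ++ y = w → φ x y = 0) : splitSum w φ = 0 := by
  rw [splitSum_congr h, ← sum_range_take_drop]; simp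

/-- Only the factorisation with empty left factor contributes. -/
lemma splitSum_eq_left {β : Type*} [AddCommMonoid β] {w : List ℕ} {φ : List ℕ → List ℕ → β}
    (h : ∀ x y, x ++ y = w → x ≠ [] → φ x y = 0) : splitSum w φ = φ [] w := by
  cases w with
  | nil => rfl
  | cons s u =>
    rw [splitSum, splitSum_eq_zero, add_zero]
    intro x y hxy
    exact h _ _ (by simp [hxy]) (by simp)

lemma splitSum_append_singleton {β : Type*} [AddCommMonoid β] (w : List ℕ) (s : ℕ)
    (φ : List ℕ → List ℕ → β) :
    splitSum (w ++ [s]) φ = splitSum w (fun x y => φ x (y ++ [s])) + φ (w ++ [s]) [] := by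
  induction w generalizing φ with
  | nil => simp [splitSum]
  | cons t u ih => simp only [List.cons_append, splitSum, ih, add_assoc]

/-- Only the factorisation with empty right factor contributes. -/
lemma splitSum_eq_right {β : Type*} [AddCommMonoid β] {w : List ℕ} {φ : List ℕ → List ℕ → β}
    (h : ∀ x y, x ++ y = w → y ≠ [] → φ x y = 0) : splitSum w φ = φ w [] := by
  induction w using List.reverseRecOn with
  | nil => rfl
  | append_singleton u s _ =>
    rw [splitSum_append_singleton, splitSum_eq_zero, zero_add]
    intro x y hxy
    exact h _ _ (by simp [← hxy]) (by simp)

/-- Coassociativity of deconcatenation. -/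
lemma splitSum_assoc {β : Type*} [AddCommMonoid β] (w : List ℕ)
    (φ : List ℕ → List ℕ → List ℕ → β) :
    splitSum w (fun x y => splitSum x (fun a b => φ a b y))
      = splitSum w (fun a y => splitSum y (fun b d => φ a b d)) := by
  induction w generalizing φ with
  | nil => rfl
  | cons s u ih =>
    simp only [splitSum, splitSum_add, ih, add_assoc]

/-- Moulds as the elements of an algebra: a wrapper around `Mould`, so that the product is the mould
product and not the pointwise one. -/
@[ext] structure MouldAlg where
  /-- A mould regarded as an element of the mould algebra. -/
  of ::
  /-- The underlying mould. -/
  toMould : Mould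

namespace MouldAlg

noncomputable section

instance : CoeFun MouldAlg (fun _ => List ℕ → ℂ) := ⟨toMould⟩

lemma ext_apply {A B : MouldAlg} (h : ∀ w : List ℕ, A w = B w) : A = B :=
  MouldAlg.ext (funext h)

lemma toMould_injective : Function.Injective toMould := fun _ _ h => MouldAlg.ext h

instance : Zero MouldAlg := ⟨of 0⟩
instance : Add MouldAlg := ⟨fun A B => of (A.toMould + B.toMould)⟩
instance : Neg MouldAlg := ⟨fun A => of (-A.toMould)⟩
instance : Sub MouldAlg := ⟨fun A B => of (A.toMould - B.toMould)⟩
instance : SMul ℕ MouldAlg := ⟨fun n A => of (n • A.toMould)⟩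
instance : SMul ℤ MouldAlg := ⟨fun n A => of (n • A.toMould)⟩
instance : SMul ℂ MouldAlg := ⟨fun n A => of (n • A.toMould)⟩
instance : AddCommGroup MouldAlg :=
  toMould_injective.addCommGroup toMould rfl (fun _ _ => rfl) (fun _ => rfl) (fun _ _ => rfl)
    (fun _ _ => rfl) (fun _ _ => rfl)

/-- The underlying mould, as an additive map. -/
def toMouldHom : MouldAlg →+ Mould where
  toFun := toMould
  map_zero' := rfl
  map_add' _ _ := rfl

instance : Module ℂ MouldAlg :=
  toMould_injective.module ℂ toMouldHom (fun _ _ => rfl)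
instance : One MouldAlg := ⟨of mouldOne⟩
instance : Mul MouldAlg := ⟨fun A B => of (mouldMul A.toMould B.toMould)⟩

lemma of_apply (A : Mould) (w : List ℕ) : of A w = A w := rfl
lemma add_apply (A B : MouldAlg) (w : List ℕ) : (A + B) w = A w + B w := rfl
lemma sub_apply (A B : MouldAlg) (w : List ℕ) : (A - B) w = A w - B w := rfl
lemma neg_apply (A : MouldAlg) (w : List ℕ) : (-A) w = -A w := rfl
lemma smul_apply (a : ℂ) (A : MouldAlg) (w : List ℕ) : (a • A) w = a * A w := rfl
lemma zero_apply (w : List ℕ) : (0 : MouldAlg) w = 0 := rfl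
lemma one_apply (w : List ℕ) : (1 : MouldAlg) w = if w = [] then 1 else 0 := rfl
@[simp] lemma one_nil : (1 : MouldAlg) [] = 1 := rfl
@[simp] lemma one_cons (s : ℕ) (u : List ℕ) : (1 : MouldAlg) (s :: u) = 0 := by simp [one_apply]
lemma mul_apply (A B : MouldAlg) (w : List ℕ) :
    (A * B) w = splitSum w (fun x y => A x * B y) := by
  rw [← sum_range_take_drop]; rfl

lemma sum_apply {ι : Type*} (t : Finset ι) (f : ι → MouldAlg) (w : List ℕ) :
    (∑ i ∈ t, f i) w = ∑ i ∈ t, f i w := by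
  have h : (∑ i ∈ t, f i).toMould = ∑ i ∈ t, (f i).toMould := map_sum toMouldHom f t
  rw [h, Finset.sum_apply]

instance : Ring MouldAlg :=
  { (inferInstance : AddCommGroup MouldAlg), (inferInstance : One MouldAlg),
    (inferInstance : Mul MouldAlg) with
    left_distrib := fun A B C => by
      refine ext_apply fun w => ?_; simp only [mul_apply, add_apply, mul_add, splitSum_add]
    right_distrib := fun A B C => by
      refine ext_apply fun w => ?_; simp only [mul_apply, add_apply, add_mul, splitSum_add]
    zero_mul := fun A => by
      refine ext_apply fun w => ?_
      rw [mul_apply]; exact splitSum_eq_zero fun x y _ => by simp [zero_apply]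
    mul_zero := fun A => by
      refine ext_apply fun w => ?_
      rw [mul_apply]; exact splitSum_eq_zero fun x y _ => by simp [zero_apply]
    mul_assoc := fun A B C => by
      refine ext_apply fun w => ?_
      simp only [mul_apply]
      simp only [← splitSum_mul_left, ← splitSum_mul_right, ← mul_assoc]
      exact splitSum_assoc w (fun a b d => A a * B b * C d)
    one_mul := fun A => by
      refine ext_apply fun w => ?_
      rw [mul_apply, splitSum_eq_left]
      · simp
      · intro x y _ hx; simp [one_apply, hx]
    mul_one := fun A => by
      refine ext_apply fun w => ?_
      rw [mul_apply, splitSum_eq_right]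
      · simp
      · intro x y _ hx; simp [one_apply, hx] }

@[simp] lemma mul_nil (A B : MouldAlg) : (A * B) [] = A [] * B [] := by
  simp [mul_apply, splitSum]

lemma mul_cons (A B : MouldAlg) (s : ℕ) (u : List ℕ) :
    (A * B) (s :: u) = A [] * B (s :: u) + splitSum u (fun x y => A (s :: x) * B y) := by
  simp [mul_apply, splitSum]

lemma mul_append_singleton (A B : MouldAlg) (s : ℕ) (u : List ℕ) :
    (A * B) (u ++ [s]) = splitSum u (fun x y => A x * B (y ++ [s])) + A (u ++ [s]) * B [] := by
  rw [mul_apply, splitSum_append_singleton]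

instance : Algebra ℂ MouldAlg :=
  Algebra.ofModule
    (fun a A B => by
      refine ext_apply fun w => ?_
      simp only [mul_apply, smul_apply, ← splitSum_mul_left, mul_assoc])
    (fun a A B => by
      refine ext_apply fun w => ?_
      simp only [mul_apply, smul_apply, ← splitSum_mul_left, mul_left_comm])

lemma pow_eq (A : MouldAlg) (m : ℕ) : A ^ m = of (mouldPow A.toMould m) := by
  induction m with
  | zero => rfl
  | succ m ih => rw [pow_succ, ih]; rfl

/-! ### Moulds built from power series -/

/-- The mould whose value at a word is the coefficient of a power series in degree the length of
the word. -/
def len : PowerSeries ℂ →+* MouldAlg where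
  toFun f := of fun w => PowerSeries.coeff w.length f
  map_one' := by
    refine ext_apply fun w => ?_
    rw [of_apply, PowerSeries.coeff_one, one_apply]
    simp
  map_zero' := by refine ext_apply fun w => ?_; simp [zero_apply]
  map_add' f g := by refine ext_apply fun w => ?_; simp [add_apply]
  map_mul' f g := by
    refine ext_apply fun w => ?_
    simp only [mul_apply]
    rw [← sum_range_take_drop, PowerSeries.coeff_mul,
      Finset.Nat.sum_antidiagonal_eq_sum_range_succ
        (fun i j => PowerSeries.coeff i f * PowerSeries.coeff j g)]
    refine Finset.sum_congr rfl fun i hi => ?_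
    have : i ≤ w.length := by simpa [Nat.lt_succ_iff] using hi
    simp [this]

lemma len_apply (f : PowerSeries ℂ) (w : List ℕ) : len f w = PowerSeries.coeff w.length f := rfl

/-- The mould supported on the words `(1, …, 1)` whose value there is the coefficient of a power
series in degree the length of the word. -/
def ones : PowerSeries ℂ →+* MouldAlg where
  toFun f := of fun w => if ∀ s ∈ w, s = 1 then PowerSeries.coeff w.length f else 0
  map_one' := by
    refine ext_apply fun w => ?_
    rw [of_apply, PowerSeries.coeff_one, one_apply]
    cases w <;> simp
  map_zero' := by refine ext_apply fun w => ?_; simp [zero_apply]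
  map_add' f g := by refine ext_apply fun w => ?_; simp only [add_apply]; split_ifs <;> simp
  map_mul' f g := by
    refine ext_apply fun w => ?_
    simp only [mul_apply]
    by_cases h : ∀ s ∈ w, s = 1
    · rw [if_pos h, ← sum_range_take_drop, PowerSeries.coeff_mul,
        Finset.Nat.sum_antidiagonal_eq_sum_range_succ
          (fun i j => PowerSeries.coeff i f * PowerSeries.coeff j g)]
      refine Finset.sum_congr rfl fun i hi => ?_
      have : i ≤ w.length := by simpa [Nat.lt_succ_iff] using hi
      rw [if_pos (fun s hs => h s (List.mem_of_mem_take hs)),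
        if_pos (fun s hs => h s (List.mem_of_mem_drop hs))]
      simp [this]
    · rw [if_neg h]
      refine (splitSum_eq_zero fun x y hxy => ?_).symm
      by_cases hx : ∀ s ∈ x, s = 1
      · rw [if_neg (c := ∀ s ∈ y, s = 1), mul_zero]
        intro hy
        apply h
        rw [← hxy]
        intro s hs
        rcases List.mem_append.1 hs with hs | hs
        exacts [hx s hs, hy s hs]
      · rw [if_neg hx, zero_mul]

lemma ones_apply (f : PowerSeries ℂ) (w : List ℕ) :
    ones f w = if ∀ s ∈ w, s = 1 then PowerSeries.coeff w.length f else 0 := rfl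

/-- The exponential `exp (a J)`, where `J` is the mould with value `1` at the word `(1)` and `0`
at all other words. -/
def expOne (a : ℂ) : MouldAlg := ones (PowerSeries.rescale a (PowerSeries.exp ℂ))

lemma expOne_apply (a : ℂ) (w : List ℕ) :
    expOne a w = if ∀ s ∈ w, s = 1 then a ^ w.length / (w.length.factorial : ℂ) else 0 := by
  simp [expOne, ones_apply, PowerSeries.coeff_rescale, PowerSeries.coeff_exp, div_eq_mul_inv]

@[simp] lemma expOne_nil (a : ℂ) : expOne a [] = 1 := by simp [expOne_apply]

lemma expOne_add (a b : ℂ) : expOne (a + b) = expOne a * expOne b := by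
  rw [expOne, expOne, expOne, ← map_mul, PowerSeries.exp_mul_exp_eq_exp_add]

@[simp] lemma expOne_zero : expOne 0 = 1 := by simp [expOne]

@[simp] lemma expOne_mul_neg (a : ℂ) : expOne a * expOne (-a) = 1 := by
  rw [← expOne_add]; simp

@[simp] lemma expOne_neg_mul (a : ℂ) : expOne (-a) * expOne a = 1 := by
  rw [← expOne_add]; simp

lemma of_coSe (c : ℂ) (k : ℕ) : of (coSe c k) = expOne (c + Real.log k) := by
  refine ext_apply fun w => ?_; rw [expOne_apply]; rfl

lemma of_invcoSe (c : ℂ) (k : ℕ) : of (invcoSe c k) = expOne (-c - Real.log k) := by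
  refine ext_apply fun w => ?_; rw [expOne_apply]; rfl

/-- A mould supported on words of ones acts by its value at the empty word on the left of a word
whose first letter is not `1`. -/
lemma ones_mul_apply_of_head (f : PowerSeries ℂ) (A : MouldAlg) {w : List ℕ}
    (h : w.head? ≠ some 1) : (ones f * A) w = PowerSeries.coeff 0 f * A w := by
  rw [mul_apply, splitSum_eq_left]
  · simp [ones_apply]
  · rintro (_ | ⟨s, x⟩) y rfl hx
    · simp at hx
    · have : s ≠ 1 := by simpa using h
      simp [ones_apply, this]

lemma expOne_mul_apply_of_head (a : ℂ) (A : MouldAlg) {w : List ℕ}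
    (h : w.head? ≠ some 1) : (expOne a * A) w = A w := by
  rw [expOne, ones_mul_apply_of_head _ _ h]; simp

/-! ### The parity automorphism -/

/-- The automorphism that multiplies the value at a word of length `r` and weight `|w|` by
`(-1) ^ (|w| + r)`. -/
def parity : MouldAlg →+* MouldAlg where
  toFun A := of fun w => (-1) ^ (w.sum + w.length) * A w
  map_one' := by refine ext_apply fun w => ?_; cases w <;> simp
  map_zero' := by refine ext_apply fun w => ?_; simp [zero_apply]
  map_add' A B := by refine ext_apply fun w => ?_; simp [add_apply, mul_add]
  map_mul' A B := by
    refine ext_apply fun w => ?_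
    simp only [mul_apply, ← splitSum_mul_left]
    refine splitSum_congr fun x y hxy => ?_
    subst hxy
    simp only [List.sum_append, List.length_append]
    ring

lemma parity_apply (A : MouldAlg) (w : List ℕ) :
    parity A w = (-1) ^ (w.sum + w.length) * A w := rfl

lemma parity_parity (A : MouldAlg) : parity (parity A) = A := by
  refine ext_apply fun w => ?_
  rw [parity_apply, parity_apply, ← mul_assoc, ← mul_pow]
  simp

lemma parity_ones (f : PowerSeries ℂ) : parity (ones f) = ones f := by
  refine ext_apply fun w => ?_
  rw [parity_apply, ones_apply]
  split_ifs with h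
  · have : w.sum = w.length := by
      rw [List.eq_replicate_of_mem h]; simp
    rw [this, ← two_mul, pow_mul]; simp
  · simp

lemma parity_expOne (a : ℂ) : parity (expOne a) = expOne a := parity_ones _

end

end MouldAlg

/-! ### Mould composition -/

/-- A composition of `n + 1` is a first block `i + 1` followed by a composition of `n - i`. -/
lemma Composition.sum_blocks_succ (n : ℕ) (φ : List ℕ → ℂ) :
    ∑ p : Composition (n + 1), φ p.blocks
      = ∑ i ∈ Finset.range (n + 1), ∑ q : Composition (n - i), φ ((i + 1) :: q.blocks) := by
  rw [Finset.sum_sigma']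
  symm
  refine Finset.sum_bij
    (i := fun (a : (i : ℕ) × Composition (n - i))
      (ha : a ∈ (Finset.range (n + 1)).sigma fun i =>
        (Finset.univ : Finset (Composition (n - i)))) =>
      (⟨(a.1 + 1) :: a.2.blocks, ?_, ?_⟩ : Composition (n + 1))) ?_ ?_ ?_ ?_
  · intro i hi
    rcases List.mem_cons.1 hi with rfl | hi
    · omega
    · exact a.2.blocks_pos hi
  · have h1 : a.1 < n + 1 := by simpa using ha
    rw [List.sum_cons, a.2.blocks_sum]
    omega
  · intro a ha; simp
  · rintro ⟨i, q⟩ hi ⟨j, q'⟩ hj h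
    have h := congrArg Composition.blocks h
    simp only [List.cons.injEq, Nat.add_right_cancel_iff] at h
    obtain ⟨rfl, h⟩ := h
    obtain rfl := Composition.ext h
    rfl
  · rintro ⟨bs, hpos, hsum⟩ _
    cases bs with
    | nil => simp at hsum
    | cons b bs =>
      have hb : 0 < b := hpos (by simp)
      rw [List.sum_cons] at hsum
      refine ⟨⟨b - 1, ⟨bs, fun hi => hpos (List.mem_cons_of_mem _ hi), by omega⟩⟩, ?_, ?_⟩
      · simp; omega
      · ext1
        simp only [List.cons.injEq, and_true]
        omega
  · intro a ha; rfl

namespace MouldAlg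

noncomputable section

/-- The mould `v ↦ A (n v)`. -/
def shift (A : MouldAlg) (n : ℕ) : MouldAlg := of fun v => A (n :: v)

/-- Mould composition in the mould algebra. -/
def comp (A B : MouldAlg) : MouldAlg := of (mouldComp A.toMould B.toMould)

lemma shift_apply (A : MouldAlg) (n : ℕ) (v : List ℕ) : A.shift n v = A (n :: v) := rfl

@[simp] lemma comp_nil (A B : MouldAlg) : comp A B [] = A [] := by
  have h : ∀ p : Composition ([] : List ℕ).length, p.blocks = [] := by
    intro p
    have := p.blocks_sum
    rcases hp : p.blocks with _ | ⟨b, bs⟩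
    · rfl
    · have hb := p.blocks_pos (i := b) (by simp [hp])
      rw [hp] at this
      simp at this
      omega
  have h2 : comp A B [] = ∑ _p : Composition ([] : List ℕ).length, A [] := by
    simp only [comp, mouldComp]
    refine Finset.sum_congr rfl fun p _ => ?_
    simp [List.splitWrtComposition, h p, List.splitWrtCompositionAux]
  rw [h2, Finset.sum_const, Finset.card_univ, composition_card]
  simp

/-- Recursion for the composition of moulds: the first block is split off. -/
lemma comp_cons (A B : MouldAlg) (s : ℕ) (u : List ℕ) :
    comp A B (s :: u)
      = splitSum u (fun x y => B (s :: x) * comp (A.shift (s + x.sum)) B y) := by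
  let T : MouldAlg → List ℕ → List ℕ → ℂ := fun A w ns =>
    A ((w.splitWrtCompositionAux ns).map List.sum)
      * ((w.splitWrtCompositionAux ns).map B.toMould).prod
  have h1 : comp A B (s :: u)
      = ∑ p : Composition (u.length + 1), T A (s :: u) p.blocks := rfl
  rw [h1, Composition.sum_blocks_succ, ← sum_range_take_drop]
  refine Finset.sum_congr rfl fun i hi => ?_
  have h2 : comp (A.shift (s + (u.take i).sum)) B (u.drop i)
      = ∑ p : Composition (u.drop i).length,
        T (A.shift (s + (u.take i).sum)) (u.drop i) p.blocks := rfl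
  rw [h2, List.length_drop, Finset.mul_sum]
  refine Finset.sum_congr rfl fun q _ => ?_
  simp only [T, List.splitWrtCompositionAux_cons, shift_apply, List.take_succ_cons,
    List.drop_succ_cons, List.map_cons, List.prod_cons, List.sum_cons]
  ring

lemma add_comp (A A' B : MouldAlg) : comp (A + A') B = comp A B + comp A' B := by
  refine ext_apply fun w => ?_
  simp only [comp, of_apply, add_apply, mouldComp]
  rw [← Finset.sum_add_distrib]
  exact Finset.sum_congr rfl fun p _ => add_mul _ _ _

lemma smul_comp (a : ℂ) (A B : MouldAlg) : comp (a • A) B = a • comp A B := by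
  refine ext_apply fun w => ?_
  simp only [comp, of_apply, smul_apply, mouldComp]
  rw [Finset.mul_sum]
  exact Finset.sum_congr rfl fun p _ => mul_assoc _ _ _

lemma zero_comp (B : MouldAlg) : comp 0 B = 0 := by
  simpa using smul_comp 0 0 B

lemma one_comp (B : MouldAlg) : comp 1 B = 1 := by
  refine ext_apply fun w => ?_
  cases w with
  | nil => simp
  | cons s u =>
    rw [comp_cons, one_cons]
    refine splitSum_eq_zero fun x y _ => ?_
    have : (1 : MouldAlg).shift (s + x.sum) = 0 := ext_apply fun w => by
      rw [shift_apply, one_cons, zero_apply]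
    rw [this, zero_comp, zero_apply, mul_zero]

lemma shift_mul (A A' : MouldAlg) (n : ℕ) :
    (A * A').shift n = A.shift n * A' + A [] • A'.shift n := by
  refine ext_apply fun w => ?_
  rw [shift_apply, mul_cons, add_apply, smul_apply, mul_apply, add_comm]
  rfl

lemma mul_comp (A A' B : MouldAlg) : comp (A * A') B = comp A B * comp A' B := by
  refine ext_apply fun w => ?_
  induction hn : w.length using Nat.strong_induction_on generalizing w A with
  | _ n ih =>
    cases w with
    | nil => simp
    | cons s u =>
      have h : ∀ x y, x ++ y = u →
          B (s :: x) * comp ((A * A').shift (s + x.sum)) B y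
          = A [] * (B (s :: x) * comp (A'.shift (s + x.sum)) B y)
          + splitSum y (fun b d => B (s :: x) * comp (A.shift (s + x.sum)) B b * comp A' B d) := by
        intro x y hxy
        rw [shift_mul, add_comp, smul_comp, add_apply, smul_apply,
          ih y.length _ _ _ rfl, mul_apply]
        · simp only [mul_assoc, splitSum_mul_left]
          ring
        · rw [← hn, ← hxy]; simp
      rw [comp_cons, splitSum_congr h, splitSum_add, splitSum_mul_left, mul_cons, comp_nil,
        ← comp_cons, ← splitSum_assoc u
          (fun x b d => B (s :: x) * comp (A.shift (s + x.sum)) B b * comp A' B d)]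
      congr 1
      refine splitSum_congr fun x y _ => ?_
      rw [comp_cons, splitSum_mul_right]

/-- Composition with a fixed mould on the right is an algebra endomorphism. -/
def compHom (B : MouldAlg) : MouldAlg →ₐ[ℂ] MouldAlg where
  toFun A := comp A B
  map_one' := one_comp B
  map_mul' A A' := mul_comp A A' B
  map_zero' := zero_comp B
  map_add' A A' := add_comp A A' B
  commutes' a := by
    rw [Algebra.algebraMap_eq_smul_one, smul_comp, one_comp]

lemma compHom_apply (A B : MouldAlg) : compHom B A = comp A B := rfl

lemma sub_comp (A A' B : MouldAlg) : comp (A - A') B = comp A B - comp A' B :=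
  map_sub (compHom B) A A'

/-- Necessary conditions for `v` to be a word of block sums `|w¹|, …, |wᵗ|` of a factorisation
`w = w¹ ⋯ wᵗ` into nonempty words: only these properties are ever used. -/
structure IsCoarsening (w v : List ℕ) : Prop where
  sum_eq : v.sum = w.sum
  length_le : v.length ≤ w.length
  pos : (∀ s ∈ w, 1 ≤ s) → ∀ s ∈ v, 1 ≤ s
  eq_nil : v = [] → w = []

/-- `comp A B w` depends only on the values of `A` on the words of block sums of `w`. -/
lemma comp_congr {A A' B : MouldAlg} {w : List ℕ}
    (h : ∀ v, IsCoarsening w v → A v = A' v) : comp A B w = comp A' B w := by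
  induction hn : w.length using Nat.strong_induction_on generalizing w A A' with
  | _ n ih =>
    cases w with
    | nil => simpa using h [] ⟨rfl, le_rfl, by simp, by simp⟩
    | cons s u =>
      rw [comp_cons, comp_cons]
      refine splitSum_congr fun x y hxy => ?_
      subst hxy
      rw [ih y.length _ (fun v hv => ?_) rfl]
      · rw [← hn]; simp
      · rw [shift_apply, shift_apply]
        refine h _ ⟨?_, ?_, ?_, by simp⟩
        · simp [hv.sum_eq, add_assoc]
        · have := hv.length_le; simp; omega
        · intro hw t ht
          rcases List.mem_cons.1 ht with rfl | ht
          · have := hw s (by simp); omega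
          · exact hv.pos (fun t ht => hw t (by simp [ht])) t ht

/-- The mould with value `1` at the one-letter word `(n)` and `0` elsewhere. -/
def letter (n : ℕ) : MouldAlg := of fun v => if v = [n] then 1 else 0

lemma letter_comp (n : ℕ) (B : MouldAlg) :
    comp (letter n) B = of fun v => if v ≠ [] ∧ v.sum = n then B v else 0 := by
  refine ext_apply fun w => ?_
  cases w with
  | nil => simp [letter]
  | cons s u =>
    have h : ∀ m, (letter n).shift m = if m = n then 1 else 0 := by
      intro m
      refine ext_apply fun v => ?_
      rw [shift_apply, letter]
      split_ifs with hm <;> simp [hm, one_apply, zero_apply]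
    rw [comp_cons, splitSum_eq_right]
    · rw [h]
      simp only [ne_eq, reduceCtorEq, not_false_eq_true, List.sum_cons, true_and]
      split_ifs <;> simp [one_comp, zero_comp, zero_apply]
    · intro x y _ hy
      rw [h]
      split_ifs <;> simp [one_comp, zero_comp, zero_apply, one_apply, hy]

lemma letter_mul_cons (n : ℕ) (A : MouldAlg) (s : ℕ) (u : List ℕ) :
    (letter n * A) (s :: u) = if s = n then A u else 0 := by
  rw [mul_cons, splitSum_eq_left]
  · simp [letter]
  · intro x y _ hx; simp [letter, hx]

/-- Expansion of a mould with respect to the first letter. -/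
lemma eq_expansion (A : MouldAlg) (N : ℕ) {v : List ℕ} (hv : v.sum ≤ N) :
    A v = (A [] • (1 : MouldAlg) + ∑ n ∈ Finset.range (N + 1), letter n * A.shift n) v := by
  rw [add_apply, smul_apply, sum_apply]
  cases v with
  | nil => simp [letter]
  | cons s u =>
    simp only [letter_mul_cons, one_cons, mul_zero, zero_add, Finset.sum_ite_eq,
      Finset.mem_range, shift_apply]
    rw [List.sum_cons] at hv
    rw [if_pos (by omega)]

lemma comp_eq_expansion (A B : MouldAlg) (N : ℕ) {w : List ℕ} (hw : w.sum ≤ N) :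
    comp A B w = (A [] • (1 : MouldAlg)
      + ∑ n ∈ Finset.range (N + 1), comp (letter n) B * comp (A.shift n) B) w := by
  rw [comp_congr (A' := A [] • (1 : MouldAlg)
    + ∑ n ∈ Finset.range (N + 1), letter n * A.shift n)]
  · rw [← compHom_apply, map_add, map_smul, map_one, map_sum]
    simp only [map_mul, compHom_apply]
  · intro v hv
    exact eq_expansion A N (hv.sum_eq.trans_le hw)

lemma letter_comp_comp (n : ℕ) (B C : MouldAlg) :
    comp (comp (letter n) B) C = comp (letter n) (comp B C) := by
  rw [letter_comp, letter_comp]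
  refine ext_apply fun w => ?_
  change _ = if w ≠ [] ∧ w.sum = n then comp B C w else 0
  split_ifs with h
  · refine comp_congr fun v hv => ?_
    rw [of_apply, if_pos ⟨fun h' => h.1 (hv.eq_nil h'), hv.sum_eq.trans h.2⟩]
  · rw [comp_congr (A' := 0), zero_comp, zero_apply]
    intro v hv
    rw [of_apply, if_neg, zero_apply]
    rintro ⟨h1, h2⟩
    refine h ⟨?_, hv.sum_eq ▸ h2⟩
    rintro rfl
    exact h1 (List.eq_nil_of_length_eq_zero (by simpa using hv.length_le))

/-- Associativity of composition. By expansion with respect to the first letter and multiplicativity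
it reduces to the moulds `letter n`, by induction on the length of the word. -/
lemma comp_assoc (A B C : MouldAlg) : comp (comp A B) C = comp A (comp B C) := by
  refine ext_apply fun w => ?_
  induction hn : w.length using Nat.strong_induction_on generalizing w A with
  | _ n ih =>
    have h1 : comp (comp A B) C w = comp (A [] • (1 : MouldAlg)
        + ∑ n ∈ Finset.range (w.sum + 1), comp (letter n) B * comp (A.shift n) B) C w :=
      comp_congr fun v hv => comp_eq_expansion A B w.sum hv.sum_eq.le
    have h2 : comp (A [] • (1 : MouldAlg)
        + ∑ n ∈ Finset.range (w.sum + 1), comp (letter n) B * comp (A.shift n) B) C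
        = A [] • (1 : MouldAlg) + ∑ n ∈ Finset.range (w.sum + 1),
          comp (letter n) (comp B C) * comp (comp (A.shift n) B) C := by
      rw [← compHom_apply, map_add, map_smul, map_one, map_sum]
      simp only [map_mul, compHom_apply, letter_comp_comp]
    rw [h1, h2, comp_eq_expansion A (comp B C) w.sum le_rfl]
    rw [add_apply, add_apply, sum_apply, sum_apply]
    refine congrArg₂ (· + ·) rfl (Finset.sum_congr rfl fun m _ => ?_)
    rw [mul_apply, mul_apply]
    refine splitSum_congr fun x y hxy => ?_
    cases x with
    | nil => rw [comp_nil]; simp [letter]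
    | cons s x =>
      rw [ih y.length _ _ _ rfl]
      rw [← hn, ← hxy]; simp

lemma comp_len_X {B : MouldAlg} (hB : B [] = 0) : comp (len PowerSeries.X) B = B := by
  refine ext_apply fun w => ?_
  cases w with
  | nil => simp [hB, len_apply]
  | cons s u =>
    have h : ∀ m, (len PowerSeries.X).shift m = 1 := fun m => ext_apply fun v => by
      rw [shift_apply, len_apply, PowerSeries.coeff_X, one_apply]
      simp
    rw [comp_cons, splitSum_eq_right]
    · rw [h, one_comp]; simp
    · intro x y _ hy; rw [h, one_comp, one_apply, if_neg hy, mul_zero]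

lemma comp_len_X_right (A : MouldAlg) : comp A (len PowerSeries.X) = A := by
  refine ext_apply fun w => ?_
  induction w generalizing A with
  | nil => simp
  | cons s u ih =>
    rw [comp_cons, splitSum_eq_left]
    · rw [ih]; simp [len_apply, shift_apply]
    · intro x y _ hx
      rw [len_apply, PowerSeries.coeff_X, if_neg (by simpa using hx), zero_mul]

lemma len_X_pow_apply (m : ℕ) (w : List ℕ) :
    (len PowerSeries.X ^ m) w = if w.length = m then 1 else 0 := by
  rw [← map_pow, len_apply, PowerSeries.coeff_X_pow]

/-- Composing a mould that depends on the length only amounts to substituting into the power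
series of its values. -/
lemma comp_len_apply (f : PowerSeries ℂ) {B : MouldAlg} (hB : B [] = 0) (w : List ℕ) :
    comp (len f) B w
      = ∑ m ∈ Finset.range (w.length + 1), PowerSeries.coeff m f * (B ^ m) w := by
  rw [comp_congr (A' := ∑ m ∈ Finset.range (w.length + 1),
    PowerSeries.coeff m f • len PowerSeries.X ^ m)]
  · rw [← compHom_apply, map_sum, sum_apply]
    refine Finset.sum_congr rfl fun m _ => ?_
    rw [map_smul, map_pow, compHom_apply, comp_len_X hB, smul_apply]
  · intro v hv
    simp only [sum_apply, smul_apply, len_X_pow_apply, len_apply, mul_ite, mul_one, mul_zero,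
      Finset.sum_ite_eq, Finset.mem_range]
    rw [if_pos (Nat.lt_succ_of_le hv.length_le)]

end

end MouldAlg

/-! ### Inverse and logarithm -/

namespace MouldAlg

noncomputable section

/-- The multiplicative inverse in the mould algebra (for a mould with value `1` at `∅`). -/
def inv (M : MouldAlg) : MouldAlg := of (invmu M.toMould)

/-- The logarithm in the mould algebra (for a mould with value `1` at `∅`). -/
def log (M : MouldAlg) : MouldAlg := of (logmu M.toMould)

/-- The geometric series `(1 - a X)⁻¹`. -/
def geoSeries (a : ℂ) : PowerSeries ℂ := PowerSeries.mk fun m => a ^ m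

/-- The series of `log (1 + X)`; the coefficient of degree `0` is a division by zero, hence `0`. -/
def logSeries : PowerSeries ℂ := PowerSeries.mk fun m => (-1) ^ (m - 1) / (m : ℂ)

lemma geoSeries_mul (a : ℂ) : geoSeries a * (1 - PowerSeries.C a * PowerSeries.X) = 1 := by
  ext n
  rw [mul_sub, mul_one, mul_left_comm, map_sub, PowerSeries.coeff_C_mul]
  cases n with
  | zero => simp [geoSeries]
  | succ n =>
    rw [PowerSeries.coeff_succ_mul_X, PowerSeries.coeff_one]
    simp [geoSeries, pow_succ']

lemma inv_eq_comp {M : MouldAlg} (hM : M [] = 1) :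
    inv M = comp (len (geoSeries (-1))) (M - 1) := by
  refine ext_apply fun w => ?_
  rw [comp_len_apply _ (by rw [sub_apply, hM]; simp)]
  have h1 : inv M w = ∑ m ∈ Finset.range (w.length + 1), ((1 - M) ^ m) w := by
    simp only [pow_eq]; rfl
  rw [h1]
  refine Finset.sum_congr rfl fun m _ => ?_
  have h2 : (1 - M) ^ m = ((-1 : ℂ) ^ m) • (M - 1) ^ m := by
    rw [← neg_sub, ← smul_pow, neg_one_smul]
  rw [h2, smul_apply, geoSeries, PowerSeries.coeff_mk]

lemma log_eq_comp {M : MouldAlg} (hM : M [] = 1) :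
    log M = comp (len logSeries) (M - 1) := by
  refine ext_apply fun w => ?_
  rw [comp_len_apply _ (by rw [sub_apply, hM]; simp)]
  have h1 : log M w = ∑ m ∈ Finset.Icc 1 w.length,
      ((-1 : ℂ) ^ (m - 1) / (m : ℂ)) * ((M - 1) ^ m) w := by
    simp only [pow_eq]; rfl
  have h2 : Finset.Icc 1 w.length = (Finset.range (w.length + 1)).erase 0 := by
    ext m; simp; omega
  rw [h1, h2, Finset.sum_erase]
  · simp [logSeries]
  · simp

lemma one_comp_sub (M : MouldAlg) (hM : M [] = 1) :
    M = comp (len (1 + PowerSeries.X)) (M - 1) := by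
  rw [map_add, map_one, add_comp, one_comp, comp_len_X]
  · abel
  · rw [sub_apply, hM]; simp

lemma mul_inv {M : MouldAlg} (hM : M [] = 1) : M * inv M = 1 := by
  rw [inv_eq_comp hM]
  nth_rw 1 [one_comp_sub M hM]
  have := geoSeries_mul (-1)
  rw [← mul_comp, ← map_mul, mul_comm, show (1 + PowerSeries.X : PowerSeries ℂ)
    = 1 - PowerSeries.C (-1) * PowerSeries.X by simp, this, map_one, one_comp]

lemma inv_mul {M : MouldAlg} (hM : M [] = 1) : inv M * M = 1 := by
  rw [inv_eq_comp hM]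
  nth_rw 2 [one_comp_sub M hM]
  have := geoSeries_mul (-1)
  rw [← mul_comp, ← map_mul, show (1 + PowerSeries.X : PowerSeries ℂ)
    = 1 - PowerSeries.C (-1) * PowerSeries.X by simp, this, map_one, one_comp]

lemma inv_nil {M : MouldAlg} (hM : M [] = 1) : inv M [] = 1 := by
  rw [inv_eq_comp hM]; simp [len_apply, geoSeries]

lemma inv_eq_of_mul_eq_one {M N : MouldAlg} (hM : M [] = 1) (h : M * N = 1) : inv M = N := by
  rw [← mul_one (inv M), ← h, ← mul_assoc, inv_mul hM, one_mul]

lemma inv_mul_rev {M N : MouldAlg} (hM : M [] = 1) (hN : N [] = 1) :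
    inv (M * N) = inv N * inv M := by
  refine inv_eq_of_mul_eq_one (by simp [hM, hN]) ?_
  rw [mul_assoc, ← mul_assoc N, mul_inv hN, one_mul, mul_inv hM]

lemma inv_inv {M : MouldAlg} (hM : M [] = 1) : inv (inv M) = M :=
  inv_eq_of_mul_eq_one (inv_nil hM) (inv_mul hM)

lemma inv_expOne (a : ℂ) : inv (expOne a) = expOne (-a) :=
  inv_eq_of_mul_eq_one (by simp) (by simp)

lemma parity_nil (M : MouldAlg) : parity M [] = M [] := by simp [parity_apply]

lemma inv_parity {M : MouldAlg} (hM : M [] = 1) : inv (parity M) = parity (inv M) :=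
  inv_eq_of_mul_eq_one (by rw [parity_nil, hM]) (by rw [← map_mul, mul_inv hM, map_one])

lemma log_comp {M : MouldAlg} (hM : M [] = 1) (B : MouldAlg) :
    log (comp M B) = comp (log M) B := by
  rw [log_eq_comp (M := comp M B) (by rw [comp_nil, hM]), log_eq_comp hM, comp_assoc, sub_comp,
    one_comp]

lemma log_parity {M : MouldAlg} (hM : M [] = 1) : log (parity M) = parity (log M) := by
  rw [log_eq_comp (M := parity M) (by rw [parity_nil, hM]), log_eq_comp hM]
  have h0 : (M - 1) [] = 0 := by rw [sub_apply, hM]; simp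
  refine ext_apply fun w => ?_
  have h1 : parity M - 1 = parity (M - 1) := by rw [map_sub, map_one]
  rw [parity_apply, h1, comp_len_apply _ (by rw [parity_nil, h0]),
    comp_len_apply _ h0, Finset.mul_sum]
  refine Finset.sum_congr rfl fun m _ => ?_
  rw [← map_pow, parity_apply, mul_left_comm]

/-- The coefficientwise form of `(log (1 + b))' = b' / (1 + b)`, for a series `b` without constant
term. -/
lemma sum_logSeries_pow {b d : PowerSeries ℂ} (hb : PowerSeries.constantCoeff b = 0)
    (hd : d * (1 + b) = PowerSeries.derivative ℂ b) (k : ℕ) :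
    (∑ m ∈ Finset.range (k + 2),
      PowerSeries.coeff m logSeries * PowerSeries.coeff (k + 1) (b ^ m)) * ((k : ℂ) + 1)
      = PowerSeries.coeff k d := by
  obtain ⟨b', hb'⟩ := PowerSeries.X_dvd_iff.2 hb
  have hgeom : (∑ j ∈ Finset.range (k + 1), (-b) ^ j) * (PowerSeries.derivative ℂ) b
      = d - PowerSeries.X ^ (k + 1) * ((-b') ^ (k + 1) * d) := by
    have h := geom_sum_mul (-b) (k + 1)
    have hp : (-b) ^ (k + 1) = PowerSeries.X ^ (k + 1) * (-b') ^ (k + 1) := by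
      rw [hb', ← mul_pow]; ring
    rw [hp] at h
    rw [← hd]
    linear_combination (-d) * h
  rw [Finset.sum_range_succ']
  simp only [pow_zero]
  rw [show PowerSeries.coeff 0 logSeries = 0 by simp [logSeries], zero_mul, add_zero,
    Finset.sum_mul]
  have hterm : ∀ j ∈ Finset.range (k + 1),
      PowerSeries.coeff (j + 1) logSeries * PowerSeries.coeff (k + 1) (b ^ (j + 1))
        * ((k : ℂ) + 1)
      = PowerSeries.coeff k ((-b) ^ j * (PowerSeries.derivative ℂ) b) := by
    intro j _
    have hj : ((j : ℂ) + 1) ≠ 0 := Nat.cast_add_one_ne_zero j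
    rw [mul_assoc, ← PowerSeries.coeff_derivative, Derivation.leibniz_pow, logSeries,
      PowerSeries.coeff_mk, neg_pow b j, nsmul_eq_mul, smul_eq_mul]
    have e1 : (((j + 1 : ℕ) : PowerSeries ℂ) * (b ^ (j + 1 - 1) * (PowerSeries.derivative ℂ) b))
        = PowerSeries.C ((j : ℂ) + 1) * (b ^ j * (PowerSeries.derivative ℂ) b) := by simp
    have e2 : (-1 : PowerSeries ℂ) ^ j * b ^ j * (PowerSeries.derivative ℂ) b
        = PowerSeries.C ((-1 : ℂ) ^ j) * (b ^ j * (PowerSeries.derivative ℂ) b) := by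
      simp [mul_assoc]
    rw [e1, e2, PowerSeries.coeff_C_mul, PowerSeries.coeff_C_mul]
    simp only [Nat.add_sub_cancel, Nat.cast_add, Nat.cast_one]
    field_simp
  rw [Finset.sum_congr rfl hterm, ← map_sum, ← Finset.sum_mul, hgeom, map_sub,
    PowerSeries.coeff_X_pow_mul', if_neg (by omega), sub_zero]

/-- The coefficientwise form of `log (1 + ((1 + X)⁻¹ - 1)) = - log (1 + X)`. -/
lemma sum_logSeries_geoSeries (n : ℕ) :
    ∑ m ∈ Finset.range (n + 1),
      PowerSeries.coeff m logSeries * PowerSeries.coeff n ((geoSeries (-1) - 1) ^ m)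
      = -PowerSeries.coeff n logSeries := by
  have hG : geoSeries (-1) * (1 + PowerSeries.X) = 1 := by
    have h := geoSeries_mul (-1)
    rw [map_neg, map_one] at h
    linear_combination h
  cases n with
  | zero => simp [logSeries]
  | succ k =>
    have hk : ((k : ℂ) + 1) ≠ 0 := Nat.cast_add_one_ne_zero k
    apply mul_right_cancel₀ hk
    rw [sum_logSeries_pow (d := -geoSeries (-1))]
    · simp only [map_neg, geoSeries, logSeries, PowerSeries.coeff_mk, Nat.add_sub_cancel,
        Nat.cast_add, Nat.cast_one]
      field_simp
    · simp [geoSeries]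
    · have h := congrArg (PowerSeries.derivative ℂ) hG
      simp only [Derivation.leibniz, map_add, Derivation.map_one_eq_zero,
        PowerSeries.derivative_X, zero_add, smul_eq_mul, mul_one] at h
      rw [map_sub, Derivation.map_one_eq_zero, sub_zero]
      linear_combination (-geoSeries (-1)) * h
        + (PowerSeries.derivative ℂ (geoSeries (-1))) * hG

/-- The logarithm of `exp (a J)` is `a J`. -/
lemma log_expOne_apply (a : ℂ) {w : List ℕ} (hw : w ≠ [1]) : log (expOne a) w = 0 := by
  have h : ∀ m : ℕ, (expOne a - 1) ^ m
      = ones ((PowerSeries.rescale a (PowerSeries.exp ℂ) - 1) ^ m) := by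
    intro m; rw [map_pow, map_sub, map_one, expOne]
  have hc : PowerSeries.constantCoeff (PowerSeries.rescale a (PowerSeries.exp ℂ)) = 1 := by
    rw [← PowerSeries.coeff_zero_eq_constantCoeff_apply, PowerSeries.coeff_rescale]; simp
  rw [log_eq_comp (expOne_nil a), comp_len_apply _ (by simp [sub_apply])]
  simp only [h, ones_apply]
  split_ifs with hone
  swap
  · simp
  rcases hn : w.length with _ | k
  · simp [logSeries]
  have hk : ((k : ℂ) + 1) ≠ 0 := Nat.cast_add_one_ne_zero k
  apply mul_right_cancel₀ hk
  rw [sum_logSeries_pow (d := PowerSeries.C a), PowerSeries.coeff_C, zero_mul, if_neg]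
  · rintro rfl
    obtain ⟨s, rfl⟩ := List.length_eq_one_iff.1 hn
    exact hw (by rw [hone s (by simp)])
  · rw [map_sub, hc]; simp
  · ext n
    rw [add_sub_cancel, PowerSeries.coeff_C_mul, PowerSeries.coeff_rescale,
      PowerSeries.coeff_derivative, map_sub, PowerSeries.coeff_rescale, PowerSeries.coeff_exp,
      PowerSeries.coeff_exp, PowerSeries.coeff_one, if_neg (by omega), Nat.factorial_succ]
    have h1 : ((n : ℂ) + 1) ≠ 0 := Nat.cast_add_one_ne_zero n
    have h2 : ((n.factorial : ℕ) : ℂ) ≠ 0 := by exact_mod_cast n.factorial_ne_zero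
    simp only [one_div, map_inv₀, map_natCast, Nat.cast_mul, Nat.cast_add, Nat.cast_one, sub_zero,
      map_mul, map_add, map_one, pow_succ]
    field_simp

lemma log_inv {M : MouldAlg} (hM : M [] = 1) : log (inv M) = -log M := by
  have h0 : (len (geoSeries (-1) - 1)) [] = 0 := by
    rw [len_apply]; simp [geoSeries]
  have h : comp (len logSeries) (len (geoSeries (-1) - 1)) = -len logSeries := by
    refine ext_apply fun w => ?_
    rw [comp_len_apply _ h0, neg_apply, len_apply, ← sum_logSeries_geoSeries]
    refine Finset.sum_congr rfl fun m _ => ?_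
    rw [← map_pow, len_apply]
  rw [log_eq_comp (inv_nil hM), log_eq_comp hM, inv_eq_comp hM]
  have h1 : comp (len (geoSeries (-1))) (M - 1) - 1
      = comp (len (geoSeries (-1) - 1)) (M - 1) := by
    rw [map_sub, map_one, sub_comp, one_comp]
  rw [h1, ← comp_assoc, h, ← compHom_apply, map_neg, compHom_apply]

/-! ### The series `2 tanh (t / 2)` -/

lemma of_KMould : of KMould = len twoTanhHalf := rfl

lemma of_expSubOneMould : of expSubOneMould = len (PowerSeries.exp ℂ - 1) := by
  refine ext_apply fun w => ?_
  rw [len_apply]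
  cases w with
  | nil => simp [expSubOneMould]
  | cons s u => simp [expSubOneMould, PowerSeries.coeff_exp, PowerSeries.coeff_one]

/-- The series `X / (1 - a X)`. -/
def moebius (a : ℂ) : PowerSeries ℂ := PowerSeries.X * geoSeries a

lemma moebius_mul (a : ℂ) : moebius a * (1 - PowerSeries.C a * PowerSeries.X)
    = PowerSeries.X := by
  rw [moebius, mul_assoc, geoSeries_mul, mul_one]

/-- If `g = f (1 - a f)` for series without constant term, then `X / (1 - a X)` composed with `f`
is `g`. -/
lemma moebius_comp {a : ℂ} {f g : PowerSeries ℂ} (hf : PowerSeries.constantCoeff f = 0)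
    (h : g * (1 - PowerSeries.C a * f) = f) : comp (len (moebius a)) (len f) = len g := by
  have hf0 : len f [] = 0 := by simpa [len_apply] using hf
  have hu : IsUnit (1 - PowerSeries.C a * f) := by
    rw [PowerSeries.isUnit_iff_constantCoeff]; simp [hf]
  have hC : len (PowerSeries.C a) = a • 1 := by
    rw [← mul_one (PowerSeries.C a), ← PowerSeries.smul_eq_C_mul]
    refine ext_apply fun w => ?_
    rw [smul_apply, ← map_one len, len_apply, len_apply, map_smul, smul_eq_mul]
  have h1 := congrArg (fun M => comp (len M) (len f)) (moebius_mul a)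
  simp only [map_mul, map_sub, map_one, mul_comp, sub_comp, one_comp, comp_len_X hf0, hC,
    smul_comp] at h1
  apply (hu.map len).mul_right_cancel
  rw [← map_mul, h]
  simpa [hC] using h1

lemma twoTanhHalf_mul :
    twoTanhHalf * (PowerSeries.rescale (1 / 2 : ℂ) (PowerSeries.exp ℂ)
        + PowerSeries.rescale (-1 / 2 : ℂ) (PowerSeries.exp ℂ))
      = 2 * (PowerSeries.rescale (1 / 2 : ℂ) (PowerSeries.exp ℂ)
        - PowerSeries.rescale (-1 / 2 : ℂ) (PowerSeries.exp ℂ)) := by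
  rw [twoTanhHalf, mul_assoc, mul_assoc, PowerSeries.inv_mul_cancel, mul_one]
  rw [map_add, ← PowerSeries.coeff_zero_eq_constantCoeff_apply,
    ← PowerSeries.coeff_zero_eq_constantCoeff_apply]
  simp [PowerSeries.coeff_rescale]

lemma isUnit_cosh_series : IsUnit (PowerSeries.rescale (1 / 2 : ℂ) (PowerSeries.exp ℂ)
        + PowerSeries.rescale (-1 / 2 : ℂ) (PowerSeries.exp ℂ)) := by
  rw [PowerSeries.isUnit_iff_constantCoeff, map_add,
    ← PowerSeries.coeff_zero_eq_constantCoeff_apply,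
    ← PowerSeries.coeff_zero_eq_constantCoeff_apply]
  simp [PowerSeries.coeff_rescale]

lemma rescale_half_mul : PowerSeries.rescale (1 / 2 : ℂ) (PowerSeries.exp ℂ)
    * PowerSeries.rescale (-1 / 2 : ℂ) (PowerSeries.exp ℂ) = 1 := by
  rw [PowerSeries.exp_mul_exp_eq_exp_add, show (1 / 2 : ℂ) + -1 / 2 = 0 by norm_num]
  simp

lemma rescale_half_sq : PowerSeries.rescale (1 / 2 : ℂ) (PowerSeries.exp ℂ)
    * PowerSeries.rescale (1 / 2 : ℂ) (PowerSeries.exp ℂ) = PowerSeries.exp ℂ := by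
  rw [PowerSeries.exp_mul_exp_eq_exp_add, show (1 / 2 : ℂ) + 1 / 2 = 1 by norm_num]
  simp

lemma twoTanhHalf_odd : PowerSeries.rescale (-1 : ℂ) twoTanhHalf = -twoTanhHalf := by
  have h := congrArg (PowerSeries.rescale (-1 : ℂ)) twoTanhHalf_mul
  simp only [map_mul, map_add, map_sub, PowerSeries.rescale_rescale, map_ofNat] at h
  rw [show (1 / 2 : ℂ) * -1 = -1 / 2 by norm_num, show (-1 / 2 : ℂ) * -1 = 1 / 2 by norm_num] at h
  apply isUnit_cosh_series.mul_right_cancel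
  linear_combination h + twoTanhHalf_mul

lemma coeff_twoTanhHalf_of_even {n : ℕ} (hn : Even n) : PowerSeries.coeff n twoTanhHalf = 0 := by
  have h := congrArg (PowerSeries.coeff n) twoTanhHalf_odd
  rw [PowerSeries.coeff_rescale, hn.neg_one_pow, one_mul, map_neg] at h
  linear_combination h / 2

/-- `X / (1 - X / 2)` composed with `2 tanh (t / 2)` is `e ^ t - 1`. -/
lemma moebius_comp_KMould : comp (len (moebius (1 / 2))) (of KMould) = of expSubOneMould := by
  rw [of_KMould, of_expSubOneMould]
  refine moebius_comp ?_ ?_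
  · rw [← PowerSeries.coeff_zero_eq_constantCoeff_apply]
    exact coeff_twoTanhHalf_of_even (by simp)
  · apply isUnit_cosh_series.mul_right_cancel
    have h2 : PowerSeries.C (1 / 2 : ℂ) * 2 = 1 := by
      rw [← map_ofNat PowerSeries.C, ← map_mul]; norm_num
    set P := PowerSeries.rescale (1 / 2 : ℂ) (PowerSeries.exp ℂ)
    set Q := PowerSeries.rescale (-1 / 2 : ℂ) (PowerSeries.exp ℂ)
    have hk : twoTanhHalf * (P + Q) = 2 * (P - Q) := twoTanhHalf_mul
    have hPQ : P * Q = 1 := rescale_half_mul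
    rw [← rescale_half_sq]
    linear_combination (-(P * P - 1) * PowerSeries.C (1 / 2 : ℂ) - 1) * hk
      - (P * P - 1) * (P - Q) * h2 + 2 * P * hPQ

lemma moebius_comp_moebius (a : ℂ) :
    comp (len (moebius a)) (len (moebius (-a))) = len PowerSeries.X := by
  refine moebius_comp (by simp [moebius]) ?_
  have h := moebius_mul (-a)
  rw [map_neg] at h
  linear_combination -h

/-- As `2 tanh (t / 2)` is odd, composition with `K` commutes with the parity automorphism. -/
lemma parity_comp_KMould (A : MouldAlg) :
    comp (parity A) (of KMould) = parity (comp A (of KMould)) := by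
  refine ext_apply fun w => ?_
  induction hn : w.length using Nat.strong_induction_on generalizing w A with
  | _ n ih =>
    cases w with
    | nil => simp [parity_nil]
    | cons s u =>
      rw [parity_apply, comp_cons, comp_cons, ← splitSum_mul_left]
      refine splitSum_congr fun x y hxy => ?_
      subst hxy
      by_cases hx : Even (x.length + 1)
      · have : (of KMould) (s :: x) = 0 := coeff_twoTanhHalf_of_even hx
        rw [this]; ring
      · have hs : (parity A).shift (s + x.sum)
            = ((-1 : ℂ) ^ (s + x.sum + 1)) • parity (A.shift (s + x.sum)) := by
          refine ext_apply fun v => ?_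
          simp only [shift_apply, smul_apply, parity_apply, List.sum_cons, List.length_cons]
          ring
        rw [hs, smul_comp, smul_apply, ih y.length _ _ _ rfl, parity_apply]
        · have hodd : (-1 : ℂ) ^ (x.length + 1) = -1 := (Nat.not_even_iff_odd.1 hx).neg_one_pow
          have e : (s :: (x ++ y)).sum + (s :: (x ++ y)).length
              = (s + x.sum) + (x.length + 1) + (y.sum + y.length) := by
            simp; ring
          rw [e, pow_add _ (s + x.sum + (x.length + 1)), pow_add _ (s + x.sum) (x.length + 1), hodd,
            pow_succ]
          ring
        · rw [← hn]; simp

/-- Composition with a mould that depends on the length only and has value `1` in length `1`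
does not change a mould supported on the words `(1, …, 1)`, as far as words with positive
letters are concerned. -/
lemma ones_comp_len_apply (f : PowerSeries ℂ) {g : PowerSeries ℂ}
    (hg : PowerSeries.coeff 1 g = 1) {w : List ℕ} (hw : ∀ s ∈ w, 1 ≤ s) :
    comp (ones f) (len g) w = ones f w := by
  induction w generalizing f with
  | nil => simp
  | cons s u ih =>
    have hshift : ∀ n, (ones f).shift n
        = if n = 1 then ones (PowerSeries.mk fun m => PowerSeries.coeff (m + 1) f) else 0 := by
      intro n
      refine ext_apply fun v => ?_
      rw [shift_apply]
      split_ifs with h <;> simp [ones_apply, h, zero_apply]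
    rw [comp_cons, splitSum_eq_left]
    · rw [hshift]
      simp only [List.sum_nil, add_zero, len_apply, List.length_singleton, hg, one_mul]
      rw [← shift_apply, hshift]
      split_ifs with h
      · exact ih _ fun t ht => hw t (by simp [ht])
      · rw [zero_comp]
    · intro x y hxy hx
      have : s + x.sum ≠ 1 := by
        have h1 := hw s (by simp)
        cases x with
        | nil => exact absurd rfl hx
        | cons t x =>
          have h2 := hw t (by simp [← hxy])
          simp; omega
      rw [hshift, if_neg this, zero_comp, zero_apply, mul_zero]

end

end MouldAlg

/-! ### Truncated multitangents and truncated `See` as ordered products -/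

namespace MouldAlg

noncomputable section

/-- The mould supported on the one-letter words, with value `x ^ (-s)` at `(s)`. -/
def mono (x : ℂ) : MouldAlg := of fun w => if w.length = 1 then (x ^ w.sum)⁻¹ else 0

/-- The mould `(1 - mono x / 2)⁻¹`. -/
def halfBlock (x : ℂ) : MouldAlg := of fun w => (1 / 2) ^ w.length * (x ^ w.sum)⁻¹

/-- The mould `(1 + mono x / 2) / (1 - mono x / 2)`: the factor that a point contributes to a
multiple sum with large inequalities, where each equality has weight `1 / 2`. -/
def block (x : ℂ) : MouldAlg := (2 : ℂ) • halfBlock x - 1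

/-- The truncation of `See₊`, in the mould algebra. -/
def seeTrunc (k : ℕ) (z : ℂ) : MouldAlg := of (doSeePlus k z)

@[simp] lemma mono_nil (x : ℂ) : mono x [] = 0 := by simp [mono]
@[simp] lemma halfBlock_nil (x : ℂ) : halfBlock x [] = 1 := by simp [halfBlock]
@[simp] lemma block_nil (x : ℂ) : block x [] = 1 := by
  rw [block, sub_apply, smul_apply]; norm_num

lemma mul_mono_append (A : MouldAlg) (x : ℂ) (w : List ℕ) (s : ℕ) :
    (A * mono x) (w ++ [s]) = A w * (x ^ s)⁻¹ := by
  rw [mul_append_singleton, splitSum_eq_right]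
  · simp [mono]
  · intro u v _ hv
    simp [mono, hv]

lemma mono_mul_cons (A : MouldAlg) (x : ℂ) (w : List ℕ) (s : ℕ) :
    (mono x * A) (s :: w) = (x ^ s)⁻¹ * A w := by
  rw [mul_cons, splitSum_eq_left]
  · simp [mono]
  · intro u v _ hu
    simp [mono, hu]

lemma halfBlock_mul (x : ℂ) : halfBlock x * (1 - (1 / 2 : ℂ) • mono x) = 1 := by
  refine ext_apply fun w => ?_
  rw [mul_sub, mul_one, mul_smul_comm, sub_apply, smul_apply]
  induction w using List.reverseRecOn with
  | nil => simp
  | append_singleton u s _ =>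
    rw [mul_mono_append]
    simp [halfBlock, one_apply, pow_succ, pow_add]
    ring

lemma mul_halfBlock (x : ℂ) : (1 - (1 / 2 : ℂ) • mono x) * halfBlock x = 1 := by
  refine ext_apply fun w => ?_
  rw [sub_mul, one_mul, smul_mul_assoc, sub_apply, smul_apply]
  cases w with
  | nil => simp
  | cons s u =>
    rw [mono_mul_cons]
    simp [halfBlock, pow_succ, pow_add]
    ring

lemma block_mul (x : ℂ) :
    block x * (1 - (1 / 2 : ℂ) • mono x) = 1 + (1 / 2 : ℂ) • mono x := by
  rw [block, sub_mul, smul_mul_assoc, halfBlock_mul, one_mul]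
  module

lemma halfBlock_mul_add (x : ℂ) : halfBlock x * (1 + (1 / 2 : ℂ) • mono x) = block x := by
  have h : (1 : MouldAlg) + (1 / 2 : ℂ) • mono x
      = (2 : ℂ) • (1 : MouldAlg) - (1 - (1 / 2 : ℂ) • mono x) := by module
  rw [h, mul_sub, halfBlock_mul, mul_smul_comm, mul_one, block]

lemma parity_smul (a : ℂ) (A : MouldAlg) : parity (a • A) = a • parity A := by
  refine ext_apply fun w => ?_
  simp only [parity_apply, smul_apply]; ring

lemma inv_neg_pow (x : ℂ) (s : ℕ) : ((-x) ^ s)⁻¹ = (-1) ^ s * (x ^ s)⁻¹ := by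
  rw [neg_pow x, mul_inv_rev, ← inv_pow (-1 : ℂ), inv_neg_one, mul_comm]

lemma parity_mono (x : ℂ) : parity (mono (-x)) = -mono x := by
  refine ext_apply fun w => ?_
  rw [parity_apply, neg_apply]
  simp only [mono, mul_ite, mul_zero]
  split_ifs with h
  · rw [h, inv_neg_pow, pow_succ]
    have : ((-1 : ℂ) ^ w.sum) * (-1) ^ w.sum = 1 := by rw [← mul_pow]; simp
    linear_combination -(x ^ w.sum)⁻¹ * this
  · simp

/-- Reflection turns the factor of a point into the inverse factor. -/
lemma block_mul_parity_block (x : ℂ) : block x * parity (block (-x)) = 1 := by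
  have h := congrArg parity (block_mul (-x))
  have h' := congrArg parity (mul_halfBlock (-x))
  simp only [map_mul, map_sub, map_add, map_one, parity_smul, parity_mono, smul_neg,
    sub_neg_eq_add, ← sub_eq_add_neg] at h h'
  calc block x * parity (block (-x))
      = block x * (parity (block (-x)) * (1 + (1 / 2 : ℂ) • mono x)) * parity (halfBlock (-x)) := by
        rw [mul_assoc, mul_assoc, h', mul_one]
    _ = 1 := by rw [h, block_mul, h']

lemma seeTrunc_append (k : ℕ) (z : ℂ) (w : List ℕ) (s : ℕ) :
    seeTrunc k z (w ++ [s]) = (1 / 2) * (seeTrunc k z w * (z ^ s)⁻¹)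
      + ∑ n ∈ Finset.range k,
        seeTrunc (k - (n + 1)) (z + (n + 1 : ℕ)) w * ((z + (n + 1 : ℕ)) ^ s)⁻¹ := by
  simp only [seeTrunc, doSeePlus, List.reverse_append, List.reverse_cons, List.reverse_nil,
    List.nil_append, List.singleton_append, seeInduction, HPlus]
  congr 1
  rw [← Finset.Ico_add_one_right_eq_Icc, Finset.sum_Ico_eq_sum_range]
  simp only [Nat.add_sub_cancel, add_comm 1]

@[simp] lemma seeTrunc_nil (k : ℕ) (z : ℂ) : seeTrunc k z [] = 1 := by
  simp [seeTrunc, doSeePlus, seeInduction]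

lemma seeTrunc_zero (z : ℂ) : seeTrunc 0 z = halfBlock z := by
  refine ext_apply fun w => ?_
  induction w using List.reverseRecOn with
  | nil => simp
  | append_singleton u s ih =>
    rw [seeTrunc_append, ih]
    simp [halfBlock, pow_succ, pow_add]
    ring

/-- The truncated form of the difference equation of `See₊`. -/
lemma seeTrunc_succ_mul (k : ℕ) (z : ℂ) :
    seeTrunc (k + 1) z * (1 - (1 / 2 : ℂ) • mono z)
      = seeTrunc k (z + 1) * (1 + (1 / 2 : ℂ) • mono (z + 1)) := by
  refine ext_apply fun w => ?_
  rw [mul_sub, mul_one, mul_smul_comm, sub_apply, smul_apply, mul_add, mul_one, mul_smul_comm,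
    add_apply, smul_apply]
  induction w using List.reverseRecOn with
  | nil => simp
  | append_singleton u s _ =>
    rw [mul_mono_append, mul_mono_append, seeTrunc_append, seeTrunc_append,
      Finset.sum_range_succ']
    have h : ∀ n ∈ Finset.range k,
        seeTrunc (k + 1 - (n + 1 + 1)) (z + (n + 1 + 1 : ℕ)) u * ((z + (n + 1 + 1 : ℕ)) ^ s)⁻¹
        = seeTrunc (k - (n + 1)) (z + 1 + (n + 1 : ℕ)) u * ((z + 1 + (n + 1 : ℕ)) ^ s)⁻¹ := by
      intro n _
      rw [show k + 1 - (n + 1 + 1) = k - (n + 1) by omega,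
        show z + ((n + 1 + 1 : ℕ) : ℂ) = z + 1 + (n + 1 : ℕ) by push_cast; ring]
    rw [Finset.sum_congr rfl h]
    simp only [zero_add, Nat.cast_one, Nat.add_sub_cancel]
    ring

/-- A larger truncation adds the factor of the new extreme point on the left. -/
lemma seeTrunc_succ (k : ℕ) (z : ℂ) :
    seeTrunc (k + 1) z = block (z + (k + 1 : ℕ)) * seeTrunc k z := by
  have cancel : ∀ (z : ℂ) (A B : MouldAlg),
      A * (1 - (1 / 2 : ℂ) • mono z) = B * (1 - (1 / 2 : ℂ) • mono z) → A = B := by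
    intro z A B h
    rw [← mul_one A, ← mul_halfBlock z, ← mul_assoc, h, mul_assoc, mul_halfBlock, mul_one]
  induction k generalizing z with
  | zero =>
    apply cancel
    rw [seeTrunc_succ_mul, seeTrunc_zero, seeTrunc_zero, mul_assoc, halfBlock_mul,
      halfBlock_mul_add, mul_one]
    simp
  | succ k ih =>
    apply cancel
    rw [seeTrunc_succ_mul, ih, mul_assoc, ← seeTrunc_succ_mul, ← mul_assoc]
    congr 3
    push_cast; ring

/-- The model `-` is the reflection of the model `+`. -/
lemma of_doSeeMinus (k : ℕ) (z : ℂ) : of (doSeeMinus k z) = parity (seeTrunc k (-z)) := by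
  refine ext_apply fun w => ?_
  change doSeeMinus k z w = _
  rw [parity_apply]
  induction w using List.reverseRecOn generalizing k z with
  | nil => simp [doSeeMinus, seeInduction]
  | append_singleton u s ih =>
    have h : ∀ x : ℂ, (x ^ s)⁻¹ = (-1) ^ s * ((-x) ^ s)⁻¹ := fun x => by
      rw [← inv_neg_pow, neg_neg]
    have h1 : doSeeMinus k z (u ++ [s]) = -(1 / 2) * (doSeeMinus k z u * (z ^ s)⁻¹)
        - ∑ n ∈ Finset.range k,
        doSeeMinus (k - (n + 1)) (z - (n + 1 : ℕ)) u * ((z - (n + 1 : ℕ)) ^ s)⁻¹ := by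
      simp only [doSeeMinus, List.reverse_append, List.reverse_cons, List.reverse_nil,
        List.nil_append, List.singleton_append, seeInduction, HMinus]
      congr 1
      rw [← Finset.Ico_add_one_right_eq_Icc, Finset.sum_Ico_eq_sum_range]
      simp only [Nat.add_sub_cancel, add_comm 1]
    rw [h1, seeTrunc_append, ih, mul_add, Finset.mul_sum, sub_eq_add_neg, ← Finset.sum_neg_distrib]
    congr 1
    · rw [h z]; simp [pow_add]; ring
    · refine Finset.sum_congr rfl fun n _ => ?_
      rw [ih, h (z - (n + 1 : ℕ)), neg_sub, ← neg_add_eq_sub, neg_add_eq_sub, ← neg_sub z,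
        show -(z - ((n + 1 : ℕ) : ℂ)) = -z + (n + 1 : ℕ) by ring]
      simp [pow_add]; ring

/-- Together with `seeTrunc_mul_inv_zero`, this exhibits the truncation of `Tee` before the
corrections as the ordered product of the factors of the points `z + k, …, z - k`. -/
lemma seeTrunc_mul_inv_succ (k : ℕ) (z : ℂ) :
    seeTrunc (k + 1) z * inv (parity (seeTrunc (k + 1) (-z)))
      = block (z + (k + 1 : ℕ)) * (seeTrunc k z * inv (parity (seeTrunc k (-z))))
        * block (z - (k + 1 : ℕ)) := by
  have h : inv (parity (block (-z + (k + 1 : ℕ)))) = block (z - (k + 1 : ℕ)) := by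
    have h1 := block_mul_parity_block (z - (k + 1 : ℕ))
    rw [show -(z - ((k + 1 : ℕ) : ℂ)) = -z + (k + 1 : ℕ) by ring] at h1
    rw [← inv_inv (block_nil (z - (k + 1 : ℕ))), inv_eq_of_mul_eq_one (block_nil _) h1]
  rw [seeTrunc_succ, seeTrunc_succ k (-z), map_mul, inv_mul_rev, h]
  · simp only [mul_assoc]
  · simp [parity_nil]
  · simp [parity_nil]

lemma seeTrunc_mul_inv_zero (z : ℂ) :
    seeTrunc 0 z * inv (parity (seeTrunc 0 (-z))) = block z := by
  have h' := congrArg parity (halfBlock_mul (-z))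
  simp only [map_mul, map_sub, map_one, parity_smul, parity_mono, smul_neg,
    sub_neg_eq_add] at h'
  rw [seeTrunc_zero, seeTrunc_zero, inv_eq_of_mul_eq_one _ h', halfBlock_mul_add]
  simp [parity_nil]

open Classical in
/-- Sum of `∏ (n_i + z) ^ (-s_i)` over the strictly decreasing sequences in `[a, b)`. -/
def decSum (a b : ℤ) (z : ℂ) : MouldAlg := of fun w =>
  ∑ n ∈ (Fintype.piFinset fun _ : Fin w.length => Finset.Ico a b).filter (fun n => StrictAnti n),
    ∏ i : Fin w.length, (((n i : ℂ) + z) ^ (w.get i))⁻¹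

lemma of_doTe (k : ℕ) (z : ℂ) : of (doTe k z) = decSum (-k) (k + 1) z := by
  rw [decSum, ← Finset.Icc_sub_one_right_eq_Ico, add_sub_cancel_right]
  rfl

lemma decSum_nil (a b : ℤ) (z : ℂ) : decSum a b z [] = 1 := by
  have h : StrictAnti (default : Fin ([] : List ℕ).length → ℤ) := fun i => i.elim0
  simp [decSum, Finset.filter_true_of_mem, Subsingleton.strictAnti]

lemma decSum_cons (a b : ℤ) (z : ℂ) (s : ℕ) (u : List ℕ) :
    decSum a b z (s :: u)
      = ∑ n ∈ Finset.Ico a b, (((n : ℂ) + z) ^ s)⁻¹ * decSum a n z u := by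
  simp only [decSum, Finset.mul_sum]
  rw [Finset.sum_sigma']
  refine Finset.sum_bij'
    (i := fun (n : Fin (u.length + 1) → ℤ) _ => (⟨n 0, Fin.tail n⟩ : (_ : ℤ) × (Fin u.length → ℤ)))
    (j := fun p _ => (Fin.cons p.1 p.2 : Fin (u.length + 1) → ℤ)) ?_ ?_ ?_ ?_ ?_
  · intro n hn
    simp only [Finset.mem_filter, Fintype.mem_piFinset, Finset.mem_Ico] at hn
    simp only [Finset.mem_sigma, Finset.mem_filter, Fintype.mem_piFinset, Finset.mem_Ico]
    refine ⟨hn.1 0, fun i => ⟨(hn.1 i.succ).1, hn.2 i.succ_pos⟩, fun i j hij => ?_⟩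
    exact hn.2 (Fin.succ_lt_succ_iff.2 hij)
  · rintro ⟨n, m⟩ h
    simp only [Finset.mem_sigma, Finset.mem_filter, Fintype.mem_piFinset, Finset.mem_Ico] at h
    simp only [Finset.mem_filter, Fintype.mem_piFinset, Finset.mem_Ico]
    refine ⟨fun i => ?_, fun i j hij => ?_⟩
    · refine Fin.cases ?_ (fun i => ?_) i
      · exact h.1
      · exact ⟨(h.2.1 i).1, (h.2.1 i).2.trans h.1.2⟩
    · obtain ⟨j, rfl⟩ := Fin.exists_succ_eq.2 (Fin.ne_zero_of_lt hij)
      revert hij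
      refine Fin.cases (fun _ => ?_) (fun i hij => ?_) i
      · exact (h.2.1 j).2
      · exact h.2.2 (Fin.succ_lt_succ_iff.1 hij)
  · intro n _
    exact Fin.cons_self_tail n
  · rintro ⟨n, m⟩ _
    rfl
  · intro n _
    exact Fin.prod_univ_succ (n := u.length) _

lemma decSum_self (a : ℤ) (z : ℂ) : decSum a a z = 1 := by
  refine ext_apply fun w => ?_
  cases w with
  | nil => rw [decSum_nil, one_nil]
  | cons s u => rw [decSum_cons]; simp

lemma decSum_succ_top {a b : ℤ} (h : a ≤ b) (z : ℂ) :
    decSum a (b + 1) z = (1 + mono (b + z)) * decSum a b z := by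
  refine ext_apply fun w => ?_
  rw [add_mul, one_mul, add_apply]
  cases w with
  | nil => simp [decSum_nil]
  | cons s u =>
    rw [mono_mul_cons, decSum_cons, decSum_cons,
      ← Finset.insert_Ico_right_eq_Ico_add_one h, Finset.sum_insert (by simp), add_comm]

lemma decSum_succ_bot {a b : ℤ} (h : a + 1 ≤ b) (z : ℂ) :
    decSum a b z = decSum (a + 1) b z * (1 + mono (a + z)) := by
  induction b, h using Int.leInduction with
  | base => rw [decSum_succ_top le_rfl, decSum_self, decSum_self, mul_one, one_mul]
  | succ b hb ih => rw [decSum_succ_top (by omega), ih, decSum_succ_top hb, mul_assoc]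

lemma of_doTe_zero (z : ℂ) : of (doTe 0 z) = 1 + mono z := by
  rw [of_doTe, decSum_succ_top (by simp)]
  simp [decSum_self]

lemma of_doTe_succ (k : ℕ) (z : ℂ) : of (doTe (k + 1) z)
    = (1 + mono (z + (k + 1 : ℕ))) * of (doTe k z) * (1 + mono (z - (k + 1 : ℕ))) := by
  rw [of_doTe, of_doTe, decSum_succ_top (by omega), decSum_succ_bot (by push_cast; omega),
    ← mul_assoc]
  push_cast
  congr 3
  · congr 1; ring
  · ring
  · ring

/-- `1 + mono x` composed with the mould of `X / (1 - X / 2)` is `block x`. -/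
lemma comp_one_add_mono (x : ℂ) : comp (1 + mono x) (len (moebius (1 / 2))) = block x := by
  rw [add_comp, one_comp, block]
  refine ext_apply fun w => ?_
  rw [add_apply, sub_apply, smul_apply]
  cases w with
  | nil => norm_num
  | cons s u =>
    have hs : ∀ n, (mono x).shift n = ((x ^ n)⁻¹ : ℂ) • (1 : MouldAlg) := by
      intro n
      refine ext_apply fun v => ?_
      rw [smul_apply, one_apply, shift_apply, mono]
      cases v <;> simp
    rw [comp_cons, splitSum_eq_right]
    · rw [hs, smul_comp, one_comp]
      rw [len_apply, moebius, List.length_cons, PowerSeries.coeff_succ_X_mul]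
      simp [geoSeries, halfBlock, smul_apply, pow_succ']
      ring
    · intro a b _ hb
      rw [hs, smul_comp, one_comp, smul_apply, one_apply, if_neg hb]; simp

/-- Passing from strict to large inequalities: composition of the truncated multitangents with
the mould of `X / (1 - X / 2)` gives the truncated `Tee`. -/
lemma comp_doTe (k : ℕ) (z : ℂ) : comp (of (doTe k z)) (len (moebius (1 / 2)))
    = seeTrunc k z * inv (parity (seeTrunc k (-z))) := by
  induction k with
  | zero => rw [of_doTe_zero, comp_one_add_mono, seeTrunc_mul_inv_zero]
  | succ k ih =>
    rw [of_doTe_succ, mul_comp, mul_comp, comp_one_add_mono, comp_one_add_mono, ih,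
      seeTrunc_mul_inv_succ]

/-- Two moulds agree on the words with positive letters. Letters `0` are excluded throughout: the
multiple sums diverge on them. -/
def PosEq (A B : MouldAlg) : Prop := ∀ w : List ℕ, (∀ s ∈ w, 1 ≤ s) → A w = B w

lemma PosEq.refl (A : MouldAlg) : PosEq A A := fun _ _ => rfl
lemma PosEq.symm {A B : MouldAlg} (h : PosEq A B) : PosEq B A := fun w hw => (h w hw).symm
lemma PosEq.trans {A B C : MouldAlg} (h : PosEq A B) (h' : PosEq B C) : PosEq A C :=
  fun w hw => (h w hw).trans (h' w hw)

lemma PosEq.mul {A A' B B' : MouldAlg} (h : PosEq A A') (h' : PosEq B B') :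
    PosEq (A * B) (A' * B') := by
  intro w hw
  rw [mul_apply, mul_apply]
  refine splitSum_congr fun x y hxy => ?_
  subst hxy
  rw [h x fun s hs => hw s (by simp [hs]), h' y fun s hs => hw s (by simp [hs])]

lemma PosEq.comp {A A' : MouldAlg} (h : PosEq A A') (B : MouldAlg) :
    PosEq (comp A B) (comp A' B) :=
  fun _ hw => comp_congr fun v hv => h v (hv.pos hw)

/-- The truncated and corrected `See₊`. -/
def seeCor (c : ℂ) (k : ℕ) (z : ℂ) : MouldAlg := expOne (-c - Real.log k) * seeTrunc k z

/-- The truncated and corrected `Tee`. -/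
def teeCor (c : ℂ) (k : ℕ) (z : ℂ) : MouldAlg := seeCor c k z * inv (parity (seeCor c k (-z)))

@[simp] lemma seeCor_nil (c : ℂ) (k : ℕ) (z : ℂ) : seeCor c k z [] = 1 := by simp [seeCor]

lemma of_seePlus_trunc (c : ℂ) (k : ℕ) (z : ℂ) :
    of (mouldMul (invcoSe c k) (doSeePlus k z)) = seeCor c k z := by
  rw [seeCor, ← of_invcoSe]; rfl

lemma of_seeMinus_trunc (c : ℂ) (k : ℕ) (z : ℂ) :
    of (mouldMul (invcoSe c k) (doSeeMinus k z)) = parity (seeCor c k (-z)) := by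
  rw [seeCor, map_mul, parity_expOne, ← of_doSeeMinus, ← of_invcoSe]; rfl

lemma teeCor_eq (c : ℂ) (k : ℕ) (z : ℂ) : teeCor c k z = expOne (-c - Real.log k)
    * (seeTrunc k z * inv (parity (seeTrunc k (-z)))) * expOne (c + Real.log k) := by
  rw [teeCor, seeCor, seeCor, map_mul, parity_expOne, inv_mul_rev (by simp) (by simp [parity_nil]),
    inv_expOne]
  simp only [mul_assoc]
  congr 4
  ring

/-- The truncated multitangents are obtained from the truncated `Tee` by composition; the corrective
exponentials are fixed by the composition. -/
lemma posEq_teTrunc (c : ℂ) (k : ℕ) (z : ℂ) :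
    PosEq (of (TeTrunc c k z)) (comp (teeCor c k z) (len (moebius (-(1 / 2))))) := by
  have h1 : of (TeTrunc c k z)
      = expOne (-c - Real.log k) * of (doTe k z) * expOne (c + Real.log k) := by
    rw [← of_invcoSe, ← of_coSe]; rfl
  have h2 : PosEq (comp (of (TeTrunc c k z)) (len (moebius (1 / 2)))) (teeCor c k z) := by
    have hg : PowerSeries.coeff 1 (moebius (1 / 2)) = 1 := by
      exact (PowerSeries.coeff_succ_X_mul 0 (geoSeries (1 / 2))).trans (by simp [geoSeries])
    rw [h1, mul_comp, mul_comp, comp_doTe, teeCor_eq]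
    exact (PosEq.mul (fun w hw => ones_comp_len_apply _ hg hw) (PosEq.refl _)).mul
      (fun w hw => ones_comp_len_apply _ hg hw)
  have h3 := h2.comp (len (moebius (-(1 / 2))))
  rwa [comp_assoc, moebius_comp_moebius, comp_len_X_right] at h3

end

end MouldAlg

/-! ### Entrywise limits, holomorphy and growth of families of moulds -/

lemma tendsto_splitSum {ι : Type*} {l : Filter ι} {w : List ℕ} {φ : ι → List ℕ → List ℕ → ℂ}
    {ψ : List ℕ → List ℕ → ℂ}
    (h : ∀ x y, x ++ y = w → Tendsto (fun i => φ i x y) l (𝓝 (ψ x y))) :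
    Tendsto (fun i => splitSum w (φ i)) l (𝓝 (splitSum w ψ)) := by
  simp only [← sum_range_take_drop]
  exact tendsto_finsetSum _ fun i _ => h _ _ (List.take_append_drop i w)

namespace MouldAlg

noncomputable section

/-- Convergence of a family of moulds at each word with positive letters. -/
def MTendsto {ι : Type*} (l : Filter ι) (M : ι → MouldAlg) (L : MouldAlg) : Prop :=
  ∀ w : List ℕ, (∀ s ∈ w, 1 ≤ s) → Tendsto (fun i => M i w) l (𝓝 (L w))

section MTendsto

variable {ι : Type*} {l : Filter ι} {M N : ι → MouldAlg} {L L' : MouldAlg}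

lemma mtendsto_const (L : MouldAlg) : MTendsto l (fun _ => L) L :=
  fun _ _ => tendsto_const_nhds

lemma MTendsto.congr_left (h : MTendsto l M L) (h' : ∀ i, PosEq (M i) (N i)) : MTendsto l N L :=
  fun w hw => (h w hw).congr fun i => h' i w hw

lemma MTendsto.congr_right (h : MTendsto l M L) (h' : PosEq L L') : MTendsto l M L' :=
  fun w hw => h' w hw ▸ h w hw

lemma MTendsto.posEq [l.NeBot] (h : MTendsto l M L) (h' : MTendsto l M L') : PosEq L L' :=
  fun w hw => tendsto_nhds_unique (h w hw) (h' w hw)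

lemma MTendsto.add (h : MTendsto l M L) (h' : MTendsto l N L') :
    MTendsto l (fun i => M i + N i) (L + L') :=
  fun w hw => (h w hw).add (h' w hw)

lemma MTendsto.sub (h : MTendsto l M L) (h' : MTendsto l N L') :
    MTendsto l (fun i => M i - N i) (L - L') :=
  fun w hw => (h w hw).sub (h' w hw)

lemma MTendsto.mul (h : MTendsto l M L) (h' : MTendsto l N L') :
    MTendsto l (fun i => M i * N i) (L * L') := by
  intro w hw
  simp only [mul_apply]
  refine tendsto_splitSum fun x y hxy => ?_
  subst hxy
  exact (h x fun s hs => hw s (by simp [hs])).mul (h' y fun s hs => hw s (by simp [hs]))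

lemma MTendsto.pow (h : MTendsto l M L) (m : ℕ) : MTendsto l (fun i => M i ^ m) (L ^ m) := by
  induction m with
  | zero => simpa using mtendsto_const (1 : MouldAlg)
  | succ m ih => simpa only [pow_succ] using ih.mul h

lemma MTendsto.parity (h : MTendsto l M L) :
    MTendsto l (fun i => parity (M i)) (parity L) :=
  fun w hw => (h w hw).const_mul _

lemma MTendsto.comp_len {f : PowerSeries ℂ} (h : MTendsto l M L) (hM : ∀ i, M i [] = 0)
    (hL : L [] = 0) : MTendsto l (fun i => comp (len f) (M i)) (comp (len f) L) := by
  intro w hw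
  simp only [comp_len_apply f (hM _), comp_len_apply f hL]
  exact tendsto_finsetSum _ fun m _ => ((h.pow m) w hw).const_mul _

lemma MTendsto.inv (h : MTendsto l M L) (hM : ∀ i, M i [] = 1) (hL : L [] = 1) :
    MTendsto l (fun i => inv (M i)) (inv L) := by
  simp only [inv_eq_comp (hM _), inv_eq_comp hL]
  exact (h.sub (mtendsto_const 1)).comp_len (fun i => by simp [sub_apply, hM])
    (by simp [sub_apply, hL])

lemma MTendsto.log (h : MTendsto l M L) (hM : ∀ i, M i [] = 1) (hL : L [] = 1) :
    MTendsto l (fun i => log (M i)) (log L) := by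
  simp only [log_eq_comp (hM _), log_eq_comp hL]
  exact (h.sub (mtendsto_const 1)).comp_len (fun i => by simp [sub_apply, hM])
    (by simp [sub_apply, hL])

lemma MTendsto.nil_eq_one [l.NeBot] (h : MTendsto l M L) (hM : ∀ i, M i [] = 1) : L [] = 1 := by
  have := h [] (by simp)
  simp only [hM] at this
  exact tendsto_nhds_unique this tendsto_const_nhds

end MTendsto

lemma isCoarsening_map_sum (ns : List ℕ) (w : List ℕ) (hpos : ∀ n ∈ ns, 0 < n)
    (hsum : ns.sum = w.length) :
    IsCoarsening w ((w.splitWrtCompositionAux ns).map List.sum) := by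
  induction ns generalizing w with
  | nil =>
    obtain rfl : w = [] := List.eq_nil_of_length_eq_zero (by simpa using hsum.symm)
    exact ⟨rfl, le_rfl, by simp [List.splitWrtCompositionAux], by simp⟩
  | cons n ns ih =>
    rw [List.sum_cons] at hsum
    have hn : 0 < n := hpos n (by simp)
    have h := ih (w.drop n) (fun m hm => hpos m (by simp [hm])) (by simp; omega)
    rw [List.splitWrtCompositionAux_cons, List.map_cons]
    refine ⟨?_, ?_, ?_, by simp⟩
    · rw [List.sum_cons, h.sum_eq, ← List.sum_append, List.take_append_drop]
    · have := h.length_le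
      simp only [List.length_drop] at this
      rw [List.length_cons]; omega
    · intro hw t ht
      rcases List.mem_cons.1 ht with rfl | ht
      · cases w with
        | nil => simp at hsum; omega
        | cons s u =>
          obtain ⟨m, rfl⟩ := Nat.exists_eq_add_of_lt hn
          have := hw s (by simp)
          simp; omega
      · exact h.pos (fun t ht => hw t (List.mem_of_mem_drop ht)) t ht

/-- Composition at a given word is a finite linear combination, with coefficients independent of
the left factor, of the values of the left factor at the words of block sums. -/
lemma exists_comp_eq_sum (B : MouldAlg) (w : List ℕ) :
    ∃ (a : Composition w.length → ℂ) (v : Composition w.length → List ℕ),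
      (∀ p, IsCoarsening w (v p)) ∧ ∀ A : MouldAlg, comp A B w = ∑ p, A (v p) * a p :=
  ⟨fun p => ((w.splitWrtComposition p).map B.toMould).prod,
    fun p => (w.splitWrtComposition p).map List.sum,
    fun p => isCoarsening_map_sum _ _ (fun _ h => p.blocks_pos h) p.blocks_sum, fun _ => rfl⟩

lemma MTendsto.comp {ι : Type*} {l : Filter ι} {M : ι → MouldAlg} {L : MouldAlg}
    (h : MTendsto l M L) (B : MouldAlg) : MTendsto l (fun i => comp (M i) B) (comp L B) := by
  intro w hw
  obtain ⟨a, v, hv, hc⟩ := exists_comp_eq_sum B w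
  simp only [hc]
  exact tendsto_finsetSum _ fun p _ => (h (v p) ((hv p).pos hw)).mul_const _

/-- Differentiability of a family of moulds at each word with positive letters. -/
def MDiffAt (M : ℂ → MouldAlg) (z : ℂ) : Prop :=
  ∀ w : List ℕ, (∀ s ∈ w, 1 ≤ s) → DifferentiableAt ℂ (fun x => M x w) z

section MDiffAt

variable {M N : ℂ → MouldAlg} {z : ℂ}

lemma mdiffAt_const (L : MouldAlg) : MDiffAt (fun _ => L) z :=
  fun _ _ => differentiableAt_const _

lemma MDiffAt.sub (h : MDiffAt M z) (h' : MDiffAt N z) : MDiffAt (fun x => M x - N x) z :=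
  fun w hw => (h w hw).sub (h' w hw)

lemma MDiffAt.mul (h : MDiffAt M z) (h' : MDiffAt N z) : MDiffAt (fun x => M x * N x) z := by
  intro w hw
  simp only [mul_apply, ← sum_range_take_drop]
  refine DifferentiableAt.fun_sum fun i _ => ?_
  exact (h _ fun s hs => hw s (List.mem_of_mem_take hs)).mul
    (h' _ fun s hs => hw s (List.mem_of_mem_drop hs))

lemma MDiffAt.pow (h : MDiffAt M z) (m : ℕ) : MDiffAt (fun x => M x ^ m) z := by
  induction m with
  | zero => simpa using mdiffAt_const (1 : MouldAlg)
  | succ m ih => simpa only [pow_succ] using ih.mul h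

lemma MDiffAt.parity (h : MDiffAt M z) : MDiffAt (fun x => parity (M x)) z :=
  fun w hw => (h w hw).const_mul _

lemma MDiffAt.comp_len {f : PowerSeries ℂ} (h : MDiffAt M z) (hM : ∀ x, M x [] = 0) :
    MDiffAt (fun x => comp (len f) (M x)) z := by
  intro w hw
  simp only [comp_len_apply f (hM _)]
  exact DifferentiableAt.fun_sum fun m _ => ((h.pow m) w hw).const_mul _

lemma MDiffAt.inv (h : MDiffAt M z) (hM : ∀ x, M x [] = 1) :
    MDiffAt (fun x => inv (M x)) z := by
  simp only [inv_eq_comp (hM _)]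
  exact (h.sub (mdiffAt_const 1)).comp_len (fun i => by simp [sub_apply, hM])

lemma MDiffAt.log (h : MDiffAt M z) (hM : ∀ x, M x [] = 1) :
    MDiffAt (fun x => log (M x)) z := by
  simp only [log_eq_comp (hM _)]
  exact (h.sub (mdiffAt_const 1)).comp_len (fun i => by simp [sub_apply, hM])

lemma mdiffAt_expOne {f : ℂ → ℂ} (hf : DifferentiableAt ℂ f z) :
    MDiffAt (fun x => expOne (f x)) z := by
  intro w _
  simp only [expOne_apply]
  split_ifs
  · exact (hf.pow _).div_const _
  · exact differentiableAt_const _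

lemma mdiffAt_halfBlock {f : ℂ → ℂ} (hf : DifferentiableAt ℂ f z) (h0 : f z ≠ 0) :
    MDiffAt (fun x => halfBlock (f x)) z := by
  intro w _
  simp only [halfBlock]
  exact ((hf.pow _).inv (pow_ne_zero _ h0)).const_mul _

lemma mdiffAt_block {f : ℂ → ℂ} (hf : DifferentiableAt ℂ f z) (h0 : f z ≠ 0) :
    MDiffAt (fun x => block (f x)) z := by
  intro w hw
  simp only [block, sub_apply, smul_apply]
  exact ((mdiffAt_halfBlock hf h0 w hw).const_mul _).sub_const _

end MDiffAt

/-- The entries of `M` at the words with positive letters grow at most like `‖y‖ ^ α` on `D`. -/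
def GrowthOn (D : Set ℂ) (α : ℝ) (M : ℂ → MouldAlg) : Prop :=
  ∀ w : List ℕ, (∀ s ∈ w, 1 ≤ s) → (fun y => M y w) =O[𝓟 D] (fun y => ‖y‖ ^ α)

section GrowthOn

variable {D : Set ℂ} {α β : ℝ} {M N : ℂ → MouldAlg}

lemma isBigO_rpow_mul (hD : ∀ y ∈ D, 1 ≤ ‖y‖) {f g : ℂ → ℂ}
    (hf : f =O[𝓟 D] (fun y => ‖y‖ ^ α)) (hg : g =O[𝓟 D] (fun y => ‖y‖ ^ β)) :
    (fun y => f y * g y) =O[𝓟 D] (fun y => ‖y‖ ^ (α + β)) := by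
  refine (hf.mul hg).congr' EventuallyEq.rfl ?_
  filter_upwards [mem_principal_self D] with y hy
  rw [Real.rpow_add (by linarith [hD y hy])]

lemma isBigO_rpow_mono (hD : ∀ y ∈ D, 1 ≤ ‖y‖) (h : α ≤ β) {f : ℂ → ℂ}
    (hf : f =O[𝓟 D] (fun y => ‖y‖ ^ α)) : f =O[𝓟 D] (fun y => ‖y‖ ^ β) := by
  refine hf.trans (IsBigO.of_bound 1 ?_)
  filter_upwards [mem_principal_self D] with y hy
  rw [one_mul, Real.norm_of_nonneg (by positivity), Real.norm_of_nonneg (by positivity)]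
  exact Real.rpow_le_rpow_of_exponent_le (hD y hy) h

lemma GrowthOn.mul (hD : ∀ y ∈ D, 1 ≤ ‖y‖) (h : GrowthOn D α M) (h' : GrowthOn D β N) :
    GrowthOn D (α + β) (fun y => M y * N y) := by
  intro w hw
  simp only [mul_apply, ← sum_range_take_drop]
  refine IsBigO.fun_sum fun i _ => isBigO_rpow_mul hD ?_ ?_
  · exact h _ fun s hs => hw s (List.mem_of_mem_take hs)
  · exact h' _ fun s hs => hw s (List.mem_of_mem_drop hs)

lemma GrowthOn.add (h : GrowthOn D α M) (h' : GrowthOn D α N) :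
    GrowthOn D α (fun y => M y + N y) :=
  fun w hw => (h w hw).add (h' w hw)

lemma GrowthOn.mono (hD : ∀ y ∈ D, 1 ≤ ‖y‖) (hab : α ≤ β) (h : GrowthOn D α M) :
    GrowthOn D β M :=
  fun w hw => isBigO_rpow_mono hD hab (h w hw)

lemma isBigO_rpow_pow {f : ℂ → ℂ}
    (hf : f =O[𝓟 D] (fun y => ‖y‖ ^ α)) (n : ℕ) :
    (fun y => f y ^ n) =O[𝓟 D] (fun y => ‖y‖ ^ (n * α)) := by
  refine (hf.pow n).congr' EventuallyEq.rfl ?_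
  filter_upwards [mem_principal_self D] with y hy
  rw [mul_comm, Real.rpow_mul_natCast (by positivity)]

/-- If `f` grows slower than every positive power, then so does `expOne (f y)`. -/
lemma growthOn_expOne (hD : ∀ y ∈ D, 1 ≤ ‖y‖) {f : ℂ → ℂ}
    (hf : ∀ ε : ℝ, 0 < ε → f =O[𝓟 D] (fun y => ‖y‖ ^ ε)) {ε : ℝ} (hε : 0 < ε) :
    GrowthOn D ε (fun y => expOne (f y)) := by
  intro w _
  simp only [expOne_apply]
  split_ifs
  · have h := isBigO_rpow_pow (hf (ε / (w.length + 1)) (by positivity)) w.length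
    have h2 : (w.length : ℝ) * (ε / (w.length + 1)) ≤ ε := by
      rw [mul_div_assoc', div_le_iff₀ (by positivity)]; nlinarith
    simpa only [div_eq_mul_inv, mul_comm] using
      (isBigO_rpow_mono hD h2 h).const_mul_left ((w.length.factorial : ℂ)⁻¹)
  · exact isBigO_zero _ _

lemma isBigO_log (hD : ∀ y ∈ D, 1 ≤ ‖y‖) {ε : ℝ} (hε : 0 < ε) :
    (fun y => Complex.log y) =O[𝓟 D] (fun y => ‖y‖ ^ ε) := by
  refine IsBigO.of_bound (1 / ε + Real.pi) ?_
  filter_upwards [mem_principal_self D] with y hy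
  have h1 := hD y hy
  rw [Real.norm_of_nonneg (by positivity)]
  have h2 : ‖Complex.log y‖ ≤ |Real.log ‖y‖| + Real.pi := by
    refine (Complex.norm_le_abs_re_add_abs_im _).trans ?_
    rw [Complex.log_re, Complex.log_im]
    gcongr
    exact Complex.abs_arg_le_pi y
  rw [abs_of_nonneg (Real.log_nonneg h1)] at h2
  have h3 := Real.log_le_rpow_div (norm_nonneg y) hε
  have h4 : 1 ≤ ‖y‖ ^ ε := Real.one_le_rpow h1 hε.le
  calc ‖Complex.log y‖ ≤ ‖y‖ ^ ε / ε + Real.pi * 1 := by linarith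
    _ ≤ ‖y‖ ^ ε / ε + Real.pi * ‖y‖ ^ ε := by gcongr
    _ = (1 / ε + Real.pi) * ‖y‖ ^ ε := by ring

lemma isBigO_inv_pow {n m : ℕ} (hD : ∀ y ∈ D, 1 ≤ ‖y‖) (h : m ≤ n) :
    (fun y : ℂ => (y ^ n)⁻¹) =O[𝓟 D] (fun y => ‖y‖ ^ (-(m : ℝ))) := by
  refine IsBigO.of_bound 1 ?_
  filter_upwards [mem_principal_self D] with y hy
  have h1 := hD y hy
  rw [one_mul, norm_inv, norm_pow, Real.norm_of_nonneg (by positivity), ← Real.rpow_natCast,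
    ← Real.rpow_neg (by positivity)]
  exact Real.rpow_le_rpow_of_exponent_le h1 (by simpa using h)

end GrowthOn

end

end MouldAlg

/-! ### Convergence of the normalised products -/

namespace MouldAlg

noncomputable section

/-- The region on which the factors of the normalised product are estimated. -/
def farRight : Set ℂ := {y | 0 ≤ y.re ∧ 2 ≤ ‖y‖}

/-- The region on which the normalised products converge uniformly. -/
def baseRegion : Set ℂ := {x | -1 ≤ x.re ∧ 4 ≤ ‖x‖}

lemma one_le_norm_farRight : ∀ y ∈ farRight, 1 ≤ ‖y‖ := fun _ hy => by linarith [hy.2]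

/-- `log (y - 1) = log y + log (1 - 1 / y)` for the principal determinations. -/
lemma log_sub_one {y : ℂ} (hy : y ∈ farRight) :
    Complex.log (y - 1) = Complex.log y + Complex.log (1 + -y⁻¹) := by
  have hy0 : y ≠ 0 := by
    rintro rfl
    have := hy.2
    norm_num at this
  have hn : ‖y⁻¹‖ ≤ 1 / 2 := by
    rw [norm_inv]
    have := hy.2
    rw [inv_le_comm₀ (by linarith) (by norm_num)]
    linarith
  have hre : 0 < (1 + -y⁻¹).re := by
    have := (abs_le.1 ((Complex.abs_re_le_norm y⁻¹).trans hn)).2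
    simp only [Complex.add_re, Complex.one_re, Complex.neg_re]
    linarith
  have h1 : y - 1 = y * (1 + -y⁻¹) := by field_simp; ring
  rw [h1, Complex.log_mul hy0 (fun h => by rw [h] at hre; simp at hre)]
  have ha := abs_le.1 (Complex.abs_arg_le_pi_div_two_iff.2 hy.1)
  have hb := abs_lt.1 (Complex.abs_arg_lt_pi_div_two_iff.2 (Or.inl hre))
  exact ⟨by linarith [ha.1, hb.1], by linarith [ha.2, hb.2]⟩

lemma norm_log_one_sub_inv {y : ℂ} (hy : y ∈ farRight) :
    ‖Complex.log (1 + -y⁻¹) + y⁻¹‖ ≤ ‖y‖ ^ (-2 : ℝ) := by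
  have h2 := hy.2
  have hn : ‖y⁻¹‖ ≤ 1 / 2 := by
    rw [norm_inv, inv_le_comm₀ (by linarith) (by norm_num)]
    linarith
  have h := Complex.norm_log_one_add_sub_self_le (z := -y⁻¹) (by rw [norm_neg]; linarith)
  rw [sub_neg_eq_add, norm_neg] at h
  have h3 : (1 - ‖y⁻¹‖)⁻¹ ≤ 2 := by
    rw [inv_le_comm₀ (by linarith) (by norm_num)]; linarith
  refine h.trans ?_
  rw [Real.rpow_neg (by positivity), Real.rpow_two, ← inv_pow, ← norm_inv]
  have := sq_nonneg ‖y⁻¹‖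
  nlinarith

lemma isBigO_log_one_sub_inv :
    (fun y : ℂ => Complex.log (1 + -y⁻¹)) =O[𝓟 farRight] (fun y => ‖y‖ ^ (-1 : ℝ)) := by
  have h1 : (fun y : ℂ => Complex.log (1 + -y⁻¹) + y⁻¹) =O[𝓟 farRight]
      (fun y => ‖y‖ ^ (-1 : ℝ)) := by
    refine isBigO_rpow_mono one_le_norm_farRight (α := -2) (by norm_num) (IsBigO.of_bound 1 ?_)
    filter_upwards [mem_principal_self _] with y hy
    rw [one_mul, Real.norm_of_nonneg (by positivity)]
    exact norm_log_one_sub_inv hy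
  have h2 : (fun y : ℂ => (y ^ 1)⁻¹) =O[𝓟 farRight] (fun y => ‖y‖ ^ (-1 : ℝ)) := by
    simpa using isBigO_inv_pow (m := 1) one_le_norm_farRight le_rfl
  simpa using h1.sub h2

/-- The first-order part of `block y`. -/
def leading (y : ℂ) : PowerSeries ℂ := PowerSeries.C y⁻¹ * PowerSeries.X

/-- The deviation from `1` of the factors of the normalised product. -/
def defect (y : ℂ) : MouldAlg :=
  expOne (-Complex.log y) * block y * expOne (Complex.log (y - 1)) - 1

/-- As `leading y` commutes with the exponentials, the defect splits into a part coming from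
words of weight at least `2`, and a part that is a power series in one variable. -/
lemma defect_eq (y : ℂ) : defect y
    = expOne (-Complex.log y) * (block y - 1 - ones (leading y)) * expOne (Complex.log (y - 1))
      + ones ((1 + leading y)
        * PowerSeries.rescale (Complex.log (y - 1) - Complex.log y) (PowerSeries.exp ℂ) - 1) := by
  have h : ones ((1 + leading y)
        * PowerSeries.rescale (Complex.log (y - 1) - Complex.log y) (PowerSeries.exp ℂ))
      = expOne (-Complex.log y) * (1 + ones (leading y)) * expOne (Complex.log (y - 1)) := by
    rw [sub_eq_neg_add, ← PowerSeries.exp_mul_exp_eq_exp_add, expOne, expOne, ← map_one ones,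
      ← map_add, ← map_mul, ← map_mul]
    congr 1
    ring
  rw [map_sub, map_one, h, defect]
  noncomm_ring

/-- At `∅` and `(1)` the two terms cancel; all other words have weight at least `2`. -/
lemma growthOn_block_sub :
    GrowthOn farRight (-2) (fun y => block y - 1 - ones (leading y)) := by
  intro w hw
  have hval : ∀ y, (block y - 1 - ones (leading y)) w
      = 2 * ((1 / 2) ^ w.length * (y ^ w.sum)⁻¹) - (1 : MouldAlg) w - (1 : MouldAlg) w
        - if ∀ s ∈ w, s = 1 then PowerSeries.coeff w.length (leading y) else 0 := fun y => rfl
  have hbig : 2 ≤ w.sum → w ≠ [] → w ≠ [1] → (fun y => (block y - 1 - ones (leading y)) w)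
      =O[𝓟 farRight] (fun y => ‖y‖ ^ (-2 : ℝ)) := by
    intro h2 h0 h1
    have h3 : ∀ y, (if ∀ s ∈ w, s = 1 then PowerSeries.coeff w.length (leading y) else 0) = 0 := by
      intro y
      split_ifs with hone
      · have hlen : w.length ≠ 1 := by
          intro hl
          obtain ⟨s, rfl⟩ := List.length_eq_one_iff.1 hl
          exact h1 (by rw [hone s (by simp)])
        rw [leading, PowerSeries.coeff_C_mul, PowerSeries.coeff_X, if_neg hlen, mul_zero]
      · rfl
    simp only [hval, h3, one_apply, if_neg h0, sub_zero]
    have := (isBigO_inv_pow (m := 2) one_le_norm_farRight h2).const_mul_left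
      (2 * (1 / 2 : ℂ) ^ w.length)
    simpa [mul_assoc] using this
  match w, hw, hval, hbig with
  | [], _, hval, _ =>
    simp only [hval]
    refine (isBigO_zero _ _).congr_left fun y => ?_
    simp [leading]; norm_num
  | [s], hw, hval, hbig =>
    by_cases hs : s = 1
    · subst hs
      simp only [hval]
      refine (isBigO_zero _ _).congr_left fun y => ?_
      simp [leading]
    · have := hw s (by simp)
      exact hbig (by simp; omega) (by simp) (by simpa using hs)
  | s :: t :: u, hw, _, hbig =>
    have h1 := hw s (by simp)
    have h2 := hw t (by simp)
    exact hbig (by simp; omega) (by simp) (by simp)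

/-- In degree `1` the terms `log (1 - 1 / y)` and `1 / y` cancel up to order `y ^ (-2)`; this
cancellation is what the logarithmic corrections are made for. -/
lemma growthOn_ones_part : GrowthOn farRight (-2) (fun y => ones ((1 + leading y)
    * PowerSeries.rescale (Complex.log (y - 1) - Complex.log y) (PowerSeries.exp ℂ) - 1)) := by
  intro w _
  simp only [ones_apply]
  split_ifs
  swap
  · exact isBigO_zero _ _
  have hD := one_le_norm_farRight
  have hδ : (fun y : ℂ => Complex.log (y - 1) - Complex.log y) =O[𝓟 farRight]
      (fun y => ‖y‖ ^ (-1 : ℝ)) := by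
    refine isBigO_log_one_sub_inv.congr' ?_ EventuallyEq.rfl
    filter_upwards [mem_principal_self _] with y hy
    rw [log_sub_one hy]; ring
  have hcoeff : ∀ (n : ℕ) (y : ℂ), PowerSeries.coeff (n + 1) ((1 + leading y)
      * PowerSeries.rescale (Complex.log (y - 1) - Complex.log y) (PowerSeries.exp ℂ) - 1)
      = (Complex.log (y - 1) - Complex.log y) ^ (n + 1) * ((n + 1).factorial : ℂ)⁻¹
        + (y⁻¹ * (Complex.log (y - 1) - Complex.log y) ^ n) * (n.factorial : ℂ)⁻¹ := by
    intro n y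
    rw [add_mul, one_mul, leading, mul_assoc, map_sub, map_add, PowerSeries.coeff_C_mul,
      PowerSeries.coeff_succ_X_mul]
    simp [PowerSeries.coeff_rescale, PowerSeries.coeff_exp, PowerSeries.coeff_one, mul_assoc]
  rcases w.length with _ | _ | n
  · refine (isBigO_zero _ _).congr_left fun y => ?_
    have h : PowerSeries.constantCoeff (PowerSeries.rescale (Complex.log (y - 1) - Complex.log y)
        (PowerSeries.exp ℂ)) = 1 := by
      rw [← PowerSeries.coeff_zero_eq_constantCoeff_apply, PowerSeries.coeff_rescale]; simp
    simp [leading, h]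
  · simp only [hcoeff]
    refine IsBigO.of_bound 1 ?_
    filter_upwards [mem_principal_self _] with y hy
    rw [one_mul, Real.norm_of_nonneg (by positivity)]
    convert norm_log_one_sub_inv hy using 2
    rw [log_sub_one hy]
    simp
  · simp only [hcoeff]
    have hi : (fun y : ℂ => y⁻¹) =O[𝓟 farRight] (fun y => ‖y‖ ^ (-1 : ℝ)) := by
      simpa using isBigO_inv_pow (n := 1) (m := 1) hD le_rfl
    have h1 := isBigO_rpow_mono hD (β := -2) (by push_cast; linarith [n.cast_nonneg (α := ℝ)])
      (isBigO_rpow_pow hδ (n + 1 + 1))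
    have h2 := isBigO_rpow_mono hD (β := -2) (by push_cast; linarith [n.cast_nonneg (α := ℝ)])
      (isBigO_rpow_mul hD hi (isBigO_rpow_pow hδ (n + 1)))
    simp only [mul_comm _ ((_ : ℂ)⁻¹)]
    exact (h1.const_mul_left _).add (h2.const_mul_left _)

lemma growthOn_expOne_neg_log {D : Set ℂ} (hD : ∀ y ∈ D, 1 ≤ ‖y‖) {ε : ℝ} (hε : 0 < ε) :
    GrowthOn D ε (fun y => expOne (-Complex.log y)) :=
  growthOn_expOne hD (fun _ h => (isBigO_log hD h).neg_left) hε

/-- The two parts are `O (‖y‖ ^ (-2))`, up to arbitrarily small powers from the exponentials of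
logarithms; any exponent below `-1` would do. -/
lemma growthOn_defect : GrowthOn farRight (-(7 / 4)) defect := by
  have hD := one_le_norm_farRight
  have h1 : GrowthOn farRight (1 / 8) (fun y => expOne (Complex.log (y - 1))) := by
    refine growthOn_expOne hD (fun ε hε => ?_) (by norm_num)
    refine ((isBigO_log hD hε).add
      (isBigO_rpow_mono hD (by linarith) isBigO_log_one_sub_inv)).congr' ?_ EventuallyEq.rfl
    filter_upwards [mem_principal_self _] with y hy
    rw [log_sub_one hy]
  have h2 := ((growthOn_expOne_neg_log hD (ε := 1 / 8) (by norm_num)).mul hD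
    growthOn_block_sub).mul hD h1
  have h3 := (h2.mono hD (β := -(7 / 4)) (by norm_num)).add
    (growthOn_ones_part.mono hD (β := -(7 / 4)) (by norm_num))
  intro w hw
  simp only [defect_eq]
  exact h3 w hw

/-- The ordered product of the factors of the points `x + k, …, x + 1`. -/
def blockProd (x : ℂ) : ℕ → MouldAlg
  | 0 => 1
  | k + 1 => block (x + (k + 1 : ℕ)) * blockProd x k

lemma seeTrunc_add (N k : ℕ) (z : ℂ) :
    seeTrunc (N + k) z = blockProd (z + N) k * seeTrunc N z := by
  induction k with
  | zero => simp [blockProd]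
  | succ k ih =>
    rw [← add_assoc, seeTrunc_succ, ih, blockProd, mul_assoc]
    congr 2
    push_cast; ring

/-- The product of the factors of `x + k, …, x + 1`, normalised by the exponentials of the
logarithms of its end points. -/
def normProd (x : ℂ) (k : ℕ) : MouldAlg :=
  expOne (-Complex.log (x + k)) * blockProd x k * expOne (Complex.log x)

lemma normProd_zero (x : ℂ) : normProd x 0 = 1 := by
  rw [normProd, blockProd, mul_one]; simp

lemma normProd_succ (x : ℂ) (k : ℕ) :
    normProd x (k + 1) = normProd x k + defect (x + (k + 1 : ℕ)) * normProd x k := by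
  have h : x + ((k + 1 : ℕ) : ℂ) - 1 = x + k := by push_cast; ring
  rw [defect, h, sub_mul, one_mul, add_sub_cancel, normProd, normProd, blockProd]
  simp only [mul_assoc]
  rw [← mul_assoc (expOne (Complex.log (x + k))), expOne_mul_neg, one_mul]

lemma norm_add_nat_ge {x : ℂ} (hx : x ∈ baseRegion) {n : ℕ} (hn : 1 ≤ n) :
    ‖x‖ / 2 ≤ ‖x + n‖ ∧ (n : ℝ) / 2 ≤ ‖x + n‖ := by
  have h1 : ‖x + n‖ ^ 2 = ‖x‖ ^ 2 + 2 * n * x.re + n ^ 2 := by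
    rw [Complex.sq_norm, Complex.sq_norm, Complex.normSq_apply, Complex.normSq_apply]
    simp; ring
  have hn' : (1 : ℝ) ≤ n := by exact_mod_cast hn
  have hre := hx.1
  have hnorm := hx.2
  -- uses `2 n Re x ≥ -2 n` and `‖x‖ ^ 2 ≥ 16`
  have h3 : (‖x‖ ^ 2 + n ^ 2) / 4 ≤ ‖x + n‖ ^ 2 := by
    rw [h1]
    nlinarith [mul_le_mul_of_nonneg_left hre (show (0 : ℝ) ≤ 2 * n by linarith),
      sq_nonneg ((n : ℝ) - 4 / 3)]
  constructor
  · rw [← pow_le_pow_iff_left₀ (by positivity) (norm_nonneg _) two_ne_zero]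
    nlinarith [sq_nonneg (n : ℝ)]
  · rw [← pow_le_pow_iff_left₀ (by positivity) (norm_nonneg _) two_ne_zero]
    nlinarith [sq_nonneg ‖x‖]

lemma add_nat_mem_farRight {x : ℂ} (hx : x ∈ baseRegion) {n : ℕ} (hn : 1 ≤ n) :
    x + n ∈ farRight := by
  have h := (norm_add_nat_ge hx hn).1
  have hn' : (1 : ℝ) ≤ n := by exact_mod_cast hn
  refine ⟨?_, by linarith [hx.2]⟩
  simp only [Complex.add_re, Complex.natCast_re]
  linarith [hx.1]

/-- The summable majorant of the increments of the normalised product. -/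
def rate (k : ℕ) : ℝ := ((k + 1 : ℕ) : ℝ) ^ (-(3 / 2) : ℝ)

lemma summable_rate : Summable rate :=
  (summable_nat_add_iff 1).2 (Real.summable_nat_rpow.2 (by norm_num))

lemma rate_nonneg (k : ℕ) : 0 ≤ rate k := by unfold rate; positivity

lemma norm_defect_le {w : List ℕ} (hw : ∀ s ∈ w, 1 ≤ s) : ∃ C, 0 ≤ C ∧ ∀ x ∈ baseRegion, ∀ k : ℕ,
    ‖defect (x + (k + 1 : ℕ)) w‖ ≤ C * (‖x‖ ^ (-(1 / 4) : ℝ) * rate k) := by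
  obtain ⟨C, hC0, hC⟩ := (growthOn_defect w hw).exists_nonneg
  rw [isBigOWith_principal] at hC
  refine ⟨C * 4, by positivity, fun x hx k => ?_⟩
  have h := hC _ (add_nat_mem_farRight hx (Nat.le_add_left 1 k))
  refine h.trans ?_
  rw [mul_assoc]
  refine mul_le_mul_of_nonneg_left ?_ hC0
  rw [Real.norm_of_nonneg (by positivity)]
  obtain ⟨h1, h2⟩ := norm_add_nat_ge hx (Nat.le_add_left 1 k)
  have hx0 : 0 < ‖x‖ := by linarith [hx.2]
  have hk0 : (0 : ℝ) < ((k + 1 : ℕ) : ℝ) := by positivity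
  have hy0 : 0 < ‖x + ((k + 1 : ℕ) : ℂ)‖ := by linarith
  have e1 : ‖x + ((k + 1 : ℕ) : ℂ)‖ ^ (-(1 / 4) : ℝ) ≤ (‖x‖ / 2) ^ (-(1 / 4) : ℝ) :=
    Real.rpow_le_rpow_of_nonpos (by positivity) h1 (by norm_num)
  have e2 : ‖x + ((k + 1 : ℕ) : ℂ)‖ ^ (-(3 / 2) : ℝ) ≤ (((k + 1 : ℕ) : ℝ) / 2) ^ (-(3 / 2) : ℝ) :=
    Real.rpow_le_rpow_of_nonpos (by positivity) h2 (by norm_num)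
  have e3 : (1 / 2 : ℝ) ^ (-(7 / 4) : ℝ) ≤ 4 := by
    rw [one_div, Real.inv_rpow (by norm_num), ← Real.rpow_neg (by norm_num), neg_neg]
    calc (2 : ℝ) ^ (7 / 4 : ℝ) ≤ 2 ^ (2 : ℝ) :=
          Real.rpow_le_rpow_of_exponent_le (by norm_num) (by norm_num)
      _ = 4 := by norm_num
  have e4 : (‖x‖ / 2) ^ (-(1 / 4) : ℝ) * (((k + 1 : ℕ) : ℝ) / 2) ^ (-(3 / 2) : ℝ)
      = (1 / 2 : ℝ) ^ (-(7 / 4) : ℝ) * (‖x‖ ^ (-(1 / 4) : ℝ) * rate k) := by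
    rw [div_eq_mul_one_div, div_eq_mul_one_div ((k + 1 : ℕ) : ℝ),
      Real.mul_rpow hx0.le (by norm_num), Real.mul_rpow hk0.le (by norm_num), rate,
      show (-(7 / 4) : ℝ) = -(1 / 4) + -(3 / 2) by norm_num, Real.rpow_add (by norm_num)]
    ring
  rw [show (-(7 / 4) : ℝ) = -(1 / 4) + -(3 / 2) by norm_num, Real.rpow_add hy0]
  refine (mul_le_mul e1 e2 (by positivity) (by positivity)).trans ?_
  rw [e4]
  exact mul_le_mul_of_nonneg_right e3 (mul_nonneg (by positivity) (rate_nonneg k))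

lemma norm_splitSum_le {w : List ℕ} {φ : List ℕ → List ℕ → ℂ} {ψ : List ℕ → List ℕ → ℝ}
    (h : ∀ x y, x ++ y = w → ‖φ x y‖ ≤ ψ x y) : ‖splitSum w φ‖ ≤ splitSum w ψ := by
  rw [← sum_range_take_drop, ← sum_range_take_drop]
  exact norm_sum_le_of_le _ fun i _ => h _ _ (List.take_append_drop i w)

lemma rpow_neg_le_one {x : ℂ} (hx : x ∈ baseRegion) : ‖x‖ ^ (-(1 / 4) : ℝ) ≤ 1 :=
  Real.rpow_le_one_of_one_le_of_nonpos (by linarith [hx.2]) (by norm_num)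

/-- The increments of the normalised product, at a given word, are dominated by a summable
sequence, with a factor that vanishes at infinity. By induction on the length of the word, since
the defect vanishes at the empty word. -/
lemma norm_normProd_succ_sub_le (w : List ℕ) (hw : ∀ s ∈ w, 1 ≤ s) :
    ∃ C, 0 ≤ C ∧ ∀ x ∈ baseRegion, ∀ k : ℕ,
      ‖normProd x (k + 1) w - normProd x k w‖ ≤ C * (‖x‖ ^ (-(1 / 4) : ℝ) * rate k) := by
  induction hn : w.length using Nat.strong_induction_on generalizing w with
  | _ n ih =>
    -- by telescoping, the normalised product itself is bounded at shorter words
    have hbound : ∀ u : List ℕ, ∃ C, 0 ≤ C ∧ ((∀ s ∈ u, 1 ≤ s) → u.length < n →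
        ∀ x ∈ baseRegion, ∀ k, ‖normProd x k u‖ ≤ C) := by
      intro u
      by_cases hu : (∀ s ∈ u, 1 ≤ s) ∧ u.length < n
      swap
      · exact ⟨0, le_rfl, fun h1 h2 => absurd ⟨h1, h2⟩ hu⟩
      obtain ⟨C, hC0, hC⟩ := ih u.length hu.2 u hu.1 rfl
      refine ⟨‖(1 : MouldAlg) u‖ + C * ∑' k, rate k, ?_, fun _ _ x hx k => ?_⟩
      · exact add_nonneg (norm_nonneg _) (mul_nonneg hC0 (tsum_nonneg rate_nonneg))
      have h1 : normProd x k u = (1 : MouldAlg) u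
          + ∑ j ∈ Finset.range k, (normProd x (j + 1) u - normProd x j u) := by
        rw [Finset.sum_range_sub (fun j => normProd x j u), normProd_zero]; ring
      rw [h1]
      refine (norm_add_le _ _).trans (add_le_add le_rfl ?_)
      refine (norm_sum_le_of_le _ (fun j _ => hC x hx j)).trans ?_
      rw [← Finset.mul_sum]
      refine mul_le_mul_of_nonneg_left ?_ hC0
      calc ∑ j ∈ Finset.range k, ‖x‖ ^ (-(1 / 4) : ℝ) * rate j
          ≤ ∑ j ∈ Finset.range k, rate j := Finset.sum_le_sum fun j _ =>
            mul_le_of_le_one_left (rate_nonneg j) (rpow_neg_le_one hx)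
        _ ≤ ∑' k, rate k := summable_rate.sum_le_tsum _ fun j _ => rate_nonneg j
    choose Cb hCb0 hCb using hbound
    have hdef : ∀ u : List ℕ, ∃ C, 0 ≤ C ∧ ((∀ s ∈ u, 1 ≤ s) → ∀ x ∈ baseRegion, ∀ k : ℕ,
        ‖defect (x + (k + 1 : ℕ)) u‖ ≤ C * (‖x‖ ^ (-(1 / 4) : ℝ) * rate k)) := by
      intro u
      by_cases hu : ∀ s ∈ u, 1 ≤ s
      · obtain ⟨C, h0, h⟩ := norm_defect_le hu
        exact ⟨C, h0, fun _ => h⟩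
      · exact ⟨0, le_rfl, fun h => absurd h hu⟩
    choose Cd hCd0 hCd using hdef
    refine ⟨splitSum w (fun a b => Cd a * Cb b), ?_, fun x hx k => ?_⟩
    · rw [← sum_range_take_drop]
      exact Finset.sum_nonneg fun i _ => mul_nonneg (hCd0 _) (hCb0 _)
    have h1 : normProd x (k + 1) w - normProd x k w
        = (defect (x + (k + 1 : ℕ)) * normProd x k) w := by
      rw [normProd_succ, add_apply]; ring
    have h2 : splitSum w (fun a b => Cd a * Cb b) * (‖x‖ ^ (-(1 / 4) : ℝ) * rate k)
        = splitSum w (fun a b => Cd a * Cb b * (‖x‖ ^ (-(1 / 4) : ℝ) * rate k)) := by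
      rw [← sum_range_take_drop, ← sum_range_take_drop, Finset.sum_mul]
    have hpos : 0 ≤ ‖x‖ ^ (-(1 / 4) : ℝ) * rate k := mul_nonneg (by positivity) (rate_nonneg k)
    rw [h1, h2, mul_apply]
    refine norm_splitSum_le fun a b hab => ?_
    subst hab
    cases a with
    | nil =>
      have h0 : defect (x + (k + 1 : ℕ)) [] = 0 := by simp [defect, sub_apply]
      rw [h0, zero_mul, norm_zero]
      exact mul_nonneg (mul_nonneg (hCd0 _) (hCb0 _)) hpos
    | cons t a =>
      rw [norm_mul, mul_right_comm]
      refine mul_le_mul (hCd _ (fun s hs => hw s (List.mem_append_left _ hs)) x hx k)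
        (hCb b (fun s hs => hw s (List.mem_append_right _ hs)) ?_ x hx k) (norm_nonneg _)
        (mul_nonneg (hCd0 _) hpos)
      rw [← hn]; simp

/-- The infinite normalised product, as a telescoping series. -/
def normProdLim (x : ℂ) : MouldAlg := of fun w =>
  (1 : MouldAlg) w + ∑' k : ℕ, (normProd x (k + 1) w - normProd x k w)

@[simp] lemma normProd_nil (x : ℂ) (k : ℕ) : normProd x k [] = 1 := by
  induction k with
  | zero => rw [normProd_zero, one_nil]
  | succ k ih => rw [normProd_succ, add_apply, mul_nil, ih]; simp [defect, sub_apply]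

@[simp] lemma normProdLim_nil (x : ℂ) : normProdLim x [] = 1 := by
  simp [normProdLim]

lemma summable_normProd {x : ℂ} (hx : x ∈ baseRegion) {w : List ℕ} (hw : ∀ s ∈ w, 1 ≤ s) :
    Summable fun k : ℕ => (normProd x (k + 1) w - normProd x k w) := by
  obtain ⟨C, _, h⟩ := norm_normProd_succ_sub_le w hw
  exact Summable.of_norm_bounded ((summable_rate.mul_left _).mul_left C) (h x hx)

lemma mtendsto_normProd {x : ℂ} (hx : x ∈ baseRegion) :
    MTendsto atTop (normProd x) (normProdLim x) := by
  intro w hw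
  have h := (summable_normProd hx hw).hasSum.tendsto_sum_nat.const_add ((1 : MouldAlg) w)
  refine h.congr fun k => ?_
  rw [Finset.sum_range_sub (fun j => normProd x j w), normProd_zero]; ring

lemma norm_normProdLim_sub_one_le {w : List ℕ} (hw : ∀ s ∈ w, 1 ≤ s) :
    ∃ C, ∀ x ∈ baseRegion, ‖(normProdLim x - 1) w‖ ≤ C * ‖x‖ ^ (-(1 / 4) : ℝ) := by
  obtain ⟨C, _, h⟩ := norm_normProd_succ_sub_le w hw
  refine ⟨C * ∑' k, rate k, fun x hx => ?_⟩
  have h1 : (normProdLim x - 1) w = ∑' k : ℕ, (normProd x (k + 1) w - normProd x k w) := by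
    rw [sub_apply]; simp [normProdLim]
  rw [h1]
  refine (tsum_of_norm_bounded ((summable_rate.mul_left _).mul_left C).hasSum (h x hx)).trans
    (le_of_eq ?_)
  rw [tsum_mul_left, tsum_mul_left]; ring

lemma mdiffAt_blockProd {x : ℂ} (hx : ∀ n : ℕ, x + (n + 1 : ℕ) ≠ 0) (k : ℕ) :
    MDiffAt (fun x => blockProd x k) x := by
  induction k with
  | zero => exact mdiffAt_const 1
  | succ k ih =>
    exact (mdiffAt_block (differentiableAt_id.add_const _) (hx k)).mul ih

lemma mem_slitPlane_of_mem_baseRegion {x : ℂ} (hx : x ∈ baseRegion) (n : ℕ) :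
    x + n ∈ Complex.slitPlane := by
  rw [Complex.mem_slitPlane_iff]
  by_contra h
  push Not at h
  have h1 := hx.1
  have him : x.im = 0 := by simpa using h.2
  have hre : x.re + n ≤ 0 := by simpa using h.1
  have h2 : ‖x‖ = |x.re| := by
    rw [Complex.norm_def, Complex.normSq_apply, him, ← Real.sqrt_mul_self_eq_abs]; simp
  have h3 := hx.2
  rw [h2] at h3
  have hn : (0 : ℝ) ≤ n := n.cast_nonneg
  rcases le_abs.1 h3 with h4 | h4 <;> linarith

lemma mdiffAt_normProdLim {x : ℂ} (h1 : -1 < x.re) (h2 : 4 < ‖x‖) :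
    MDiffAt normProdLim x := by
  intro w hw
  set U : Set ℂ := {x : ℂ | -1 < x.re} ∩ {x | 4 < ‖x‖}
  have hU : IsOpen U :=
    (isOpen_lt continuous_const Complex.continuous_re).inter
      (isOpen_lt continuous_const continuous_norm)
  have hUB : ∀ x ∈ U, x ∈ baseRegion := fun x hx => ⟨le_of_lt hx.1, le_of_lt hx.2⟩
  obtain ⟨C, hC0, h⟩ := norm_normProd_succ_sub_le w hw
  have hd : ∀ k : ℕ, DifferentiableOn ℂ (fun x => normProd x k w) U := by
    intro k y hy
    have hs := mem_slitPlane_of_mem_baseRegion (hUB y hy)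
    have hk : MDiffAt (fun x => normProd x k) y := by
      refine ((mdiffAt_expOne ?_).mul (mdiffAt_blockProd (fun n => ?_) k)).mul (mdiffAt_expOne ?_)
      · exact ((differentiableAt_id.add_const _).clog (hs k)).neg
      · exact Complex.slitPlane_ne_zero (hs (n + 1))
      · exact differentiableAt_id.clog (by simpa using hs 0)
    exact (hk w hw).differentiableWithinAt
  have ht := Complex.differentiableOn_tsum_of_summable_norm (summable_rate.mul_left C)
    (fun k => (hd (k + 1)).sub (hd k)) hU (fun k x hx => by
      refine (h x (hUB x hx) k).trans (mul_le_mul_of_nonneg_left ?_ hC0)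
      exact mul_le_of_le_one_left (rate_nonneg k) (rpow_neg_le_one (hUB x hx)))
  exact ((ht x ⟨h1, h2⟩).differentiableAt (hU.mem_nhds ⟨h1, h2⟩)).const_add _

end

end MouldAlg

/-! ### The limit moulds -/

namespace MouldAlg

noncomputable section

lemma mtendsto_expOne {ι : Type*} {l : Filter ι} {f : ι → ℂ} {a : ℂ} (h : Tendsto f l (𝓝 a)) :
    MTendsto l (fun i => expOne (f i)) (expOne a) := by
  intro w _
  simp only [expOne_apply]
  split_ifs
  · exact (h.pow _).div_const _
  · exact tendsto_const_nhds

lemma PosEq.mtendsto {A B : MouldAlg} (h : PosEq A B) :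
    MTendsto (atTop : Filter ℕ) (fun _ => A) B :=
  (mtendsto_const A).congr_right h

lemma PosEq.nil {A B : MouldAlg} (h : PosEq A B) : A [] = B [] := h [] (by simp)

lemma PosEq.inv {A B : MouldAlg} (h : PosEq A B) (hA : A [] = 1) : PosEq (inv A) (inv B) :=
  (mtendsto_const _).posEq (h.mtendsto.inv (fun _ => hA) (h.nil ▸ hA))

lemma PosEq.log {A B : MouldAlg} (h : PosEq A B) (hA : A [] = 1) : PosEq (log A) (log B) :=
  (mtendsto_const _).posEq (h.mtendsto.log (fun _ => hA) (h.nil ▸ hA))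

lemma PosEq.parity {A B : MouldAlg} (h : PosEq A B) : PosEq (parity A) (parity B) :=
  fun w hw => by rw [parity_apply, parity_apply, h w hw]

lemma MDiffAt.congr {M N : ℂ → MouldAlg} {z : ℂ} (h : MDiffAt M z)
    (h' : ∀ᶠ x in 𝓝 z, PosEq (N x) (M x)) : MDiffAt N z :=
  fun w hw => (h w hw).congr_of_eventuallyEq (h'.mono fun _ hx => hx w hw)

lemma MDiffAt.comp_apply {M : ℂ → MouldAlg} {g : ℂ → ℂ} {z : ℂ} (h : MDiffAt M (g z))
    (hg : DifferentiableAt ℂ g z) : MDiffAt (fun x => M (g x)) z :=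
  fun w hw => DifferentiableAt.comp z (h w hw) hg

lemma tendsto_log_add_sub_log (z : ℂ) :
    Tendsto (fun m : ℕ => Complex.log (z + m) - (Real.log m : ℂ)) atTop (𝓝 0) := by
  have h1 : Tendsto (fun m : ℕ => 1 + z * ((m : ℂ))⁻¹) atTop (𝓝 1) := by
    simpa using (tendsto_inv_atTop_nhds_zero_nat (𝕜 := ℂ)).const_mul z |>.const_add 1
  have h2 : Tendsto (fun m : ℕ => Complex.log (1 + z * ((m : ℂ))⁻¹)) atTop (𝓝 0) := by
    simpa using h1.clog (by simp)
  refine h2.congr' ?_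
  filter_upwards [h1.eventually_ne one_ne_zero, eventually_gt_atTop 0] with m hm hm0
  have hm' : (m : ℂ) ≠ 0 := by exact_mod_cast hm0.ne'
  have h3 : z + m = ((m : ℝ) : ℂ) * (1 + z * ((m : ℂ))⁻¹) := by
    rw [Complex.ofReal_natCast]; field_simp; ring
  rw [h3, Complex.log_ofReal_mul (by exact_mod_cast hm0) hm]
  ring

/-- The limit of the truncated and corrected `See₊`, expressed by the normalised product at the
point `z + N`. -/
def seeLim (c : ℂ) (N : ℕ) (z : ℂ) : MouldAlg :=
  expOne (-c) * normProdLim (z + N) * expOne (-Complex.log (z + N)) * seeTrunc N z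

/-- `log (z + k) - log k → 0`, so the correction may be expressed by `log (z + k)`, which is the one
that the normalised product contains. -/
lemma mtendsto_seeCor {c z : ℂ} {N : ℕ} (hz : z + N ∈ baseRegion) :
    MTendsto atTop (fun k => seeCor c k z) (seeLim c N z) := by
  have h1 : ∀ k : ℕ, seeCor c (N + k) z
      = expOne (-c) * (expOne (Complex.log (z + (N + k : ℕ)) - (Real.log (N + k : ℕ) : ℂ))
        * normProd (z + N) k) * expOne (-Complex.log (z + N)) * seeTrunc N z := by
    intro k
    have e1 : -c - (Real.log (N + k : ℕ) : ℂ) = -c + ((Complex.log (z + (N + k : ℕ))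
        - (Real.log (N + k : ℕ) : ℂ)) + -Complex.log (z + N + k)) := by
      rw [show z + ((N + k : ℕ) : ℂ) = z + N + k by push_cast; ring]; ring
    rw [seeCor, seeTrunc_add, e1, expOne_add, expOne_add, normProd]
    simp only [mul_assoc]
    rw [← mul_assoc (expOne (Complex.log (z + N))), expOne_mul_neg, one_mul]
  have h2 : Tendsto (fun k : ℕ => Complex.log (z + (N + k : ℕ)) - (Real.log (N + k : ℕ) : ℂ))
      atTop (𝓝 0) :=
    (tendsto_log_add_sub_log z).comp (tendsto_add_atTop_nat N |>.congr fun k => add_comm k N)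
  have h3 := (((mtendsto_const (expOne (-c))).mul ((mtendsto_expOne h2).mul
    (mtendsto_normProd hz))).mul (mtendsto_const (expOne (-Complex.log (z + N))))).mul
    (mtendsto_const (seeTrunc N z))
  intro w hw
  rw [← tendsto_add_atTop_iff_nat N]
  simp only [add_comm _ N, h1]
  simpa [seeLim] using h3 w hw

lemma add_nat_mem_baseRegion {z : ℂ} {N : ℕ} (h : ‖z‖ + 4 < N) :
    -1 < (z + N).re ∧ 4 < ‖z + N‖ := by
  have h1 := (abs_le.1 (Complex.abs_re_le_norm z)).1
  have h2 : 4 < (z + N).re := by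
    simp only [Complex.add_re, Complex.natCast_re]; linarith
  exact ⟨by linarith, h2.trans_le (Complex.re_le_norm _)⟩

/-- The limit defining `See₊` exists. This holds for every `z`, integers included, because of the
convention `0⁻¹ = 0`. -/
lemma mtendsto_seePlus (c z : ℂ) :
    MTendsto atTop (fun k => seeCor c k z) (of (SeePlus c z)) := by
  obtain ⟨N, hN⟩ := exists_nat_gt (‖z‖ + 4)
  have hz := add_nat_mem_baseRegion hN
  have h := mtendsto_seeCor (c := c) (z := z) (N := N) ⟨hz.1.le, hz.2.le⟩
  refine h.congr_right fun w hw => ((h w hw).limUnder_eq).symm.trans ?_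
  simp only [← of_seePlus_trunc]
  rfl

lemma mtendsto_seeMinus (c z : ℂ) :
    MTendsto atTop (fun k => parity (seeCor c k (-z))) (of (SeeMinus c z)) := by
  have h := (mtendsto_seePlus c (-z)).parity
  refine h.congr_right fun w hw => ((h w hw).limUnder_eq).symm.trans ?_
  simp only [← of_seeMinus_trunc]
  rfl

lemma posEq_seePlus {c z : ℂ} {N : ℕ} (hz : z + N ∈ baseRegion) :
    PosEq (of (SeePlus c z)) (seeLim c N z) :=
  (mtendsto_seePlus c z).posEq (mtendsto_seeCor hz)

lemma posEq_seeMinus (c z : ℂ) : PosEq (of (SeeMinus c z)) (parity (of (SeePlus c (-z)))) :=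
  (mtendsto_seeMinus c z).posEq (mtendsto_seePlus c (-z)).parity

@[simp] lemma seePlus_nil (c z : ℂ) : SeePlus c z [] = 1 :=
  (mtendsto_seePlus c z).nil_eq_one (by simp)

@[simp] lemma seeMinus_nil (c z : ℂ) : SeeMinus c z [] = 1 :=
  (mtendsto_seeMinus c z).nil_eq_one (by simp [parity_nil])

lemma of_tee (c z : ℂ) : of (Tee c z) = of (SeePlus c z) * inv (of (SeeMinus c z)) := rfl

lemma of_teen (c z : ℂ) : of (Teen c z) = log (of (Tee c z)) := rfl

@[simp] lemma tee_nil (c z : ℂ) : Tee c z [] = 1 := by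
  have h : of (Tee c z) [] = 1 := by
    rw [of_tee, mul_nil, inv_nil (seeMinus_nil c z)]; simp
  exact h

lemma mtendsto_tee (c z : ℂ) : MTendsto atTop (fun k => teeCor c k z) (of (Tee c z)) := by
  rw [of_tee]
  exact (mtendsto_seePlus c z).mul
    ((mtendsto_seeMinus c z).inv (fun k => by simp [parity_nil]) (seeMinus_nil c z))

lemma mtendsto_teTrunc (c z : ℂ) :
    MTendsto atTop (fun k => of (TeTrunc c k z)) (of (Te c z)) := by
  have h : MTendsto atTop (fun k => of (TeTrunc c k z))
      (comp (of (Tee c z)) (len (moebius (-(1 / 2))))) :=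
    ((mtendsto_tee c z).comp _).congr_left fun k => (posEq_teTrunc c k z).symm
  exact h.congr_right fun w hw => ((h w hw).limUnder_eq).symm

lemma posEq_te (c z : ℂ) :
    PosEq (of (Te c z)) (comp (of (Tee c z)) (len (moebius (-(1 / 2))))) :=
  (mtendsto_teTrunc c z).posEq
    (((mtendsto_tee c z).comp _).congr_left fun k => (posEq_teTrunc c k z).symm)

/-- Passage to the limit in the truncated identity; the composition with `X / (1 + X / 2)` cancels
against the factor `X / (1 - X / 2)` of `e ^ t - 1`, and `K` remains. -/
lemma posEq_tan (c z : ℂ) : PosEq (of (Tan c z)) (comp (of (Teen c z)) (of KMould)) := by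
  have h1 : of (Tan c z) = log (comp (of (Te c z)) (of expSubOneMould)) := rfl
  have h2 : comp (comp (of (Tee c z)) (len (moebius (-(1 / 2))))) (of expSubOneMould)
      = comp (of (Tee c z)) (of KMould) := by
    have h3 := moebius_comp_moebius (-(1 / 2))
    rw [neg_neg] at h3
    rw [← moebius_comp_KMould, comp_assoc, ← comp_assoc _ _ (of KMould), h3, comp_len_X]
    exact coeff_twoTanhHalf_of_even (by simp)
  have h4 := (posEq_te c z).comp (of expSubOneMould)
  rw [h2] at h4
  rw [h1, of_teen, ← log_comp (tee_nil c z)]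
  exact h4.log (by rw [h4.nil, comp_nil]; exact tee_nil c z)

/-! ### Parity and periodicity -/

lemma posEq_tee (c z : ℂ) : PosEq (of (Tee c z))
    (of (SeePlus c z) * inv (parity (of (SeePlus c (-z))))) := by
  rw [of_tee]
  exact (PosEq.refl _).mul ((posEq_seeMinus c z).inv (seeMinus_nil c z))

/-- Reflection replaces `Tee` by its inverse up to parity, hence its logarithm by the opposite. -/
lemma posEq_teen_neg (c z : ℂ) : PosEq (of (Teen c (-z))) (-parity (of (Teen c z))) := by
  have hP : ∀ x, (of (SeePlus c x)) [] = 1 := seePlus_nil c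
  have hP' : ∀ x, (parity (of (SeePlus c x))) [] = 1 := fun x => by rw [parity_nil, hP]
  have hT : (of (Tee c z)) [] = 1 := tee_nil c z
  have h1 := posEq_tee c (-z)
  rw [neg_neg] at h1
  have h2 := ((posEq_tee c z).inv hT).parity
  rw [inv_mul_rev (hP z) (inv_nil (hP' _)), inv_inv (hP' _), map_mul, parity_parity,
    ← inv_parity (hP z)] at h2
  have h3 := (h1.trans h2.symm).log (tee_nil c (-z))
  rwa [log_parity (inv_nil hT), log_inv hT, map_neg, ← of_teen, ← of_teen] at h3

lemma posEq_tan_neg (c z : ℂ) : PosEq (of (Tan c (-z))) (-parity (of (Tan c z))) := by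
  have h1 := (posEq_tan c (-z)).trans ((posEq_teen_neg c z).comp (of KMould))
  rw [← compHom_apply, map_neg, compHom_apply, parity_comp_KMould] at h1
  refine h1.trans fun w hw => ?_
  rw [neg_apply, neg_apply, (posEq_tan c z).parity w hw]

/-- The difference equation of `See₊`. -/
lemma posEq_seePlus_add_one (c z : ℂ) :
    PosEq (of (SeePlus c z) * (1 - (1 / 2 : ℂ) • mono z))
      (of (SeePlus c (z + 1)) * (1 + (1 / 2 : ℂ) • mono (z + 1))) := by
  have h1 : MTendsto atTop (fun k => seeCor c (k + 1) z * (1 - (1 / 2 : ℂ) • mono z))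
      (of (SeePlus c z) * (1 - (1 / 2 : ℂ) • mono z)) :=
    MTendsto.mul (fun w hw => (mtendsto_seePlus c z w hw).comp (tendsto_add_atTop_nat 1))
      (mtendsto_const _)
  have h2 : ∀ k : ℕ, seeCor c (k + 1) z * (1 - (1 / 2 : ℂ) • mono z)
      = expOne (-((Real.log (k + 1 : ℕ) : ℂ) - Real.log k))
        * (seeCor c k (z + 1) * (1 + (1 / 2 : ℂ) • mono (z + 1))) := by
    intro k
    rw [seeCor, seeCor, mul_assoc, seeTrunc_succ_mul, ← mul_assoc, ← mul_assoc, ← mul_assoc,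
      ← expOne_add]
    congr 3
    ring
  have h3 : Tendsto (fun k : ℕ => -((Real.log (k + 1 : ℕ) : ℂ) - Real.log k)) atTop (𝓝 (-0)) := by
    refine ((tendsto_log_add_sub_log 1).congr fun k => ?_).neg
    have : (1 : ℂ) + k = ((k + 1 : ℕ) : ℝ) := by push_cast; ring
    rw [this, ← Complex.ofReal_log (by positivity)]
  have h4 := (mtendsto_expOne h3).mul ((mtendsto_seePlus c (z + 1)).mul
    (mtendsto_const (1 + (1 / 2 : ℂ) • mono (z + 1))))
  simp only [h2] at h1
  simpa using h1.posEq h4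

lemma posEq_seeMinus_add_one (c z : ℂ) :
    PosEq (of (SeeMinus c (z + 1)) * (1 + (1 / 2 : ℂ) • mono (z + 1)))
      (of (SeeMinus c z) * (1 - (1 / 2 : ℂ) • mono z)) := by
  have h := (posEq_seePlus_add_one c (-(z + 1))).parity
  rw [show -(z + 1) + 1 = -z by ring] at h
  simp only [map_mul, map_sub, map_add, map_one, parity_smul, parity_mono, smul_neg,
    sub_neg_eq_add, ← sub_eq_add_neg] at h
  exact (((posEq_seeMinus c (z + 1)).mul (PosEq.refl _)).trans h).trans
    ((posEq_seeMinus c z).symm.mul (PosEq.refl _))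

/-- `Tee` is periodic, since `See₊` and `See₋` satisfy the same difference equation. -/
lemma posEq_tee_add_one (c z : ℂ) : PosEq (of (Tee c (z + 1))) (of (Tee c z)) := by
  have key : ∀ A B p : MouldAlg, A [] = 1 → B [] = 1 → p [] = 1 →
      (A * p) * inv (B * p) = A * inv B := by
    intro A B p _ hB hp
    rw [inv_mul_rev hB hp, mul_assoc, ← mul_assoc p, mul_inv hp, one_mul]
  have hp : (1 - (1 / 2 : ℂ) • mono z) [] = 1 := by simp [sub_apply, smul_apply]
  have hq : (1 + (1 / 2 : ℂ) • mono (z + 1)) [] = 1 := by simp [add_apply, smul_apply]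
  have hP : ∀ x, (of (SeePlus c x)) [] = 1 := seePlus_nil c
  have hM : ∀ x, (of (SeeMinus c x)) [] = 1 := seeMinus_nil c
  rw [of_tee, of_tee, ← key _ _ _ (hP (z + 1)) (hM (z + 1)) hq,
    ← key _ _ _ (hP z) (hM z) hp]
  exact (posEq_seePlus_add_one c z).symm.mul
    ((posEq_seeMinus_add_one c z).inv (by rw [mul_nil, hM, hq, one_mul]))

lemma teen_periodic (c : ℂ) {w : List ℕ} (hw : ∀ s ∈ w, 1 ≤ s) :
    Function.Periodic (fun z => Teen c z w) 1 :=
  fun z => (posEq_tee_add_one c z).log (tee_nil c _) w hw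

/-! ### Holomorphy -/

lemma mdiffAt_seePlus {c z : ℂ} (hz : ∀ n : ℕ, z + n ≠ 0) :
    MDiffAt (fun x => of (SeePlus c x)) z := by
  obtain ⟨N, hN⟩ := exists_nat_gt (‖z‖ + 5)
  have hball : ∀ x ∈ Metric.ball z 1, -1 < (x + N).re ∧ 4 < ‖x + N‖ := by
    intro x hx
    apply add_nat_mem_baseRegion
    have h1 : ‖x - z‖ < 1 := by simpa [dist_eq_norm] using hx
    have := norm_sub_norm_le x z
    linarith
  have hz' := hball z (Metric.mem_ball_self one_pos)
  have hT : MDiffAt (fun x => seeTrunc N x) z := by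
    have h : ∀ x, seeTrunc N x = blockProd x N * halfBlock x := by
      intro x
      have := seeTrunc_add 0 N x
      rwa [zero_add, seeTrunc_zero, Nat.cast_zero, add_zero] at this
    simp only [h]
    exact (mdiffAt_blockProd (fun n => hz (n + 1)) N).mul
      (mdiffAt_halfBlock differentiableAt_id (by simpa using hz 0))
  have hlog : DifferentiableAt ℂ (fun x : ℂ => -Complex.log (x + N)) z := by
    refine ((differentiableAt_id.add_const _).clog ?_).neg
    simpa using mem_slitPlane_of_mem_baseRegion ⟨hz'.1.le, hz'.2.le⟩ 0
  have hL : MDiffAt (seeLim c N) z :=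
    (((mdiffAt_const _).mul ((mdiffAt_normProdLim hz'.1 hz'.2).comp_apply
      (g := fun x => x + N) (differentiableAt_id.add_const _))).mul (mdiffAt_expOne hlog)).mul hT
  refine hL.congr ?_
  filter_upwards [Metric.ball_mem_nhds z one_pos] with x hx
  exact posEq_seePlus ⟨(hball x hx).1.le, (hball x hx).2.le⟩

lemma mdiffAt_teen {c z : ℂ} (hz : ∀ n : ℤ, z ≠ n) : MDiffAt (fun x => of (Teen c x)) z := by
  have h1 : MDiffAt (fun x => of (SeePlus c x)) z := by
    refine mdiffAt_seePlus fun n h => hz (-n) ?_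
    push_cast; linear_combination h
  have h2 : MDiffAt (fun x => of (SeePlus c x)) (-z) := by
    refine mdiffAt_seePlus fun n h => hz n ?_
    push_cast; linear_combination -h
  have h3 : MDiffAt (fun x => of (SeeMinus c x)) z :=
    ((h2.comp_apply (g := fun x => -x) differentiableAt_id.neg).parity).congr
      (Eventually.of_forall fun x => posEq_seeMinus c x)
  exact (h1.mul (h3.inv (seeMinus_nil c))).log (tee_nil c)

end

end MouldAlg

/-! ### Behaviour at `i ∞` -/

namespace MouldAlg

noncomputable section

/-- The ends `Im z → +∞` of the strip `0 ≤ Re z ≤ 1`. -/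
def stripTop : Filter ℂ := comap Complex.im atTop ⊓ 𝓟 {z | 0 ≤ z.re ∧ z.re ≤ 1}

lemma tendsto_norm_stripTop : Tendsto (fun z : ℂ => ‖z‖) stripTop atTop := by
  refine tendsto_atTop_mono (f := fun z : ℂ => z.im) (fun z => ?_)
    (tendsto_comap.mono_left inf_le_left)
  exact (le_abs_self _).trans (Complex.abs_im_le_norm z)

lemma eventually_stripTop : ∀ᶠ z in stripTop, z ∈ baseRegion ∧ -z ∈ baseRegion ∧ 0 < z.im := by
  have h1 : ∀ᶠ z in stripTop, 4 ≤ z.im :=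
    (tendsto_comap.mono_left inf_le_left).eventually_ge_atTop 4
  have h2 : ∀ᶠ z in stripTop, 0 ≤ z.re ∧ z.re ≤ 1 := mem_inf_of_right (mem_principal_self _)
  filter_upwards [h1, h2] with z h1 h2
  have h3 : 4 ≤ ‖z‖ := h1.trans ((le_abs_self _).trans (Complex.abs_im_le_norm z))
  refine ⟨⟨by linarith [h2.1], h3⟩, ⟨?_, by rwa [norm_neg]⟩, by linarith⟩
  rw [Complex.neg_re]; linarith [h2.2]

lemma GrowthOn.mtendsto_zero {D : Set ℂ} {α : ℝ} {M : ℂ → MouldAlg} (h : GrowthOn D α M)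
    (hα : α < 0) {ι : Type*} {l : Filter ι} {f : ι → ℂ} (hD : ∀ᶠ i in l, f i ∈ D)
    (hf : Tendsto (fun i => ‖f i‖) l atTop) : MTendsto l (fun i => M (f i)) 0 := by
  intro w hw
  have h1 := (h w hw).comp_tendsto (tendsto_principal.2 hD)
  refine h1.trans_tendsto ?_
  have := (tendsto_rpow_neg_atTop (neg_pos.2 hα)).comp hf
  simp only [neg_neg] at this
  exact this

lemma growthOn_normProdLim :
    GrowthOn baseRegion (-(1 / 4)) (fun x => normProdLim x - 1) := by
  intro w hw
  obtain ⟨C, hC⟩ := norm_normProdLim_sub_one_le hw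
  refine IsBigO.of_bound C ?_
  filter_upwards [mem_principal_self _] with x hx
  rw [Real.norm_of_nonneg (by positivity)]
  exact hC x hx

lemma mtendsto_normProdLim {ι : Type*} {l : Filter ι} {f : ι → ℂ}
    (hD : ∀ᶠ i in l, f i ∈ baseRegion) (hf : Tendsto (fun i => ‖f i‖) l atTop) :
    MTendsto l (fun i => normProdLim (f i)) 1 := by
  simpa using (growthOn_normProdLim.mtendsto_zero (by norm_num) hD hf).add (mtendsto_const 1)

lemma growthOn_halfBlock {D : Set ℂ} (hD : ∀ y ∈ D, 1 ≤ ‖y‖) :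
    GrowthOn D (-1) (fun y => halfBlock y - 1) := by
  intro w hw
  cases w with
  | nil => exact (isBigO_zero _ _).congr_left fun y => by simp [sub_apply]
  | cons s u =>
    have h1 : 1 ≤ (s :: u).sum := by
      have := hw s (by simp)
      rw [List.sum_cons]; omega
    have h2 := (isBigO_inv_pow (m := 1) hD h1).const_mul_left ((1 / 2 : ℂ) ^ (s :: u).length)
    refine (h2.congr_left fun y => ?_).congr_right fun y => by simp
    rw [sub_apply, one_cons, sub_zero]
    rfl

/-- As `Im z → +∞`, the corrective factors of the two ends of the ordered product that defines
`Tee` combine into `exp ((log (-z) - log z) J) = exp (-π i J)`, and all other contributions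
vanish. -/
lemma mtendsto_tee_stripTop (c : ℂ) :
    MTendsto stripTop (fun z => of (Tee c z)) (expOne (-(Real.pi * Complex.I))) := by
  set D : Set ℂ := {z | 1 ≤ ‖z‖}
  have hD : ∀ y ∈ D, 1 ≤ ‖y‖ := fun y hy => hy
  have hevD : ∀ᶠ z in stripTop, z ∈ D :=
    tendsto_norm_stripTop.eventually_ge_atTop 1
  have hev := eventually_stripTop
  have hW := mtendsto_normProdLim (f := fun z => z) (hev.mono fun z h => h.1) tendsto_norm_stripTop
  have hW' := (mtendsto_normProdLim (f := fun z => -z) (hev.mono fun z h => h.2.1)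
    (by simpa using tendsto_norm_stripTop)).parity.inv (fun z => by simp [parity_nil])
    (by simp)
  have hlog : GrowthOn D (1 / 4) (fun y => expOne (Complex.log (-y))) := by
    refine growthOn_expOne hD (fun ε hε => ?_) (by norm_num)
    have h := (isBigO_log hD hε).comp_tendsto (k := fun z => -z) (l' := 𝓟 D)
      (tendsto_principal_principal.2 fun z hz => by
        have : 1 ≤ ‖z‖ := hz
        change 1 ≤ ‖-z‖
        rwa [norm_neg])
    refine h.congr_right fun y => by simp
  have hmid := (((growthOn_expOne_neg_log hD (ε := 1 / 4) (by norm_num)).mul hD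
    (growthOn_halfBlock hD)).mul hD hlog).mtendsto_zero (by norm_num) hevD tendsto_norm_stripTop
  have hmid2 : MTendsto stripTop
      (fun z => expOne (-Complex.log z) * block z * expOne (Complex.log (-z)))
      (expOne (-(Real.pi * Complex.I))) := by
    have h : MTendsto stripTop (fun z => expOne (Complex.log (-z) - Complex.log z))
        (expOne (-(Real.pi * Complex.I))) := by
      refine mtendsto_expOne (tendsto_const_nhds.congr' ?_)
      filter_upwards [hev] with z hz
      rw [Complex.log, Complex.log, norm_neg, Complex.arg_neg_eq_arg_sub_pi_of_im_pos hz.2.2]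
      push_cast; ring
    have h2 := ((hmid.add hmid).add h)
    rw [add_zero, zero_add] at h2
    intro w hw
    refine (h2 w hw).congr fun z => ?_
    congr 1
    beta_reduce
    have e : Complex.log (-z) - Complex.log z = -Complex.log z + Complex.log (-z) := by ring
    rw [e, expOne_add, block, two_smul]
    noncomm_ring
  have htot := ((((mtendsto_const (l := stripTop) (expOne (-c))).mul hW).mul hmid2).mul
    hW').mul (mtendsto_const (expOne c))
  have hlim : expOne (-c) * 1 * expOne (-(Real.pi * Complex.I)) * inv (parity 1) * expOne c
      = expOne (-(Real.pi * Complex.I)) := by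
    have : inv (parity 1) = 1 := by
      rw [map_one]; exact inv_eq_of_mul_eq_one one_nil (one_mul 1)
    rw [this, mul_one, mul_one, ← expOne_add, ← expOne_add]
    congr 1; ring
  rw [hlim] at htot
  intro w hw
  refine (htot w hw).congr' ?_
  filter_upwards [hev] with z hz
  have h1 := posEq_seePlus (c := c) (z := z) (N := 0) (by simpa using hz.1)
  have h2 := posEq_seePlus (c := c) (z := -z) (N := 0) (by simpa using hz.2.1)
  rw [seeLim, seeTrunc_zero, Nat.cast_zero, add_zero] at h1 h2
  have h3 := (posEq_tee c z).trans (h1.mul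
    (h2.parity.inv (by rw [parity_nil]; exact seePlus_nil c _)))
  refine Eq.trans ?_ (h3 w hw).symm
  congr 1
  have h' := congrArg parity (halfBlock_mul (-z))
  simp only [map_mul, map_sub, map_one, parity_smul, parity_mono, smul_neg,
    sub_neg_eq_add] at h'
  have h4 : ∀ x : ℂ, parity (halfBlock x) [] = 1 := fun x => by rw [parity_nil, halfBlock_nil]
  have h5 : parity (normProdLim (-z)) [] = 1 := by rw [parity_nil, normProdLim_nil]
  rw [map_mul, map_mul, map_mul, parity_expOne, parity_expOne,
    inv_mul_rev (by simp [h5]) (h4 _), inv_mul_rev (by simp [h5]) (by simp),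
    inv_mul_rev (by simp) h5, inv_expOne, inv_expOne, inv_eq_of_mul_eq_one (h4 _) h', neg_neg,
    neg_neg, ← halfBlock_mul_add]
  simp only [mul_assoc]

/-- The logarithm of the limit `exp (-π i J)` of `Tee` is supported on the word `(1)`. -/
lemma tendsto_teen_stripTop (c : ℂ) {w : List ℕ} (hw : ∀ s ∈ w, 1 ≤ s) (hw1 : w ≠ [1]) :
    Tendsto (fun z => Teen c z w) stripTop (𝓝 0) := by
  have h := (mtendsto_tee_stripTop c).log (tee_nil c) (expOne_nil _) w hw
  rwa [log_expOne_apply _ hw1] at h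

end

end MouldAlg

/-! ### Fourier expansions -/

open UpperHalfPlane in
/-- A `1`-periodic function, holomorphic on the upper half-plane, that tends to `0` at `i ∞` is the
sum of its Fourier series there. -/
lemma hasSum_fourierAt_of_im_pos {T : ℂ → ℂ} (hper : Function.Periodic T 1)
    (hdiff : ∀ z : ℂ, 0 < z.im → DifferentiableAt ℂ T z)
    (hlim : Tendsto T MouldAlg.stripTop (𝓝 0)) {z : ℂ} (hz : 0 < z.im) :
    HasSum (fun n : ℕ => fourierAt T (-(n + 1)) * Complex.exp (-freq (-(n + 1)) * z)) (T z) := by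
  set f : ℍ → ℂ := fun τ => T τ with hf
  have hval : ∀ x : ℂ, 0 < x.im → (f ∘ ofComplex) x = T x := fun x hx => by
    simp only [hf, Function.comp_apply, ofComplex_apply_of_im_pos hx]
  have hfper : Function.Periodic (f ∘ ofComplex) ((1 : ℝ) : ℂ) := by
    intro x
    by_cases hx : 0 < x.im
    · rw [hval x hx, hval _ (by simpa using hx), Complex.ofReal_one, hper]
    · simp only [Function.comp_apply]
      rw [ofComplex_apply_of_im_nonpos (not_lt.1 hx),
        ofComplex_apply_of_im_nonpos (by simpa using hx)]
  have hfhol : MDifferentiable (modelWithCornersSelf ℂ ℂ) (modelWithCornersSelf ℂ ℂ) f := by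
    rw [mdifferentiable_iff]
    intro x hx
    refine ((hdiff x hx).congr_of_eventuallyEq ?_).differentiableWithinAt
    filter_upwards [(isOpen_lt continuous_const Complex.continuous_im).mem_nhds hx] with y hy
    exact hval y hy
  have hzero : IsZeroAtImInfty f := by
    rw [isZeroAtImInfty_iff]
    intro ε hε
    have h1 : ∀ᶠ x in MouldAlg.stripTop, ‖T x‖ < ε := by
      simpa using hlim.norm.eventually (gt_mem_nhds (by simpa using hε))
    rw [MouldAlg.stripTop, eventually_inf_principal, eventually_comap] at h1
    obtain ⟨A, hA⟩ := eventually_atTop.1 h1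
    refine ⟨A, fun τ hτ => ?_⟩
    have h2 : T (τ : ℂ) = T (τ - (⌊(τ : ℂ).re⌋ : ℤ) * (1 : ℂ)) :=
      (hper.sub_int_mul_eq ⌊(τ : ℂ).re⌋).symm
    change ‖T τ‖ ≤ ε
    rw [h2]
    refine (hA (τ : ℂ).im hτ _ (by simp) ⟨?_, ?_⟩).le
    · simp
    · simpa using (Int.fract_lt_one _).le
  have hbdd : IsBoundedAtImInfty f := hzero.isBoundedAtImInfty
  have hsum := hasSum_qExpansion one_pos hfper hfhol hbdd ⟨z, hz⟩
  -- no constant term, as the function vanishes at the cusp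
  have h0 : PowerSeries.coeff 0 (qExpansion 1 f) = 0 := by
    rw [qExpansion_coeff]
    simp [hzero.cuspFunction_apply_zero one_pos]
  rw [← hasSum_nat_add_iff' 1] at hsum
  simp only [Finset.sum_range_one, h0, zero_smul, sub_zero] at hsum
  refine hsum.congr_fun ?_
  intro n
  rw [qExpansion_coeff_eq_intervalIntegral one_pos hfper hfhol hbdd (n + 1) one_pos, smul_eq_mul]
  have hq : ∀ x : ℂ, Function.Periodic.qParam 1 x ^ (n + 1)
      = Complex.exp (-freq (-(n + 1)) * x) := by
    intro x
    rw [Function.Periodic.qParam, ← Complex.exp_nat_mul]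
    congr 1
    simp [freq]; ring
  rw [hq]
  congr 1
  have hsgn : ((-((n : ℤ) + 1)).sign : ℂ) = -1 := by
    rw [Int.sign_eq_neg_one_of_neg (by omega)]; simp
  simp only [fourierAt, hsgn, hq, Complex.ofReal_one, div_one, one_mul]
  refine intervalIntegral.integral_congr fun x _ => ?_
  simp only [hf, neg_mul, Complex.exp_neg, one_mul, one_div, inv_inv, sub_neg_eq_add,
    show ((UpperHalfPlane.I : ℍ) : ℂ) = Complex.I from rfl]
  ring

/-- Reflection of Fourier coefficients for functions with a parity. -/
lemma fourierAt_of_reflection {T : ℂ → ℂ} (hper : Function.Periodic T 1) {a : ℂ}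
    (hpar : ∀ x : ℝ, T (x - Complex.I) = a * T (-(x - Complex.I))) (n : ℕ) :
    fourierAt T (n + 1) = a * fourierAt T (-(n + 1)) := by
  have hs1 : (((n : ℤ) + 1).sign : ℂ) = 1 := by
    rw [Int.sign_eq_one_of_pos (by omega)]; simp
  have hs2 : ((-((n : ℤ) + 1)).sign : ℂ) = -1 := by
    rw [Int.sign_eq_neg_one_of_neg (by omega)]; simp
  simp only [fourierAt, hs1, hs2, one_mul, neg_mul, sub_neg_eq_add]
  rw [← intervalIntegral.integral_const_mul]
  -- substitute `1 - x` for `x` and use periodicity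
  have h := intervalIntegral.integral_comp_sub_left (a := 0) (b := 1) (fun x : ℝ =>
    a * (T (x + Complex.I) * Complex.exp (freq (-(n + 1)) * (x + Complex.I)))) 1
  rw [sub_self, sub_zero] at h
  rw [← h]
  refine intervalIntegral.integral_congr fun x _ => ?_
  have e1 : (((1 - x : ℝ) : ℂ) + Complex.I) = -(x - Complex.I) + 1 := by push_cast; ring
  have e2 : freq (-((n : ℤ) + 1)) * (-(x - Complex.I) + 1)
      = freq (n + 1) * (x - Complex.I)
        + ((-((n : ℤ) + 1) : ℤ) : ℂ) * (2 * Real.pi * Complex.I) := by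
    simp only [freq]; push_cast; ring
  rw [e1, hper, e2, Complex.exp_periodic.int_mul, hpar]
  ring

namespace MouldAlg

noncomputable section

lemma ne_intCast_of_im_ne_zero {z : ℂ} (hz : z.im ≠ 0) (n : ℤ) : z ≠ n := by
  rintro rfl
  simp at hz

lemma teen_neg_apply (c z : ℂ) {w : List ℕ} (hw : ∀ s ∈ w, 1 ≤ s) :
    Teen c (-z) w = -(-1) ^ (w.sum + w.length) * Teen c z w := by
  have h := posEq_teen_neg c z w hw
  rw [neg_apply, parity_apply, ← neg_mul] at h
  exact h

lemma tan_neg_apply (c z : ℂ) {w : List ℕ} (hw : ∀ s ∈ w, 1 ≤ s) :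
    Tan c (-z) w = -(-1) ^ (w.sum + w.length) * Tan c z w := by
  have h := posEq_tan_neg c z w hw
  rw [neg_apply, parity_apply, ← neg_mul] at h
  exact h

lemma hasSum_teen_of_im_pos (c : ℂ) {w : List ℕ} (hw : ∀ s ∈ w, 1 ≤ s) (hw1 : w ≠ [1]) {z : ℂ}
    (hz : 0 < z.im) :
    HasSum (fun n : ℕ => TeenOmega c (-(n + 1)) w * Complex.exp (-freq (-(n + 1)) * z))
      (Teen c z w) :=
  hasSum_fourierAt_of_im_pos (teen_periodic c hw)
    (fun _ hx => mdiffAt_teen (ne_intCast_of_im_ne_zero hx.ne') w hw)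
    (tendsto_teen_stripTop c hw hw1) hz

/-- The southern expansion is the reflection of the northern one. -/
lemma hasSum_teen_of_im_neg (c : ℂ) {w : List ℕ} (hw : ∀ s ∈ w, 1 ≤ s) (hw1 : w ≠ [1]) {z : ℂ}
    (hz : z.im < 0) :
    HasSum (fun n : ℕ => TeenOmega c (n + 1) w * Complex.exp (-freq (n + 1) * z))
      (Teen c z w) := by
  set a : ℂ := -(-1) ^ (w.sum + w.length)
  have h := (hasSum_teen_of_im_pos c hw hw1 (z := -z) (by simpa using hz)).mul_left a
  have hpar : ∀ x : ℂ, Teen c x w = a * Teen c (-x) w := fun x => by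
    rw [← teen_neg_apply c (-x) hw, neg_neg]
  rw [← hpar] at h
  refine h.congr_fun fun n => ?_
  have h1 : TeenOmega c (n + 1) w = a * TeenOmega c (-(n + 1)) w :=
    fourierAt_of_reflection (teen_periodic c hw) (fun x => hpar _) n
  have h2 : -freq (n + 1) * z = -freq (-(n + 1)) * -z := by
    simp only [freq]; push_cast; ring
  rw [h1, h2, mul_assoc]

/-- `Tan` at a word is a linear combination of values of `Teen`, with the same constant coefficients
as in the composition of any scalar mould with `K`. -/
lemma exists_tan_eq_sum (c : ℂ) {w : List ℕ} (hw : ∀ s ∈ w, 1 ≤ s) :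
    ∃ (a : Composition w.length → ℂ) (v : Composition w.length → List ℕ),
      (∀ p, IsCoarsening w (v p)) ∧ (∀ z, Tan c z w = ∑ p, Teen c z (v p) * a p) ∧
      ∀ M : Mould, mouldComp M KMould w = ∑ p, M (v p) * a p := by
  obtain ⟨a, v, hv, h⟩ := exists_comp_eq_sum (of KMould) w
  exact ⟨a, v, hv, fun z => (posEq_tan c z w hw).trans (h _), fun M => h (of M)⟩

/-- The words that occur in `Teen ∘ K` at a word other than `(1)` are themselves other
than `(1)`. -/
lemma IsCoarsening.ne_singleton_one {w v : List ℕ} (h : IsCoarsening w v)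
    (hw : ∀ s ∈ w, 1 ≤ s) (hw1 : w ≠ [1]) : v ≠ [1] := by
  rintro rfl
  have h1 := h.sum_eq
  have h2 := h.length_le
  rcases w with _ | ⟨s, _ | ⟨t, u⟩⟩
  · simp at h2
  · simp at h1; exact hw1 (by simp [h1])
  · have hs := hw s (by simp)
    have ht := hw t (by simp)
    simp at h1
    omega

lemma hasSum_tan_of_teen {c : ℂ} {w : List ℕ} (hw : ∀ s ∈ w, 1 ≤ s) {z : ℂ} {m : ℕ → ℤ}
    (hm : ∀ n, TanOmega c (m n) w = mouldComp (TeenOmega c (m n)) KMould w) {e : ℕ → ℂ}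
    (h : ∀ v, IsCoarsening w v → HasSum (fun n => TeenOmega c (m n) v * e n) (Teen c z v)) :
    HasSum (fun n => TanOmega c (m n) w * e n) (Tan c z w) := by
  obtain ⟨a, v, hv, h1, h2⟩ := exists_tan_eq_sum c hw
  rw [h1]
  refine (hasSum_sum fun p _ => (h (v p) (hv p)).mul_right (a p)).congr_fun fun n => ?_
  rw [hm, h2, Finset.sum_mul]
  exact Finset.sum_congr rfl fun p _ => by ring

/-- Composition at a given word is a finite linear combination, which commutes with integration. -/
lemma tanOmega_eq_comp (c : ℂ) {w : List ℕ} (hw : ∀ s ∈ w, 1 ≤ s) {m : ℤ} (hm : m ≠ 0) :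
    TanOmega c m w = mouldComp (TeenOmega c m) KMould w := by
  obtain ⟨a, v, hv, h1, h2⟩ := exists_tan_eq_sum c hw
  rw [h2]
  simp only [TanOmega, TeenOmega, fourierAt, h1, Finset.sum_mul]
  have him : ∀ x : ℝ, ((x : ℂ) - (m.sign : ℂ) * Complex.I).im ≠ 0 := by
    intro x
    have : (m.sign : ℝ) ≠ 0 := by exact_mod_cast (Int.sign_eq_zero_iff_zero.not.2 hm)
    simpa using this
  rw [intervalIntegral.integral_finsetSum]
  · refine Finset.sum_congr rfl fun p _ => ?_
    rw [← intervalIntegral.integral_mul_const]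
    refine intervalIntegral.integral_congr fun x _ => ?_
    ring
  · intro p _
    refine Continuous.intervalIntegrable ?_ _ _
    have hT : Continuous fun x : ℝ => Teen c ((x : ℂ) - (m.sign : ℂ) * Complex.I) (v p) := by
      refine continuous_iff_continuousAt.2 fun x => ?_
      have h := (mdiffAt_teen (c := c) (ne_intCast_of_im_ne_zero (him x)) (v p)
        ((hv p).pos hw)).continuousAt
      exact ContinuousAt.comp (f := fun x : ℝ => (x : ℂ) - (m.sign : ℂ) * Complex.I) h
        (by fun_prop)
    exact (hT.mul continuous_const).mul (by fun_prop)

end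

end MouldAlg

/-! ### Laplace transforms and the convolutive model -/

section Laplace

open MeasureTheory Set

/-- `F` is the Laplace transform of the function `f` of polynomial growth on the half-line. -/
structure HasLaplace (f : ℝ → ℝ) (F : ℂ → ℂ) : Prop where
  growth : ∃ C : ℝ, ∃ p : ℕ, 0 ≤ C ∧ ∀ x : ℝ, 0 ≤ x → |f x| ≤ C * (1 + x) ^ p
  integrableOn : ∀ z : ℂ, 0 < z.re →
    IntegrableOn (fun x : ℝ => (f x : ℂ) * Complex.exp (-((x : ℂ) * z))) (Ioi 0)
  eq_integral : ∀ z : ℂ, 0 < z.re →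
    F z = ∫ x in Ioi (0 : ℝ), (f x : ℂ) * Complex.exp (-((x : ℂ) * z))

lemma norm_exp_neg_ofReal_mul (x : ℝ) (z : ℂ) :
    ‖Complex.exp (-((x : ℂ) * z))‖ = Real.exp (-(z.re * x)) := by
  rw [Complex.norm_exp]; simp [mul_comm]

/-- A polynomial is dominated by `exp (Re z / 2 * x)`, up to a constant. -/
lemma integrableOn_of_growth {f : ℝ → ℝ} {z : ℂ} (hz : 0 < z.re)
    (hm : AEStronglyMeasurable (fun x : ℝ => (f x : ℂ) * Complex.exp (-((x : ℂ) * z)))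
      (volume.restrict (Ioi 0))) {C : ℝ} {p : ℕ} (hC : 0 ≤ C)
    (h : ∀ x : ℝ, 0 ≤ x → |f x| ≤ C * (1 + x) ^ p) :
    IntegrableOn (fun x : ℝ => (f x : ℂ) * Complex.exp (-((x : ℂ) * z))) (Ioi 0) := by
  set b := z.re / 2 with hb
  have hb0 : 0 < b := by positivity
  have hint := (exp_neg_integrableOn_Ioi 0 hb0).const_mul
    (C * ((p.factorial : ℝ) / b ^ p * Real.exp b))
  refine Integrable.mono' hint hm ?_
  filter_upwards [ae_restrict_mem measurableSet_Ioi] with x hx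
  have hx0 : 0 ≤ x := (mem_Ioi.1 hx).le
  rw [norm_mul, norm_exp_neg_ofReal_mul, Complex.norm_real, Real.norm_eq_abs]
  have h1 : (1 + x) ^ p ≤ (p.factorial : ℝ) / b ^ p * Real.exp (b * (1 + x)) := by
    have h2 := Real.pow_div_factorial_le_exp _ (by positivity : 0 ≤ b * (1 + x)) p
    rw [mul_pow, div_le_iff₀ (by positivity)] at h2
    rw [div_mul_eq_mul_div, le_div_iff₀ (by positivity)]
    linarith
  calc |f x| * Real.exp (-(z.re * x))
      ≤ (C * ((p.factorial : ℝ) / b ^ p * Real.exp (b * (1 + x)))) * Real.exp (-(z.re * x)) := by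
        gcongr
        exact (h x hx0).trans (by gcongr)
    _ = C * ((p.factorial : ℝ) / b ^ p * Real.exp b) * Real.exp (-b * x) := by
        have e : Real.exp (b * (1 + x)) * Real.exp (-(z.re * x))
            = Real.exp b * Real.exp (-b * x) := by
          rw [← Real.exp_add, ← Real.exp_add, hb]; congr 1; ring
        linear_combination C * ((p.factorial : ℝ) / b ^ p) * e

lemma tendsto_laplace_add_nat {f : ℝ → ℝ} {z : ℂ}
    (h : IntegrableOn (fun x : ℝ => (f x : ℂ) * Complex.exp (-((x : ℂ) * z))) (Ioi 0)) :
    Tendsto (fun n : ℕ => ∫ x in Ioi (0 : ℝ), (f x : ℂ) * Complex.exp (-((x : ℂ) * (z + n))))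
      atTop (𝓝 0) := by
  have e : ∀ (n : ℕ) (x : ℝ), (f x : ℂ) * Complex.exp (-((x : ℂ) * (z + n)))
      = (f x : ℂ) * Complex.exp (-((x : ℂ) * z)) * (Complex.exp (-(x : ℂ))) ^ n := by
    intro n x
    rw [← Complex.exp_nat_mul, mul_assoc, ← Complex.exp_add]
    congr 2; ring
  have hn : ∀ x : ℝ, 0 < x → ‖Complex.exp (-(x : ℂ))‖ < 1 := by
    intro x hx
    rw [Complex.norm_exp]; simpa using hx
  rw [← integral_zero ℝ ℂ (μ := volume.restrict (Ioi 0))]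
  refine tendsto_integral_of_dominated_convergence
    (fun x => ‖(f x : ℂ) * Complex.exp (-((x : ℂ) * z))‖) (fun n => ?_) h.norm (fun n => ?_) ?_
  · simp only [e]
    exact h.aestronglyMeasurable.mul (by fun_prop)
  · filter_upwards [ae_restrict_mem measurableSet_Ioi] with x hx
    rw [e, norm_mul, norm_pow]
    exact mul_le_of_le_one_right (norm_nonneg _) (pow_le_one₀ (norm_nonneg _) (hn x hx).le)
  · filter_upwards [ae_restrict_mem measurableSet_Ioi] with x hx
    simp only [e]
    simpa using (tendsto_pow_atTop_nhds_zero_of_norm_lt_one (hn x hx)).const_mul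
      ((f x : ℂ) * Complex.exp (-((x : ℂ) * z)))

lemma convolution_mul_exp (f g : ℝ → ℝ) (z : ℂ) (x : ℝ) :
    ((∫ t in (0 : ℝ)..x, f (x - t) * g t : ℝ) : ℂ) * Complex.exp (-((x : ℂ) * z))
      = ∫ t in (0 : ℝ)..x, ContinuousLinearMap.mul ℝ ℂ ((g t : ℂ) * Complex.exp (-((t : ℂ) * z)))
        ((f (x - t) : ℂ) * Complex.exp (-(((x - t : ℝ) : ℂ) * z))) := by
  rw [← intervalIntegral.integral_ofReal, ← intervalIntegral.integral_mul_const]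
  refine intervalIntegral.integral_congr fun t _ => ?_
  have e : Complex.exp (-((x : ℂ) * z))
      = Complex.exp (-((t : ℂ) * z)) * Complex.exp (-(((x - t : ℝ) : ℂ) * z)) := by
    rw [← Complex.exp_add]; congr 1; push_cast; ring
  simp only [ContinuousLinearMap.mul_apply', Complex.ofReal_mul, e]
  ring

lemma abs_convolution_le {f g : ℝ → ℝ} {C D : ℝ} {p q : ℕ} (hC : 0 ≤ C) (hD : 0 ≤ D)
    (hf : ∀ x : ℝ, 0 ≤ x → |f x| ≤ C * (1 + x) ^ p)
    (hg : ∀ x : ℝ, 0 ≤ x → |g x| ≤ D * (1 + x) ^ q) {x : ℝ} (hx : 0 ≤ x) :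
    |∫ t in (0 : ℝ)..x, f (x - t) * g t| ≤ C * D * x * (1 + x) ^ (p + q) := by
  have h := intervalIntegral.norm_integral_le_of_norm_le_const (a := 0) (b := x)
    (f := fun t => f (x - t) * g t) (C := C * D * (1 + x) ^ (p + q)) (fun t ht => ?_)
  · rw [Real.norm_eq_abs, sub_zero, abs_of_nonneg hx] at h
    linarith
  · rw [uIoc_of_le hx] at ht
    rw [norm_mul, Real.norm_eq_abs, Real.norm_eq_abs]
    have h1 : 0 ≤ x - t := by linarith [ht.2]
    have h2 : 0 ≤ t := ht.1.le
    calc |f (x - t)| * |g t| ≤ (C * (1 + x) ^ p) * (D * (1 + x) ^ q) := by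
          refine mul_le_mul ((hf _ h1).trans ?_) ((hg _ h2).trans ?_) (abs_nonneg _) (by positivity)
          · gcongr; linarith
          · gcongr; exact ht.2
      _ = C * D * (1 + x) ^ (p + q) := by ring

/-- The Laplace transform turns convolutions into products. -/
lemma HasLaplace.convolution {f g : ℝ → ℝ} {F G : ℂ → ℂ} (hf : HasLaplace f F)
    (hg : HasLaplace g G) :
    HasLaplace (fun x => ∫ t in (0 : ℝ)..x, f (x - t) * g t) (fun z => F z * G z) where
  growth := by
    obtain ⟨C, p, hC, h⟩ := hf.growth
    obtain ⟨D, q, hD, h'⟩ := hg.growth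
    refine ⟨C * D, p + q + 1, by positivity, fun x hx => ?_⟩
    refine (abs_convolution_le hC hD h h' hx).trans ?_
    rw [pow_succ, mul_assoc (C * D), mul_comm x]
    gcongr
    linarith
  integrableOn z hz := by
    have h := integrable_posConvolution (hg.integrableOn z hz) (hf.integrableOn z hz)
      (ContinuousLinearMap.mul ℝ ℂ)
    rw [posConvolution, integrable_indicator_iff measurableSet_Ioi] at h
    simpa only [convolution_mul_exp] using h
  eq_integral z hz := by
    simp only [convolution_mul_exp]
    rw [integral_posConvolution (hg.integrableOn z hz) (hf.integrableOn z hz),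
      ContinuousLinearMap.mul_apply', ← hf.eq_integral z hz, ← hg.eq_integral z hz, mul_comm]

lemma hasLaplace_one : HasLaplace (fun _ => 1) (fun z => z⁻¹) where
  growth := ⟨1, 0, zero_le_one, by simp⟩
  integrableOn z hz := by
    simpa [mul_comm] using integrableOn_exp_mul_complex_Ioi (a := -z) (by simpa using hz) 0
  eq_integral z hz := by
    have h := integral_exp_mul_complex_Ioi (a := -z) (by simpa using hz) 0
    simp only [Complex.ofReal_one, one_mul]
    simpa [mul_comm, neg_div] using h.symm

lemma hasLaplace_pow (n : ℕ) :
    HasLaplace (fun x => x ^ n / (n.factorial : ℝ)) (fun z => (z ^ (n + 1))⁻¹) := by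
  induction n with
  | zero => simpa using hasLaplace_one
  | succ n ih =>
    convert hasLaplace_one.convolution ih using 2 with x z
    · simp only [one_mul]
      rw [intervalIntegral.integral_div, integral_pow, Nat.factorial_succ]
      push_cast
      field_simp
      simp
    · rw [pow_succ' z (n + 1), mul_inv]

lemma hasLaplace_letter {s : ℕ} (hs : 1 ≤ s) :
    HasLaplace (fun x => x ^ (s - 1) / ((s - 1).factorial : ℝ)) (fun z => (z ^ s)⁻¹) := by
  have h := hasLaplace_pow (s - 1)
  rwa [Nat.sub_add_cancel hs] at h

lemma hfun_neg (x : ℝ) : Hfun (-x) = -Hfun x := by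
  rw [Hfun, Hfun, neg_div, Real.cosh_neg, Real.sinh_neg]; ring

@[simp] lemma hfun_zero : Hfun 0 = 0 := by simp [Hfun]

/-- The pole of `H` at the origin is simple, and `H` is bounded at infinity. At `x = 0` the
convention `Hfun 0 = 0` is harmless. -/
lemma abs_hfun_mul_le {x : ℝ} (hx : 0 ≤ x) : |Hfun (-x)| * x ≤ 1 + x := by
  rcases hx.eq_or_lt with rfl | hx
  · simp
  have hy : 0 < x / 2 := by positivity
  have h1 : x / 2 ≤ Real.sinh (x / 2) := Real.self_le_sinh_iff.2 hy.le
  have h2 : 0 < Real.sinh (x / 2) := hy.trans_le h1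
  have h3 : Real.cosh (x / 2) ≤ 1 + Real.sinh (x / 2) := by
    have h4 : Real.exp (-(x / 2)) ≤ 1 := Real.exp_le_one_iff.2 (by linarith)
    rw [← Real.cosh_sub_sinh] at h4
    linarith
  rw [hfun_neg, abs_neg, Hfun, abs_mul, abs_div, abs_of_pos h2, abs_of_pos (Real.cosh_pos _),
    abs_neg, abs_of_pos (by norm_num : (0 : ℝ) < 1 / 2), mul_div_assoc', div_mul_eq_mul_div,
    div_le_iff₀ h2]
  nlinarith [mul_le_mul_of_nonneg_left h3 hy.le]

/-- `(1 - e^x) H(x) = (1 + e^x) / 2`. -/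
lemma hfun_mul_one_sub_exp {x : ℝ} (hx : x ≠ 0) :
    Hfun x * (1 - Real.exp x) = (1 + Real.exp x) / 2 := by
  have h2 : Real.sinh (x / 2) ≠ 0 := by simpa [Real.sinh_eq_zero] using hx
  have h3 : Real.exp x = Real.exp (x / 2) ^ 2 := by
    rw [← Real.exp_nat_mul]; congr 1; push_cast; ring
  have h4 := Real.cosh_add_sinh (x / 2)
  have h5 := Real.cosh_sq (x / 2)
  rw [Hfun, h3, ← h4]
  field_simp
  linear_combination (Real.cosh (x / 2) + Real.sinh (x / 2)) * h5

lemma measurable_hfun : Measurable Hfun := by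
  unfold Hfun
  fun_prop

/-- Multiplication by `H(-ζ)` corresponds to the solution of the difference equation
`F(z) - F(z + 1) = (G(z) + G(z + 1)) / 2`. -/
lemma HasLaplace.hfun_mul {g : ℝ → ℝ} {G : ℂ → ℂ} (hg : HasLaplace g G) {C : ℝ} {p : ℕ}
    (hC : 0 ≤ C) (h : ∀ x : ℝ, 0 ≤ x → |g x| ≤ C * x * (1 + x) ^ p) :
    ∃ F, HasLaplace (fun x => Hfun (-x) * g x) F ∧
      ∀ z : ℂ, 0 < z.re → F z - F (z + 1) = 1 / 2 * (G z + G (z + 1)) := by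
  have hgr : ∀ x : ℝ, 0 ≤ x → |Hfun (-x) * g x| ≤ C * (1 + x) ^ (p + 1) := by
    intro x hx
    rw [abs_mul]
    calc |Hfun (-x)| * |g x| ≤ |Hfun (-x)| * (C * x * (1 + x) ^ p) := by gcongr; exact h x hx
      _ = C * (1 + x) ^ p * (|Hfun (-x)| * x) := by ring
      _ ≤ C * (1 + x) ^ p * (1 + x) := by gcongr; exact abs_hfun_mul_le hx
      _ = C * (1 + x) ^ (p + 1) := by ring
  have hint : ∀ z : ℂ, 0 < z.re → IntegrableOn
      (fun x : ℝ => ((Hfun (-x) * g x : ℝ) : ℂ) * Complex.exp (-((x : ℂ) * z))) (Ioi 0) := by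
    intro z hz
    refine integrableOn_of_growth hz ?_ hC hgr
    have h1 : Measurable fun x : ℝ => (Hfun (-x) : ℂ) :=
      Complex.measurable_ofReal.comp (measurable_hfun.comp measurable_neg)
    refine (h1.aestronglyMeasurable.mul (hg.integrableOn z hz).aestronglyMeasurable).congr ?_
    exact Eventually.of_forall fun x => by simp [mul_assoc]
  refine ⟨fun z => ∫ x in Ioi (0 : ℝ), ((Hfun (-x) * g x : ℝ) : ℂ) * Complex.exp (-((x : ℂ) * z)),
    ⟨⟨C, p + 1, hC, hgr⟩, hint, fun _ _ => rfl⟩, fun z hz => ?_⟩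
  have hz1 : 0 < (z + 1).re := by simp; linarith
  rw [hg.eq_integral z hz, hg.eq_integral _ hz1, ← integral_sub (hint z hz) (hint _ hz1),
    ← integral_add (hg.integrableOn z hz) (hg.integrableOn _ hz1), ← integral_const_mul]
  refine setIntegral_congr_fun measurableSet_Ioi fun x hx => ?_
  have hx0 : -x ≠ 0 := neg_ne_zero.2 (mem_Ioi.1 hx).ne'
  have h1 : (Hfun (-x) : ℂ) * (1 - Complex.exp (-(x : ℂ))) = (1 + Complex.exp (-(x : ℂ))) / 2 := by
    exact_mod_cast congrArg (fun t : ℝ => (t : ℂ)) (hfun_mul_one_sub_exp hx0)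
  have e : Complex.exp (-((x : ℂ) * (z + 1)))
      = Complex.exp (-((x : ℂ) * z)) * Complex.exp (-(x : ℂ)) := by
    rw [← Complex.exp_add]; congr 1; ring
  simp only [e, Complex.ofReal_mul]
  linear_combination (g x : ℂ) * Complex.exp (-((x : ℂ) * z)) * h1

end Laplace

namespace MouldAlg

noncomputable section

/-- `See₊` tends to `0` along `z + ℕ` at the words with `s₁ ≠ 1`, for which the factor
`exp (-c J)` acts trivially. -/
lemma tendsto_seePlus_add_nat (c z : ℂ) {w : List ℕ} (hw : ∀ s ∈ w, 1 ≤ s) (hne : w ≠ [])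
    (hhead : w.head? ≠ some 1) :
    Tendsto (fun n : ℕ => SeePlus c (z + n) w) atTop (𝓝 0) := by
  have hD : ∀ y ∈ baseRegion, 1 ≤ ‖y‖ := fun y hy => by linarith [hy.2]
  have hev : ∀ᶠ n : ℕ in atTop, z + n ∈ baseRegion := by
    obtain ⟨N, hN⟩ := exists_nat_gt (‖z‖ + 4)
    filter_upwards [eventually_ge_atTop N] with n hn
    have hn' : (N : ℝ) ≤ n := by exact_mod_cast hn
    have h := add_nat_mem_baseRegion (hN.trans_le hn')
    exact ⟨h.1.le, h.2.le⟩
  have hnorm : Tendsto (fun n : ℕ => ‖z + n‖) atTop atTop := by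
    refine tendsto_atTop_mono (f := fun n : ℕ => (n : ℝ) + -‖z‖) (fun n => ?_)
      (tendsto_atTop_add_const_right _ _ tendsto_natCast_atTop_atTop)
    have := norm_sub_le (z + n) z
    rw [add_sub_cancel_left, Complex.norm_natCast] at this
    linarith
  have h1 : GrowthOn baseRegion 0 halfBlock := by
    have h1 : GrowthOn baseRegion 0 (fun _ => 1) := fun w _ => by
      simpa using isBigO_const_const ((1 : MouldAlg) w) (one_ne_zero (α := ℝ)) (𝓟 baseRegion)
    have h := ((growthOn_halfBlock hD).mono hD (by norm_num : (-1 : ℝ) ≤ 0)).add h1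
    simpa using h
  have h2 : GrowthOn baseRegion (-(1 / 4)) (fun x => normProdLim x - 1) := growthOn_normProdLim
  have h3 := ((h2.mul hD (growthOn_expOne_neg_log hD (ε := 1 / 8) (by norm_num))).mul hD
    h1).mtendsto_zero (by norm_num) hev hnorm w hw
  have h4 := (growthOn_halfBlock hD).mtendsto_zero (by norm_num) hev hnorm w hw
  have h5 := h3.add h4
  rw [zero_apply, add_zero] at h5
  refine h5.congr' ?_
  filter_upwards [hev] with n hn
  have h6 := posEq_seePlus (c := c) (z := z + n) (N := 0) (by simpa using hn) w hw
  refine Eq.trans ?_ h6.symm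
  rw [seeLim, seeTrunc_zero, Nat.cast_zero, add_zero, mul_assoc (expOne (-c) * _),
    mul_assoc (expOne (-c)),
    expOne_mul_apply_of_head _ _ hhead, sub_apply (halfBlock _), one_apply, if_neg hne, sub_zero,
    ← expOne_mul_apply_of_head (-Complex.log (z + n)) (halfBlock (z + n)) hhead, ← add_apply]
  congr 1
  noncomm_ring

/-- The difference equation of `See₊`, read at a word with last letter `s`. -/
lemma seePlus_append_sub (c z : ℂ) {w : List ℕ} {s : ℕ} (hw : ∀ t ∈ w ++ [s], 1 ≤ t) :
    SeePlus c z (w ++ [s]) - SeePlus c (z + 1) (w ++ [s])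
      = 1 / 2 * (SeePlus c z w * (z ^ s)⁻¹ + SeePlus c (z + 1) w * ((z + 1) ^ s)⁻¹) := by
  have h := posEq_seePlus_add_one c z _ hw
  rw [mul_sub, mul_add, mul_one, mul_one, mul_smul_comm, mul_smul_comm, sub_apply, add_apply,
    smul_apply, smul_apply, mul_mono_append, mul_mono_append] at h
  simp only at h
  linear_combination h

end

end MouldAlg

open MouldAlg MeasureTheory Set in
/-- The convolutive model: `See₊` is the Laplace transform of the solution of the corresponding
induction. Both sides satisfy the same difference equation and vanish at infinity. -/
lemma hasLaplace_hatSeeRev (c : ℂ) (u : List ℕ) (hu : ∀ s ∈ u, 1 ≤ s) (hne : u ≠ [])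
    (hlast : u.getLast? ≠ some 1) :
    HasLaplace (hatSeeRev u) (fun z => SeePlus c z u.reverse) := by
  -- a step of the induction: `g` is the preimage of `hatSeeRev (s :: u)` under `H`
  have step : ∀ (s : ℕ) (u : List ℕ), (∀ t ∈ s :: u, 1 ≤ t) → (s :: u).getLast? ≠ some 1 →
      ∀ (g : ℝ → ℝ) (G : ℂ → ℂ), HasLaplace g G →
      (∃ (C : ℝ) (p : ℕ), 0 ≤ C ∧ ∀ x : ℝ, 0 ≤ x → |g x| ≤ C * x * (1 + x) ^ p) →
      (∀ z : ℂ, 0 < z.re → G z = SeePlus c z u.reverse * (z ^ s)⁻¹) →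
      hatSeeRev (s :: u) = (fun x => Hfun (-x) * g x) →
      HasLaplace (hatSeeRev (s :: u)) (fun z => SeePlus c z (s :: u).reverse) := by
    intro s u hu hlast g G hg ⟨C, p, hC, hgr⟩ hG hhat
    obtain ⟨F, hF, hdiff⟩ := hg.hfun_mul hC hgr
    rw [hhat]
    -- the difference of the two sides is constant along `z + ℕ` and tends to `0`
    have key : ∀ z : ℂ, 0 < z.re → SeePlus c z (s :: u).reverse = F z := by
      intro z hz
      have hre : ∀ n : ℕ, 0 < (z + n).re := fun n => by
        rw [Complex.add_re, Complex.natCast_re]; positivity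
      have hpos : ∀ t ∈ (s :: u).reverse, 1 ≤ t := fun t ht => hu t (List.mem_reverse.1 ht)
      have hconst : ∀ n : ℕ, SeePlus c (z + n) (s :: u).reverse - F (z + n)
          = SeePlus c z (s :: u).reverse - F z := by
        intro n
        induction n with
        | zero => simp
        | succ n ih =>
          have h1 := hdiff (z + n) (hre n)
          have hre' := hre (n + 1)
          rw [Nat.cast_succ, ← add_assoc] at hre' ⊢
          rw [hG _ (hre n), hG _ hre'] at h1
          rw [List.reverse_cons] at hpos ih ⊢
          have h2 := seePlus_append_sub c (z + n) hpos
          linear_combination ih - h2 + h1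
      have hlim := (tendsto_seePlus_add_nat c z hpos (by simp)
        (by rwa [List.head?_reverse])).sub ((tendsto_laplace_add_nat (hF.integrableOn z hz)).congr
          fun n => (hF.eq_integral _ (hre n)).symm)
      simp only [hconst, sub_zero] at hlim
      exact sub_eq_zero.1 (tendsto_nhds_unique tendsto_const_nhds hlim)
    exact ⟨hF.growth, hF.integrableOn, fun z hz => (key z hz).trans (hF.eq_integral z hz)⟩
  induction u with
  | nil => exact absurd rfl hne
  | cons s u ih =>
    have hs : 1 ≤ s := hu s (by simp)
    have hm := hasLaplace_letter hs
    cases u with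
    | nil =>
      refine step s [] hu hlast _ _ hm ?_ (fun z _ => by simp) rfl
      have hs2 : s ≠ 1 := by simpa using hlast
      -- `s ≥ 2` provides the zero at the origin that compensates the pole of `H`
      obtain ⟨q, rfl⟩ : ∃ q, s = q + 2 := ⟨s - 2, by omega⟩
      refine ⟨1, q, zero_le_one, fun x hx => ?_⟩
      rw [show q + 2 - 1 = q + 1 by omega, abs_of_nonneg (by positivity), one_mul]
      calc x ^ (q + 1) / ((q + 1).factorial : ℝ) ≤ x ^ (q + 1) := by
            refine div_le_self (by positivity) ?_
            exact_mod_cast (q + 1).factorial_pos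
        _ = x * x ^ q := pow_succ' x q
        _ ≤ x * (1 + x) ^ q := by gcongr; linarith
    | cons t u =>
      have hu' : ∀ r ∈ t :: u, 1 ≤ r := fun r hr => hu r (List.mem_cons_of_mem s hr)
      have hlast' : (t :: u).getLast? ≠ some 1 := by rwa [List.getLast?_cons_cons] at hlast
      have hprev := ih hu' (by simp) hlast'
      refine step s (t :: u) hu hlast _ _ (hprev.convolution hm) ?_ (fun z _ => rfl) rfl
      obtain ⟨C, p, hC, h⟩ := hprev.growth
      obtain ⟨D, q, hD, h'⟩ := hm.growth
      exact ⟨C * D, p + q, by positivity, fun x hx => abs_convolution_le hC hD h h' hx⟩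

/-- Both `H` and the substitution `τ ↦ -τ` in the convolution integral contribute a sign. -/
lemma hatSeeRev_neg (u : List ℕ) (hu : ∀ s ∈ u, 1 ≤ s) (x : ℝ) :
    hatSeeRev u (-x) = -((-1) ^ (u.sum + u.length) * hatSeeRev u x) := by
  induction u generalizing x with
  | nil => simp [hatSeeRev]
  | cons s u ih =>
    obtain ⟨q, rfl⟩ : ∃ q, s = q + 1 := ⟨s - 1, by have := hu s (by simp); omega⟩
    have hpow : ∀ t : ℝ, (-t) ^ q = (-1) ^ q * t ^ q := fun t => neg_pow t q
    cases u with
    | nil =>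
      simp only [hatSeeRev, Nat.add_sub_cancel, hpow x, hfun_neg, List.sum_cons, List.sum_nil,
        List.length_cons, List.length_nil]
      ring
    | cons t u =>
      have ih' := ih (fun r hr => hu r (List.mem_cons_of_mem _ hr))
      simp only [hatSeeRev, Nat.add_sub_cancel]
      have h1 : ∫ τ in (0 : ℝ)..-x, hatSeeRev (t :: u) (-x - τ) * (τ ^ q / (q.factorial : ℝ))
          = (-1) ^ q * (-1) ^ ((t :: u).sum + (t :: u).length) *
            ∫ τ in (0 : ℝ)..x, hatSeeRev (t :: u) (x - τ) * (τ ^ q / (q.factorial : ℝ)) := by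
        have h2 := intervalIntegral.integral_comp_neg (a := 0) (b := x)
          (fun τ => hatSeeRev (t :: u) (-x - τ) * (τ ^ q / (q.factorial : ℝ)))
        rw [neg_zero] at h2
        rw [intervalIntegral.integral_symm, ← h2, ← intervalIntegral.integral_const_mul,
          ← intervalIntegral.integral_neg]
        refine intervalIntegral.integral_congr fun τ _ => ?_
        rw [show -x - -τ = -(x - τ) by ring]
        simp only [ih', hpow τ]
        ring
      rw [h1, hfun_neg, List.sum_cons (a := q + 1), List.length_cons (a := q + 1)]
      rw [show q + 1 + (t :: u).sum + ((t :: u).length + 1)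
        = q + ((t :: u).sum + (t :: u).length) + 2 by ring, pow_add, pow_add]
      ring

section Laplace

open MeasureTheory Set

variable {c : ℂ} {w : List ℕ}

lemma hasLaplace_hatSee (hw : ∀ s ∈ w, 1 ≤ s) (hne : w ≠ []) (hhead : w.head? ≠ some 1) :
    HasLaplace (hatSee w) (fun z => SeePlus c z w) := by
  have h := hasLaplace_hatSeeRev c w.reverse (fun s hs => hw s (List.mem_reverse.1 hs))
    (by simpa using hne) (by rwa [List.getLast?_reverse])
  rwa [List.reverse_reverse] at h

lemma hatSee_neg (hw : ∀ s ∈ w, 1 ≤ s) (x : ℝ) :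
    hatSee w (-x) = -((-1) ^ (w.sum + w.length) * hatSee w x) := by
  have h := hatSeeRev_neg w.reverse (fun s hs => hw s (List.mem_reverse.1 hs)) x
  rwa [List.sum_reverse, List.length_reverse] at h

lemma laplace_seeMinus (hw : ∀ s ∈ w, 1 ≤ s) (hne : w ≠ []) (hhead : w.head? ≠ some 1) {z : ℂ}
    (hz : z.re < 0) :
    IntegrableOn (fun x : ℝ => (hatSee w x : ℂ) * Complex.exp (-((x : ℂ) * z))) (Iio 0) ∧
      SeeMinus c z w = -∫ x in Iio (0 : ℝ), (hatSee w x : ℂ) * Complex.exp (-((x : ℂ) * z)) := by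
  have hz' : 0 < (-z).re := by simpa using hz
  have h := hasLaplace_hatSee (c := c) hw hne hhead
  set a : ℂ := (-1) ^ (w.sum + w.length)
  have haa : a * a = 1 := by rw [← mul_pow]; simp
  have e : ∀ x : ℝ, (hatSee w (-x) : ℂ) * Complex.exp (-(((-x : ℝ) : ℂ) * z))
      = -a * ((hatSee w x : ℂ) * Complex.exp (-((x : ℂ) * -z))) := by
    intro x
    rw [hatSee_neg hw]
    push_cast
    rw [show -(-(x : ℂ) * z) = -((x : ℂ) * -z) by ring]
    ring
  constructor
  · have h1 := IntegrableOn.congr_fun (Integrable.const_mul (h.integrableOn (-z) hz') (-a))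
      (fun x _ => (e x).symm) measurableSet_Ioi
    rw [← neg_zero] at h1
    simpa using h1.comp_neg_Iio
  · have h1 := integral_comp_neg_Ioi 0
      (fun x : ℝ => (hatSee w x : ℂ) * Complex.exp (-((x : ℂ) * z)))
    simp only [e] at h1
    rw [neg_zero, integral_Iic_eq_integral_Iio, integral_const_mul, ← h.eq_integral (-z) hz'] at h1
    rw [← h1, neg_mul, neg_neg]
    exact MouldAlg.posEq_seeMinus c z w hw

end Laplace

end

theorem mainTheorem4 (c : ℂ) (w : List ℕ) (hw : ∀ s ∈ w, 1 ≤ s) :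
    -- the limits that define the multitangents and the moulds `See₊`, `See₋` exist
    (∀ z : ℂ, (∀ n : ℤ, z ≠ n) →
      Filter.Tendsto (fun k => TeTrunc c k z w) Filter.atTop (nhds (Te c z w)) ∧
      Filter.Tendsto (fun k => mouldMul (invcoSe c k) (doSeePlus k z) w) Filter.atTop
        (nhds (SeePlus c z w)) ∧
      Filter.Tendsto (fun k => mouldMul (invcoSe c k) (doSeeMinus k z) w) Filter.atTop
        (nhds (SeeMinus c z w))) ∧
    -- for `s₁ ≠ 1`, `See₊` and `See₋` are the Laplace transforms of `See` along the two half-axes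
    (w ≠ [] → w.head? ≠ some 1 →
      (∀ z : ℂ, 0 < z.re →
        MeasureTheory.IntegrableOn
          (fun x : ℝ => (hatSee w x : ℂ) * Complex.exp (-((x : ℂ) * z))) (Set.Ioi 0) ∧
        SeePlus c z w =
          ∫ x in Set.Ioi (0 : ℝ), (hatSee w x : ℂ) * Complex.exp (-((x : ℂ) * z))) ∧
      (∀ z : ℂ, z.re < 0 →
        MeasureTheory.IntegrableOn
          (fun x : ℝ => (hatSee w x : ℂ) * Complex.exp (-((x : ℂ) * z))) (Set.Iio 0) ∧
        SeeMinus c z w =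
          -∫ x in Set.Iio (0 : ℝ), (hatSee w x : ℂ) * Complex.exp (-((x : ℂ) * z)))) ∧
    -- `Tan = Teen ∘ K`
    (∀ z : ℂ, (∀ n : ℤ, z ≠ n) → Tan c z w = mouldComp (Teen c z) KMould w) ∧
    -- for `s₁ ≠ 1`, `s_r ≠ 1`, the Fourier expansions with coefficients `Tan_ω` and `Teen_ω`
    (w.head? ≠ some 1 → w.getLast? ≠ some 1 →
      (∀ z : ℂ, 0 < z.im →
        HasSum (fun n : ℕ => TanOmega c (-(n + 1)) w * Complex.exp (-freq (-(n + 1)) * z))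
          (Tan c z w) ∧
        HasSum (fun n : ℕ => TeenOmega c (-(n + 1)) w * Complex.exp (-freq (-(n + 1)) * z))
          (Teen c z w)) ∧
      (∀ z : ℂ, z.im < 0 →
        HasSum (fun n : ℕ => TanOmega c (n + 1) w * Complex.exp (-freq (n + 1) * z))
          (Tan c z w) ∧
        HasSum (fun n : ℕ => TeenOmega c (n + 1) w * Complex.exp (-freq (n + 1) * z))
          (Teen c z w))) ∧
    -- `Tan_ω = Teen_ω ∘ K`
    (∀ m : ℤ, m ≠ 0 → TanOmega c m w = mouldComp (TeenOmega c m) KMould w) ∧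
    -- parity separation
    (∀ z : ℂ, (∀ n : ℤ, z ≠ n) →
      Teen c (-z) w = (-1 : ℂ) ^ (1 - (w.length : ℤ) + (w.sum : ℤ)) * Teen c z w ∧
      Tan c (-z) w = (-1 : ℂ) ^ (1 - (w.length : ℤ) + (w.sum : ℤ)) * Tan c z w) := by
  refine ⟨fun z _ => ⟨MouldAlg.mtendsto_teTrunc c z w hw, ?_, ?_⟩, fun hne hhead => ?_,
    fun z _ => MouldAlg.posEq_tan c z w hw, fun hhead _ => ?_,
    fun m hm => MouldAlg.tanOmega_eq_comp c hw hm, fun z _ => ?_⟩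
  · have h := MouldAlg.mtendsto_seePlus c z w hw
    simp only [← MouldAlg.of_seePlus_trunc] at h
    exact h
  · have h := MouldAlg.mtendsto_seeMinus c z w hw
    simp only [← MouldAlg.of_seeMinus_trunc] at h
    exact h
  · have h := hasLaplace_hatSee (c := c) hw hne hhead
    exact ⟨fun z hz => ⟨h.integrableOn z hz, h.eq_integral z hz⟩,
      fun z hz => laplace_seeMinus hw hne hhead hz⟩
  · have hw1 : w ≠ [1] := by rintro rfl; simp at hhead
    refine ⟨fun z hz => ⟨?_, MouldAlg.hasSum_teen_of_im_pos c hw hw1 hz⟩,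
      fun z hz => ⟨?_, MouldAlg.hasSum_teen_of_im_neg c hw hw1 hz⟩⟩
    · exact MouldAlg.hasSum_tan_of_teen hw
        (fun n => MouldAlg.tanOmega_eq_comp c hw (by omega)) fun v hv =>
        MouldAlg.hasSum_teen_of_im_pos c (hv.pos hw) (hv.ne_singleton_one hw hw1) hz
    · exact MouldAlg.hasSum_tan_of_teen hw
        (fun n => MouldAlg.tanOmega_eq_comp c hw (by omega)) fun v hv =>
        MouldAlg.hasSum_teen_of_im_neg c (hv.pos hw) (hv.ne_singleton_one hw hw1) hz
  -- both exponents have the parity of `1 + |w| + r`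
  · have hsign : (-1 : ℂ) ^ (1 - (w.length : ℤ) + (w.sum : ℤ)) = -(-1) ^ (w.sum + w.length) := by
      have e : 1 - (w.length : ℤ) + (w.sum : ℤ) = ((w.sum + w.length : ℕ) : ℤ) + 1
          + 2 * -(w.length : ℤ) := by push_cast; ring
      have h2 : (-1 : ℂ) ^ (2 * -(w.length : ℤ)) = 1 := by rw [zpow_mul]; norm_num
      rw [e, zpow_add₀ (by norm_num), zpow_add₀ (by norm_num), h2, zpow_natCast]
      simp
    rw [hsign]
    exact ⟨MouldAlg.teen_neg_apply c z hw, MouldAlg.tan_neg_apply c z hw⟩
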